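/- Let $\Omega\subset\mathbb R^p$ be an open neighbourhood of the origin, and let $f,g:\mathbb R_+\times\mathbb R\times\Omega\to\mathbb R^p$ (with $\mathbb R_+=[0,\infty)$) be smooth maps such that the Jacobian matrix $\frac{\partial f}{\partial u}(t,x,u)$ has $p$ real and distinct eigenvalues $\lambda_1(t,x,u)<\dots<\lambda_p(t,x,u)$ and such that each characteristic field is either genuinely nonlinear ($\nabla_u\lambda_j\cdot r_j\neq0$ everywhere) or linearly degenerate ($\nabla_u\lambda_j\cdot r_j=0$ everywhere), $r_j$ being the right eigenvectors. Set $q(t,x,u):=g(t,x,u)-\frac{\partial f}{\partial x}(t,x,u)$. Given $(t_0,x_0)\in\mathbb R_+\times\mathbb R$ and states $u_L,u_R$, let $W_C=W_C(\xi)$, $\xi=\frac{x-x_0}{t-t_0}$, denote the (Lax) solution of the classical Riemann problem $$\partial_tu+\partial_xf(t_0,x_0,u)=0\ \ (t>t_0),\qquad u(t_0,x)=u_L\ (x<x_0),\quad u(t_0,x)=u_R\ (x>x_0),$$ that is, a self-similar function consisting of constant states $u_L=u_0,u_1,\dots,u_p=u_R$ in which $u_{i-1}$ and $u_i$ are separated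 by an $i$-rarefaction wave, an $i$-shock satisfying the Rankine--Hugoniot relation and the Lax inequalities $\lambda_i(t_0,x_0,u_i)<\sigma_i<\lambda_i(t_0,x_0,u_{i-1})$, or an $i$-contact discontinuity (possibly of zero strength), the waves being ordered by increasing speeds. Define $$W_G(t,x):=W_C(\xi)+(t-t_0)\,q(t_0,x_0,W_C(\xi))\quad (t>t_0),$$ and let $W_G(t_0,\cdot)$ be the initial data, equal to $u_L$ for $x<x_0$ and to $u_R$ for $x>x_0$. **Proposition.** Let $T,X>0$. For every sufficiently small neighbourhood $\mathcal U$ of the origin in $\mathbb R^p$ (with a smallness depending only on $f$, $g$, $\Omega$, $T$, $X$) and every compact set $K\subset\Omega$, the following holds. Let $\theta:\mathbb R_+\times\mathbb R\to\mathbb R$ be a compactly supported $C^1$ function, $(t_0,x_0)\in\mathbb R_+\times\mathbb R$, and $u_L,u_R\in\mathcal U$ such that $W_C$ takes its values in $\mathcal U$. Let $s,r>0$ satisfy $t_0+s\le T$, $|x_0|+r\le X$ and the stability condition $$\frac sr\,\sup|\lambda_i(t,x,u)|\le1,$$ the supremum being taken over $1\le i\le p$, $(t,x)\in\mathbb R_+\times\mathbb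 R$ and $u\in\mathcal U$, and assume that $W_G$ takes its values in $K$ on $[t_0,t_0+s]\times[x_0-r,x_0+r]$. Then all the integrals below exist and $$\begin{aligned} &\int_{t_0}^{t_0+s}\!\int_{x_0-r}^{x_0+r}\big\{W_G\,\partial_t\theta+f(t,x,W_G)\,\partial_x\theta+g(t,x,W_G)\,\theta\big\}\,dx\,dt\\ &\quad=\int_{x_0-r}^{x_0+r}W_G(t_0+s,x)\,\theta(t_0+s,x)\,dx-\int_{x_0-r}^{x_0+r}W_G(t_0,x)\,\theta(t_0,x)\,dx\\ &\qquad+\int_{t_0}^{t_0+s}f(t,x_0+r,W_G(t,x_0+r))\,\theta(t,x_0+r)\,dt-\int_{t_0}^{t_0+s}f(t,x_0-r,W_G(t,x_0-r))\,\theta(t,x_0-r)\,dt+R, \end{aligned}$$ $$|R|\le C\,(s^2+r^2)\,\big(s+r+|u_R-u_L|\big)\,\|\theta\|_{C^1},\qquad \|\theta\|_{C^1}=\|\theta\|_{C^0}+\|\partial_t\theta\|_{C^0}+\|\partial_x\theta\|_{C^0},$$ where the constant $C$ depends only on $f$, $g$, $\Omega$, $T$, $X$ and $K$ (and not on $\mathcal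 U,\theta,t_0,x_0,u_L,u_R,s,r$). -/

import Mathlib

open Set MeasureTheory Topology
open scoped ContDiff

/-- The phase space `ℝ^p` with its Euclidean norm. -/
abbrev State (p : ℕ) : Type := EuclideanSpace ℝ (Fin p)

/-- The Jacobian matrix of a flux `F : ℝ^p → ℝ^p` at `u`, as an endomorphism of `ℝ^p`. -/
noncomputable def jacobian {p : ℕ} (F : State p → State p) (u : State p) :
    Module.End ℝ (State p) :=
  (fderiv ℝ F u).toLinearMap

/-- The `i`-th characteristic field is genuinely nonlinear: `∇λ_i · r_i ≠ 0` everywhere. -/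
def GenuinelyNonlinear {p : ℕ} (f : ℝ → ℝ → State p → State p)
    (lam : Fin p → ℝ → ℝ → State p → ℝ) (Ω : Set (State p)) (i : Fin p) : Prop :=
  ∀ t : ℝ, 0 ≤ t → ∀ x : ℝ, ∀ u ∈ Ω, ∀ r : State p,
    (jacobian (f t x) u).HasEigenvector (lam i t x u) r → fderiv ℝ (lam i t x) u r ≠ 0

/-- The `i`-th characteristic field is linearly degenerate: `∇λ_i · r_i = 0` everywhere. -/
def LinearlyDegenerate {p : ℕ} (f : ℝ → ℝ → State p → State p)
    (lam : Fin p → ℝ → ℝ → State p → ℝ) (Ω : Set (State p)) (i : Fin p) : Prop :=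
  ∀ t : ℝ, 0 ≤ t → ∀ x : ℝ, ∀ u ∈ Ω, ∀ r : State p,
    (jacobian (f t x) u).HasEigenvector (lam i t x u) r → fderiv ℝ (lam i t x) u r = 0

/-- The standing assumptions on the balance law `∂_t u + ∂_x f(t,x,u) = g(t,x,u)`: the maps `f`
and `g` are smooth on `[0,∞) × ℝ × Ω`, the matrix `∂f/∂u` has the `p` real distinct eigenvalues
`λ_1 < ... < λ_p` (which are thereby determined on `[0,∞) × ℝ × Ω`), and every characteristic
field is genuinely nonlinear or linearly degenerate. -/
structure IsHyperbolicSystem {p : ℕ} (f g : ℝ → ℝ → State p → State p)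
    (lam : Fin p → ℝ → ℝ → State p → ℝ) (Ω : Set (State p)) : Prop where
  smooth_flux : ContDiffOn ℝ ∞ (fun z : ℝ × ℝ × State p => f z.1 z.2.1 z.2.2)
    (Ici (0 : ℝ) ×ˢ (univ : Set ℝ) ×ˢ Ω)
  smooth_source : ContDiffOn ℝ ∞ (fun z : ℝ × ℝ × State p => g z.1 z.2.1 z.2.2)
    (Ici (0 : ℝ) ×ˢ (univ : Set ℝ) ×ˢ Ω)
  eigenvalue : ∀ t : ℝ, 0 ≤ t → ∀ x : ℝ, ∀ u ∈ Ω, ∀ i : Fin p,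
    (jacobian (f t x) u).HasEigenvalue (lam i t x u)
  distinct : ∀ t : ℝ, 0 ≤ t → ∀ x : ℝ, ∀ u ∈ Ω, StrictMono fun i : Fin p => lam i t x u
  fields : ∀ i : Fin p, GenuinelyNonlinear f lam Ω i ∨ LinearlyDegenerate f lam Ω i

/-! In the next definitions `F` is a flux depending on `u` only and `l` is one of the eigenvalues
of its Jacobian matrix, as a function of `u`. -/

/-- On `[σm, σp]`, the function `W` is a centered rarefaction wave from `um` to `up` of the
characteristic field with eigenvalue `l`. -/
def IsRarefaction {p : ℕ} (F : State p → State p) (l : State p → ℝ) (W : ℝ → State p)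
    (um up : State p) (σm σp : ℝ) : Prop :=
  σm < σp ∧ W σm = um ∧ W σp = up ∧ ContDiffOn ℝ 1 W (Icc σm σp) ∧
    ∀ ξ ∈ Icc σm σp, l (W ξ) = ξ ∧
      (jacobian F (W ξ)).HasEigenvector ξ (derivWithin W (Icc σm σp) ξ)

/-- The Rankine-Hugoniot relation for a jump from `um` to `up` with speed `σ`. -/
def RankineHugoniot {p : ℕ} (F : State p → State p) (um up : State p) (σ : ℝ) : Prop :=
  F up - F um = σ • (up - um)

/-- A shock wave: the Rankine-Hugoniot relation and the Lax shock inequalities. -/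
def IsShock {p : ℕ} (F : State p → State p) (l : State p → ℝ) (um up : State p) (σ : ℝ) :
    Prop :=
  RankineHugoniot F um up σ ∧ l up < σ ∧ σ < l um

/-- A contact discontinuity. The case `um = up` (a wave of zero strength) is included. -/
def IsContact {p : ℕ} (F : State p → State p) (l : State p → ℝ) (um up : State p) (σ : ℝ) :
    Prop :=
  RankineHugoniot F um up σ ∧ l up = σ ∧ σ = l um

/-- `W = W_C(ξ)`, with `ξ = (x - x₀) / (t - t₀)`, is the solution of the classical Riemann problem
for `∂_t u + ∂_x F(u) = 0` with left and right states `uL`, `uR`: there are constant states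
`uL = u_0, u_1, ..., u_p = uR` such that `(u_{i-1}, u_i)` is an `i`-rarefaction, an `i`-shock or an
`i`-contact, with lower and upper speeds `σm i ≤ σp i`, and `W` is equal to `u_i` between the
`i`-th and the `(i+1)`-st wave. At a jump, `W` is given one of the two adjacent values. -/
def IsClassicalRiemannSolution {p : ℕ} (F : State p → State p) (l : Fin p → State p → ℝ)
    (uL uR : State p) (W : ℝ → State p) : Prop :=
  ∃ (u : Fin (p + 1) → State p) (σm σp : Fin p → ℝ),
    u 0 = uL ∧ u (Fin.last p) = uR ∧
    (∀ i j : Fin p, i < j → σp i < σm j) ∧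
    (∀ i : Fin p,
      IsRarefaction F (l i) W (u i.castSucc) (u i.succ) (σm i) (σp i) ∨
      (σm i = σp i ∧ (W (σm i) = u i.castSucc ∨ W (σm i) = u i.succ) ∧
        (IsShock F (l i) (u i.castSucc) (u i.succ) (σm i) ∨
          IsContact F (l i) (u i.castSucc) (u i.succ) (σm i)))) ∧
    (∀ (k : Fin (p + 1)) (ξ : ℝ), (∀ j : Fin p, j.castSucc < k → σp j < ξ) →
      (∀ j : Fin p, k ≤ j.castSucc → ξ < σm j) → W ξ = u k)

/-- `q(t,x,u) = g(t,x,u) - ∂f/∂x(t,x,u)`. -/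
noncomputable def qMap {p : ℕ} (f g : ℝ → ℝ → State p → State p) (t x : ℝ) (u : State p) :
    State p :=
  g t x u - deriv (fun y : ℝ => f t y u) x

/-- The piecewise constant initial data, with a jump at `x₀`. -/
noncomputable def riemannData {p : ℕ} (uL uR : State p) (x₀ x : ℝ) : State p :=
  if x < x₀ then uL else uR

/-- The approximate solution `W_G(t,x) = W_C(ξ) + (t - t₀) q(t₀, x₀, W_C(ξ))` for `t > t₀`; at the
initial time it is the Riemann data. -/
noncomputable def approxSolution {p : ℕ} (f g : ℝ → ℝ → State p → State p) (W : ℝ → State p)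
    (uL uR : State p) (t₀ x₀ t x : ℝ) : State p :=
  if t ≤ t₀ then riemannData uL uR x₀ x
  else W ((x - x₀) / (t - t₀)) + (t - t₀) • qMap f g t₀ x₀ (W ((x - x₀) / (t - t₀)))

/-- `θ : [0,∞) × ℝ → ℝ` is of class `C^1` (up to `t = 0`) and compactly supported; the values of
`θ` at negative times play no role. -/
def IsTestFunction (θ : ℝ → ℝ → ℝ) : Prop :=
  ContDiffOn ℝ 1 (fun z : ℝ × ℝ => θ z.1 z.2) (Ici (0 : ℝ) ×ˢ (univ : Set ℝ)) ∧
    HasCompactSupport fun z : Ici (0 : ℝ) × ℝ => θ z.1 z.2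

/-- The time derivative on `[0,∞) × ℝ` (one-sided at `t = 0`). -/
noncomputable def dt (θ : ℝ → ℝ → ℝ) (t x : ℝ) : ℝ :=
  derivWithin (fun τ : ℝ => θ τ x) (Ici 0) t

/-- The space derivative. -/
noncomputable def dx (θ : ℝ → ℝ → ℝ) (t x : ℝ) : ℝ :=
  deriv (fun y : ℝ => θ t y) x

/-- The sup norm of a function on `[0,∞) × ℝ`. -/
noncomputable def normC0 (φ : ℝ → ℝ → ℝ) : ℝ :=
  ⨆ z : Ici (0 : ℝ) × ℝ, |φ z.1 z.2|

/-- `‖θ‖_{C^1} = ‖θ‖_{C^0} + ‖∂_t θ‖_{C^0} + ‖∂_x θ‖_{C^0}`. -/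
noncomputable def normC1 (θ : ℝ → ℝ → ℝ) : ℝ :=
  normC0 θ + normC0 (dt θ) + normC0 (dx θ)

/-- The integrand `V ∂_t θ + f(t,x,V) ∂_x θ + g(t,x,V) θ` of the weak form. -/
noncomputable def weakIntegrand {p : ℕ} (f g : ℝ → ℝ → State p → State p)
    (V : ℝ → ℝ → State p) (θ : ℝ → ℝ → ℝ) (t x : ℝ) : State p :=
  dt θ t x • V t x + dx θ t x • f t x (V t x) + θ t x • g t x (V t x)

/-- `Δ(s,r;θ)`: the integral of the weak form over `[t₀, t₀+s] × [x₀-r, x₀+r]`. -/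
noncomputable def weakResidual {p : ℕ} (f g : ℝ → ℝ → State p → State p)
    (V : ℝ → ℝ → State p) (θ : ℝ → ℝ → ℝ) (t₀ x₀ s r : ℝ) : State p :=
  ∫ t in t₀..(t₀ + s), ∫ x in (x₀ - r)..(x₀ + r), weakIntegrand f g V θ t x

/-- The boundary terms: top minus bottom, plus right flux minus left flux. -/
noncomputable def boundaryTerms {p : ℕ} (f : ℝ → ℝ → State p → State p)
    (V : ℝ → ℝ → State p) (θ : ℝ → ℝ → ℝ) (t₀ x₀ s r : ℝ) : State p :=
  (∫ x in (x₀ - r)..(x₀ + r), θ (t₀ + s) x • V (t₀ + s) x)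
    - (∫ x in (x₀ - r)..(x₀ + r), θ t₀ x • V t₀ x)
    + (∫ t in t₀..(t₀ + s), θ t (x₀ + r) • f t (x₀ + r) (V t (x₀ + r)))
    - (∫ t in t₀..(t₀ + s), θ t (x₀ - r) • f t (x₀ - r) (V t (x₀ - r)))

/-- All the integrals in `weakResidual` and `boundaryTerms` exist. -/
def IntegralsExist {p : ℕ} (f g : ℝ → ℝ → State p → State p)
    (V : ℝ → ℝ → State p) (θ : ℝ → ℝ → ℝ) (t₀ x₀ s r : ℝ) : Prop :=
  IntegrableOn (fun z : ℝ × ℝ => weakIntegrand f g V θ z.1 z.2)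
      (Icc t₀ (t₀ + s) ×ˢ Icc (x₀ - r) (x₀ + r)) ∧
    IntervalIntegrable (fun x => θ (t₀ + s) x • V (t₀ + s) x) volume (x₀ - r) (x₀ + r) ∧
    IntervalIntegrable (fun x => θ t₀ x • V t₀ x) volume (x₀ - r) (x₀ + r) ∧
    IntervalIntegrable (fun t => θ t (x₀ + r) • f t (x₀ + r) (V t (x₀ + r))) volume
      t₀ (t₀ + s) ∧
    IntervalIntegrable (fun t => θ t (x₀ - r) • f t (x₀ - r) (V t (x₀ - r))) volume
      t₀ (t₀ + s)

/-!
Write `τ = t - t₀`, `ξ = (x - x₀) / τ` and `a = r / s`, and attach to a state `v` the corrected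
state `V = v + τ q(t₀, x₀, v)`. The approximate solution takes the value `V` at `v = W ξ`. By the
stability condition all waves lie in `|ξ| ≤ a`, so that `W` is constant outside these rays.

In the coordinates `(τ, ξ)` the weak integrand times the Jacobian `τ` is, at fixed state, the sum of

* the `τ`-derivative of the mass term `τ θ V`, whose integral is the boundary term at the final time,
* the `ξ`-derivative of the weighted relative flux `θ (f(t, x, V) - ξ V)`,
* the product of `τ θ` and the defect `q(t₀, x₀, v) + ∂ₓf - g`, which vanishes at the base point and
  is therefore `O(τ (1 + a))`

(`smul_stateIntegrand_eq`). Only one-dimensional integrations and Fubini's theorem are needed, and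
no divergence theorem on domains with corners. The increment of the relative flux along `W` is where
the Riemann problem enters: at the base point the relative flux `f(t₀, x₀, v) - ξ v` does not
change across a shock or a contact discontinuity, by the Rankine-Hugoniot relation, and is
stationary in `v` along a rarefaction; its state derivative at `(t, x)` differs from the one at
`(t₀, x₀)` by `O(τ (1 + a))` (`Cell.relFluxDu_sub_le`). Hence the waves contribute at most
`O(τ (1 + a))` times their total strength (`Cell.norm_integral_weightedFluxDeriv_sub_le`). What
remains is compared with the profile that has a single jump at `ξ = 0`
(`Cell.defect_sub_defect`, `Cell.defect_jumpProfile_le`), for which the two halves of the cell are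
rectangles. Integration in `τ` gives `Cell.defect_le`.

The total strength of the waves is `O(|uR - uL|)` when all states are small
(`exists_sum_strength_le`). No wave curves are constructed for this: the eigenvalues are continuous
(`tendsto_eigenvalue`), so the jump across a wave of the `i`-th family, and the derivative of `W`
in a rarefaction, are almost eigenvectors of the Jacobian matrix at the state `0`, hence nearly
parallel to its `i`-th eigenvector (`wave_coord_estimate`). Since the eigenvectors are linearly
independent, the waves cannot cancel. A compactness argument makes the constants uniform in
`(t₀, x₀)`.

All this requires `s` to be so small that corrected states stay in a fixed ball. For larger `s` the
claim follows from the boundedness of the integrands on `K` (`defect_le_of_bounded`).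
-/

/-! ### Continuity of simple eigenvalues -/

theorem exists_eigenbasis {p : ℕ} (A : Module.End ℝ (State p)) (μ : Fin p → ℝ)
    (hμ : Function.Injective μ) (h : ∀ i, A.HasEigenvalue (μ i)) :
    ∃ b : Module.Basis (Fin p) ℝ (State p), ∀ i, A (b i) = μ i • b i := by
  choose v hv using fun i => (h i).exists_hasEigenvector
  have hli : LinearIndependent ℝ v := A.eigenvectors_linearIndependent' μ hμ v hv
  refine ⟨basisOfLinearIndependentOfCardEqFinrank' v hli (by simp), fun i => ?_⟩
  simpa using (hv i).apply_eq_smul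

theorem det_sub_eq_prod {p : ℕ} (A : Module.End ℝ (State p)) (μ : Fin p → ℝ)
    (hμ : Function.Injective μ) (h : ∀ i, A.HasEigenvalue (μ i)) (m : ℝ) :
    LinearMap.det (m • (1 : Module.End ℝ (State p)) - A) = ∏ i, (m - μ i) := by
  obtain ⟨b, hb⟩ := exists_eigenbasis A μ hμ h
  have : LinearMap.toMatrix b b (m • (1 : Module.End ℝ (State p)) - A)
      = Matrix.diagonal fun i => m - μ i := by
    ext i j
    rw [LinearMap.toMatrix_apply]
    simp only [LinearMap.sub_apply, LinearMap.smul_apply, Module.End.one_apply, hb, ← sub_smul,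
      map_smul, Module.Basis.repr_self, Finsupp.smul_apply, smul_eq_mul, Matrix.diagonal_apply]
    by_cases hij : i = j
    · subst hij; simp
    · rw [Finsupp.single_eq_of_ne hij]; simp [hij]
  rw [← LinearMap.det_toMatrix b, this, Matrix.det_diagonal]

/-- Ordered simple real eigenvalues depend continuously on the operator. The characteristic polynomial
changes sign between `μ₀ i - η` and `μ₀ i + η`, and it still does so for nearby operators. This gives
each of them an eigenvalue near every `μ₀ i`, and there are no more than `p`; the order identifies it
as the `i`-th one. -/
theorem tendsto_eigenvalue {p : ℕ} {ι : Type*} {l : Filter ι} {A : ι → State p →L[ℝ] State p}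
    {A₀ : State p →L[ℝ] State p} (hA : Filter.Tendsto A l (𝓝 A₀)) {μ : ι → Fin p → ℝ}
    {μ₀ : Fin p → ℝ} (hμ₀ : StrictMono μ₀)
    (h₀ : ∀ i, Module.End.HasEigenvalue (A₀ : State p →ₗ[ℝ] State p) (μ₀ i))
    (hμ : ∀ᶠ z in l, StrictMono (μ z) ∧
      ∀ i, Module.End.HasEigenvalue (A z : State p →ₗ[ℝ] State p) (μ z i)) (i : Fin p) :
    Filter.Tendsto (fun z => μ z i) l (𝓝 (μ₀ i)) := by
  rw [Metric.tendsto_nhds]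
  intro ε hε
  -- a radius smaller than `ε` and than half the gaps between the limit eigenvalues
  obtain ⟨η, hη0, hηε, hη⟩ : ∃ η : ℝ, 0 < η ∧ η < ε ∧
      ∀ i j, i ≠ j → 2 * η < |μ₀ i - μ₀ j| := by
    have : ∀ᶠ η : ℝ in 𝓝[>] 0, η < ε ∧ ∀ i j, i ≠ j → 2 * η < |μ₀ i - μ₀ j| := by
      refine Filter.Eventually.and (nhdsWithin_le_nhds (eventually_lt_nhds hε)) ?_
      refine Filter.eventually_all.2 fun i => Filter.eventually_all.2 fun j => ?_
      by_cases hij : i = j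
      · simp [hij]
      · have hpos : 0 < |μ₀ i - μ₀ j| := abs_pos.2 (sub_ne_zero.2 fun h => hij (hμ₀.injective h))
        refine nhdsWithin_le_nhds ?_
        filter_upwards [eventually_lt_nhds (half_pos hpos)] with η hη _
        linarith
    obtain ⟨η, hη, hpos⟩ := (this.and self_mem_nhdsWithin).exists
    exact ⟨η, hpos, hη.1, hη.2⟩
  obtain ⟨χ, hχc, hdet⟩ : ∃ χ : (State p →L[ℝ] State p) → ℝ → ℝ,
      (Continuous fun q : (State p →L[ℝ] State p) × ℝ => χ q.1 q.2) ∧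
      ∀ (B : State p →L[ℝ] State p) (ν : Fin p → ℝ), StrictMono ν →
      (∀ i, Module.End.HasEigenvalue (B : State p →ₗ[ℝ] State p) (ν i)) → ∀ m,
      χ B m = ∏ i, (m - ν i) :=
    ⟨fun B m => (m • (1 : State p →L[ℝ] State p) - B).det,
      ContinuousLinearMap.continuous_det.comp (by fun_prop), fun B ν hν h m =>
        det_sub_eq_prod (B : State p →ₗ[ℝ] State p) ν hν.injective h m⟩
  have hsign₀ : ∀ i, χ A₀ (μ₀ i - η) * χ A₀ (μ₀ i + η) < 0 := by
    intro i
    rw [hdet A₀ μ₀ hμ₀ h₀, hdet A₀ μ₀ hμ₀ h₀, ← Finset.prod_mul_distrib,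
      ← Finset.mul_prod_erase _ _ (Finset.mem_univ i)]
    refine mul_neg_of_neg_of_pos (by nlinarith) (Finset.prod_pos fun j hj => ?_)
    have h2 := hη i j (Finset.ne_of_mem_erase hj).symm
    have h3 : η ^ 2 < |μ₀ i - μ₀ j| ^ 2 := by
      have := abs_nonneg (μ₀ i - μ₀ j); nlinarith
    rw [sq_abs] at h3
    nlinarith
  have hsign : ∀ᶠ z in l, ∀ i, χ (A z) (μ₀ i - η) * χ (A z) (μ₀ i + η) < 0 := by
    refine Filter.eventually_all.2 fun i => ?_
    have hc : ∀ m, Filter.Tendsto (fun z => χ (A z) m) l (𝓝 (χ A₀ m)) := fun m =>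
      (hχc.tendsto (A₀, m)).comp (hA.prodMk_nhds (tendsto_const_nhds (x := m)))
    exact ((hc _).mul (hc _)).eventually_lt_const (hsign₀ i)
  filter_upwards [hsign, hμ] with z hz hμz
  have hroot : ∀ i, ∃ k, |μ z k - μ₀ i| < η := by
    intro i
    have hcont : ContinuousOn (χ (A z)) (Icc (μ₀ i - η) (μ₀ i + η)) :=
      (hχc.comp (by fun_prop : Continuous fun m : ℝ => (A z, m))).continuousOn
    have h0 : ∃ m ∈ Ioo (μ₀ i - η) (μ₀ i + η), χ (A z) m = 0 := by
      rcases mul_neg_iff.1 (hz i) with h | h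
      · exact intermediate_value_Ioo' (by linarith) hcont ⟨h.2, h.1⟩
      · exact intermediate_value_Ioo (by linarith) hcont ⟨h.1, h.2⟩
    obtain ⟨m, hm, hm0⟩ := h0
    rw [hdet _ _ hμz.1 hμz.2, Finset.prod_eq_zero_iff] at hm0
    obtain ⟨k, -, hk⟩ := hm0
    refine ⟨k, ?_⟩
    rw [← sub_eq_zero.1 hk, abs_lt]
    constructor <;> linarith [hm.1, hm.2]
  choose k hk using hroot
  have hkm : StrictMono k := by
    intro i j hij
    refine hμz.1.lt_iff_lt.1 ?_
    have h1 := abs_lt.1 (hk i)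
    have h2 := abs_lt.1 (hk j)
    have h3 := hη i j hij.ne
    rw [abs_sub_comm, abs_of_pos (sub_pos.2 (hμ₀ hij))] at h3
    linarith
  have hki : k i = i := le_antisymm (hkm.apply_le (x := i)) hkm.le_apply
  rw [Real.dist_eq]
  have := hk i
  rw [hki] at this
  linarith

/-! ### Smoothness and uniform bounds of the flux and the source -/

/-- The domain `[0,∞) × ℝ × Ω` on which the flux and the source are smooth. -/
def phaseDomain {p : ℕ} (Ω : Set (State p)) : Set (ℝ × ℝ × State p) :=
  Ici (0 : ℝ) ×ˢ (univ : Set ℝ) ×ˢ Ω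

theorem uniqueDiffOn_phaseDomain {p : ℕ} {Ω : Set (State p)} (hΩ : IsOpen Ω) :
    UniqueDiffOn ℝ (phaseDomain Ω) :=
  (uniqueDiffOn_Ici 0).prod (uniqueDiffOn_univ.prod hΩ.uniqueDiffOn)

section SmoothMap

variable {p : ℕ} {Ω : Set (State p)} {G : ℝ → ℝ → State p → State p}

/-- At fixed time the phase domain is open in `(x, u)`, so that one-sided differentiability in time
still gives a two-sided derivative in the remaining variables, at `t = 0` as well. -/
theorem hasFDerivAt_of_contDiffOn (hΩ : IsOpen Ω)
    (hG : ContDiffOn ℝ ∞ (fun z : ℝ × ℝ × State p => G z.1 z.2.1 z.2.2) (phaseDomain Ω))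
    {t : ℝ} (ht : 0 ≤ t) (x : ℝ) {u : State p} (hu : u ∈ Ω) :
    HasFDerivAt (fun y : ℝ × State p => G t y.1 y.2)
      ((fderivWithin ℝ (fun z : ℝ × ℝ × State p => G z.1 z.2.1 z.2.2) (phaseDomain Ω)
        (t, x, u)).comp (ContinuousLinearMap.inr ℝ ℝ (ℝ × State p))) (x, u) := by
  have h1 : HasFDerivWithinAt (fun z : ℝ × ℝ × State p => G z.1 z.2.1 z.2.2) _ (phaseDomain Ω)
      (t, x, u) :=
    ((hG.differentiableOn (by simp)) (t, x, u) ⟨ht, mem_univ _, hu⟩).hasFDerivWithinAt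
  have h2 : HasFDerivWithinAt (fun y : ℝ × State p => (t, y))
      (ContinuousLinearMap.inr ℝ ℝ (ℝ × State p)) ((univ : Set ℝ) ×ˢ Ω) (x, u) :=
    (hasFDerivAt_prodMk_right t (x, u)).hasFDerivWithinAt
  have h3 : MapsTo (fun y : ℝ × State p => (t, y)) ((univ : Set ℝ) ×ˢ Ω) (phaseDomain Ω) :=
    fun y hy => ⟨ht, hy⟩
  exact (HasFDerivWithinAt.comp (x, u) h1 h2 h3).hasFDerivAt
    ((isOpen_univ.prod hΩ).mem_nhds ⟨mem_univ _, hu⟩)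

theorem fderiv_state_eq (hΩ : IsOpen Ω)
    (hG : ContDiffOn ℝ ∞ (fun z : ℝ × ℝ × State p => G z.1 z.2.1 z.2.2) (phaseDomain Ω))
    {t : ℝ} (ht : 0 ≤ t) (x : ℝ) {u : State p} (hu : u ∈ Ω) :
    fderiv ℝ (G t x) u =
      (fderivWithin ℝ (fun z : ℝ × ℝ × State p => G z.1 z.2.1 z.2.2) (phaseDomain Ω)
        (t, x, u)).comp ((ContinuousLinearMap.inr ℝ ℝ (ℝ × State p)).comp
          (ContinuousLinearMap.inr ℝ ℝ (State p))) :=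
  (HasFDerivAt.comp u (hasFDerivAt_of_contDiffOn hΩ hG ht x hu)
    (hasFDerivAt_prodMk_right x u)).fderiv

theorem deriv_space_eq (hΩ : IsOpen Ω)
    (hG : ContDiffOn ℝ ∞ (fun z : ℝ × ℝ × State p => G z.1 z.2.1 z.2.2) (phaseDomain Ω))
    {t : ℝ} (ht : 0 ≤ t) (x : ℝ) {u : State p} (hu : u ∈ Ω) :
    deriv (fun y => G t y u) x =
      fderivWithin ℝ (fun z : ℝ × ℝ × State p => G z.1 z.2.1 z.2.2) (phaseDomain Ω)
        (t, x, u) (0, 1, 0) := by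
  have := (HasFDerivAt.comp x (hasFDerivAt_of_contDiffOn hΩ hG ht x hu)
    (hasFDerivAt_prodMk_left x u)).hasDerivAt.deriv
  simpa [Function.comp_def] using this

theorem contDiffOn_fderiv_state (hΩ : IsOpen Ω)
    (hG : ContDiffOn ℝ ∞ (fun z : ℝ × ℝ × State p => G z.1 z.2.1 z.2.2) (phaseDomain Ω)) :
    ContDiffOn ℝ ∞ (fun z : ℝ × ℝ × State p => fderiv ℝ (G z.1 z.2.1) z.2.2)
      (phaseDomain Ω) := by
  have h := hG.fderivWithin (m := ∞) (uniqueDiffOn_phaseDomain hΩ) (by simp)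
  exact (h.clm_comp contDiffOn_const).congr fun z hz => fderiv_state_eq hΩ hG hz.1 z.2.1 hz.2.2

theorem contDiffOn_deriv_space (hΩ : IsOpen Ω)
    (hG : ContDiffOn ℝ ∞ (fun z : ℝ × ℝ × State p => G z.1 z.2.1 z.2.2) (phaseDomain Ω)) :
    ContDiffOn ℝ ∞ (fun z : ℝ × ℝ × State p => deriv (fun y => G z.1 y z.2.2) z.2.1)
      (phaseDomain Ω) := by
  have h := hG.fderivWithin (m := ∞) (uniqueDiffOn_phaseDomain hΩ) (by simp)
  exact (h.clm_apply contDiffOn_const).congr fun z hz => deriv_space_eq hΩ hG hz.1 z.2.1 hz.2.2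

theorem exists_bound_lipschitz {E : Type*} [NormedAddCommGroup E] [NormedSpace ℝ E]
    {H : ℝ × ℝ × State p → E} (hΩ : IsOpen Ω) (hH : ContDiffOn ℝ ∞ H (phaseDomain Ω))
    {Z : Set (ℝ × ℝ × State p)} (hZ : IsCompact Z) (hZc : Convex ℝ Z) (hZD : Z ⊆ phaseDomain Ω) :
    ∃ L : ℝ, 0 ≤ L ∧ (∀ z ∈ Z, ‖H z‖ ≤ L) ∧ ∀ z ∈ Z, ∀ z' ∈ Z, ‖H z' - H z‖ ≤ L * ‖z' - z‖ := by
  obtain ⟨M, hM⟩ := hZ.exists_bound_of_continuousOn (hH.continuousOn.mono hZD)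
  obtain ⟨N, hN⟩ := hZ.exists_bound_of_continuousOn
    ((hH.continuousOn_fderivWithin (uniqueDiffOn_phaseDomain hΩ) (by simp)).mono hZD)
  refine ⟨max 0 (max M N), le_max_left _ _, fun z hz => (hM z hz).trans (by simp),
    fun z hz z' hz' => ?_⟩
  refine hZc.norm_image_sub_le_of_norm_hasFDerivWithin_le
    (f' := fun z => fderivWithin ℝ H (phaseDomain Ω) z) (fun y hy => ?_)
    (fun y hy => (hN y hy).trans (by simp)) hz hz'
  exact ((hH.differentiableOn (by simp)) y (hZD hy)).hasFDerivWithinAt.mono hZD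

end SmoothMap

/-- The regularity of the flux and the source that the local estimates use: `f`, `g` and `q` are
differentiable on `[0,∞) × ℝ × {|u| ≤ R}`, and there `L` bounds `∂f/∂u`, `q`, `∂q/∂u` and the
Lipschitz constants of `∂f/∂u`, `∂f/∂x` and `g`, as long as `t ≤ T` and `|x| ≤ X`. -/
structure LocalBounds {p : ℕ} (f g : ℝ → ℝ → State p → State p) (T X R L : ℝ) : Prop where
  nonneg : 0 ≤ L
  flux_diff : ∀ t x : ℝ, ∀ u : State p, 0 ≤ t → ‖u‖ ≤ R →
    DifferentiableAt ℝ (fun y : ℝ × State p => f t y.1 y.2) (x, u)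
  q_diff : ∀ t x : ℝ, ∀ u : State p, 0 ≤ t → ‖u‖ ≤ R → DifferentiableAt ℝ (qMap f g t x) u
  flux_cont : ContinuousOn (fun z : ℝ × ℝ × State p => f z.1 z.2.1 z.2.2)
    (phaseDomain (Metric.closedBall 0 R))
  source_cont : ContinuousOn (fun z : ℝ × ℝ × State p => g z.1 z.2.1 z.2.2)
    (phaseDomain (Metric.closedBall 0 R))
  fluxDx_cont : ContinuousOn (fun z : ℝ × ℝ × State p => deriv (fun y => f z.1 y z.2.2) z.2.1)
    (phaseDomain (Metric.closedBall 0 R))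
  jac_cont : ContinuousOn (fun z : ℝ × ℝ × State p => fderiv ℝ (f z.1 z.2.1) z.2.2)
    (phaseDomain (Metric.closedBall 0 R))
  qDu_cont : ContinuousOn (fun z : ℝ × ℝ × State p => fderiv ℝ (qMap f g z.1 z.2.1) z.2.2)
    (phaseDomain (Metric.closedBall 0 R))
  jac_le : ∀ t ∈ Icc 0 T, ∀ x ∈ Icc (-X) X, ∀ u ∈ Metric.closedBall (0 : State p) R,
    ‖fderiv ℝ (f t x) u‖ ≤ L
  q_le : ∀ t ∈ Icc 0 T, ∀ x ∈ Icc (-X) X, ∀ u ∈ Metric.closedBall (0 : State p) R,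
    ‖qMap f g t x u‖ ≤ L
  qDu_le : ∀ t ∈ Icc 0 T, ∀ x ∈ Icc (-X) X, ∀ u ∈ Metric.closedBall (0 : State p) R,
    ‖fderiv ℝ (qMap f g t x) u‖ ≤ L
  jac_lip : ∀ t ∈ Icc 0 T, ∀ x ∈ Icc (-X) X, ∀ u ∈ Metric.closedBall (0 : State p) R,
    ∀ t' ∈ Icc 0 T, ∀ x' ∈ Icc (-X) X, ∀ u' ∈ Metric.closedBall (0 : State p) R,
    ‖fderiv ℝ (f t' x') u' - fderiv ℝ (f t x) u‖ ≤ L * (|t' - t| + |x' - x| + ‖u' - u‖)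
  fluxDx_lip : ∀ t ∈ Icc 0 T, ∀ x ∈ Icc (-X) X, ∀ u ∈ Metric.closedBall (0 : State p) R,
    ∀ t' ∈ Icc 0 T, ∀ x' ∈ Icc (-X) X, ∀ u' ∈ Metric.closedBall (0 : State p) R,
    ‖deriv (fun y => f t' y u') x' - deriv (fun y => f t y u) x‖
      ≤ L * (|t' - t| + |x' - x| + ‖u' - u‖)
  source_lip : ∀ t ∈ Icc 0 T, ∀ x ∈ Icc (-X) X, ∀ u ∈ Metric.closedBall (0 : State p) R,
    ∀ t' ∈ Icc 0 T, ∀ x' ∈ Icc (-X) X, ∀ u' ∈ Metric.closedBall (0 : State p) R,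
    ‖g t' x' u' - g t x u‖ ≤ L * (|t' - t| + |x' - x| + ‖u' - u‖)

theorem exists_localBounds {p : ℕ} {f g : ℝ → ℝ → State p → State p}
    {Ω : Set (State p)} (hΩ : IsOpen Ω)
    (hf : ContDiffOn ℝ ∞ (fun z : ℝ × ℝ × State p => f z.1 z.2.1 z.2.2) (phaseDomain Ω))
    (hg : ContDiffOn ℝ ∞ (fun z : ℝ × ℝ × State p => g z.1 z.2.1 z.2.2) (phaseDomain Ω))
    (T X : ℝ) {R : ℝ} (hR : Metric.closedBall (0 : State p) R ⊆ Ω) :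
    ∃ L, LocalBounds f g T X R L := by
  have hq : ContDiffOn ℝ ∞ (fun z : ℝ × ℝ × State p => qMap f g z.1 z.2.1 z.2.2)
      (phaseDomain Ω) := hg.sub (contDiffOn_deriv_space hΩ hf)
  have hfx := contDiffOn_deriv_space hΩ hf
  have hA := contDiffOn_fderiv_state hΩ hf
  have hqu := contDiffOn_fderiv_state hΩ hq
  have hsub : phaseDomain (Metric.closedBall (0 : State p) R) ⊆ phaseDomain Ω :=
    prod_mono le_rfl (prod_mono le_rfl hR)
  set Z : Set (ℝ × ℝ × State p) := Icc 0 T ×ˢ Icc (-X) X ×ˢ Metric.closedBall 0 R with hZdef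
  have hZ : IsCompact Z := isCompact_Icc.prod (isCompact_Icc.prod (isCompact_closedBall _ _))
  have hZc : Convex ℝ Z :=
    (convex_Icc _ _).prod ((convex_Icc _ _).prod (convex_closedBall _ _))
  have hZD : Z ⊆ phaseDomain Ω := fun z hz => ⟨hz.1.1, mem_univ _, hR hz.2.2⟩
  obtain ⟨L₁, h₁, hb₁, hl₁⟩ := exists_bound_lipschitz hΩ hA hZ hZc hZD
  obtain ⟨L₂, h₂, hb₂, hl₂⟩ := exists_bound_lipschitz hΩ hfx hZ hZc hZD
  obtain ⟨L₃, h₃, hb₃, hl₃⟩ := exists_bound_lipschitz hΩ hg hZ hZc hZD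
  obtain ⟨L₄, h₄, hb₄, hl₄⟩ := exists_bound_lipschitz hΩ hq hZ hZc hZD
  obtain ⟨L₅, h₅, hb₅, hl₅⟩ := exists_bound_lipschitz hΩ hqu hZ hZc hZD
  have hnorm : ∀ z z' : ℝ × ℝ × State p,
      ‖z' - z‖ ≤ |z'.1 - z.1| + |z'.2.1 - z.2.1| + ‖z'.2.2 - z.2.2‖ := by
    intro z z'
    simp only [Prod.norm_def, Prod.fst_sub, Prod.snd_sub, Real.norm_eq_abs]
    have := abs_nonneg (z'.1 - z.1)
    have := abs_nonneg (z'.2.1 - z.2.1)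
    have := norm_nonneg (z'.2.2 - z.2.2)
    refine max_le (by linarith) (max_le (by linarith) (by linarith))
  have hlip : ∀ {l d d' : ℝ}, 0 ≤ l → l ≤ L₁ + L₂ + L₃ + L₄ + L₅ → 0 ≤ d → d ≤ d' →
      l * d ≤ (L₁ + L₂ + L₃ + L₄ + L₅) * d' := fun h h' hd hd' =>
    mul_le_mul h' hd' hd (h.trans h')
  refine ⟨L₁ + L₂ + L₃ + L₄ + L₅, by positivity, fun t x u ht hu => ?_, fun t x u ht hu => ?_,
    hf.continuousOn.mono hsub, hg.continuousOn.mono hsub, hfx.continuousOn.mono hsub,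
    hA.continuousOn.mono hsub, hqu.continuousOn.mono hsub, ?_, ?_, ?_, ?_, ?_, ?_⟩
  · exact (hasFDerivAt_of_contDiffOn hΩ hf ht x (hR (by simpa using hu))).differentiableAt
  · exact (HasFDerivAt.comp u (hasFDerivAt_of_contDiffOn hΩ hq ht x (hR (by simpa using hu)))
      (hasFDerivAt_prodMk_right x u)).differentiableAt
  · intro t ht x hx u hu
    exact (hb₁ (t, x, u) ⟨ht, hx, hu⟩).trans (by linarith)
  · intro t ht x hx u hu
    exact (hb₄ (t, x, u) ⟨ht, hx, hu⟩).trans (by linarith)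
  · intro t ht x hx u hu
    exact (hb₅ (t, x, u) ⟨ht, hx, hu⟩).trans (by linarith)
  · intro t ht x hx u hu t' ht' x' hx' u' hu'
    exact (hl₁ (t, x, u) ⟨ht, hx, hu⟩ (t', x', u') ⟨ht', hx', hu'⟩).trans
      (hlip h₁ (by linarith) (norm_nonneg _) (hnorm _ _))
  · intro t ht x hx u hu t' ht' x' hx' u' hu'
    exact (hl₂ (t, x, u) ⟨ht, hx, hu⟩ (t', x', u') ⟨ht', hx', hu'⟩).trans
      (hlip h₂ (by linarith) (norm_nonneg _) (hnorm _ _))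
  · intro t ht x hx u hu t' ht' x' hx' u' hu'
    exact (hl₃ (t, x, u) ⟨ht, hx, hu⟩ (t', x', u') ⟨ht', hx', hu'⟩).trans
      (hlip h₃ (by linarith) (norm_nonneg _) (hnorm _ _))

/-! ### The total strength of the waves of a Riemann fan -/

/-- The waves of a classical Riemann solution made explicit: `u k` are the constant states and
`σm i`, `σp i` the lower and upper speeds of the `i`-th wave, so that
`IsClassicalRiemannSolution F l uL uR W` says that such a fan exists. -/
structure RiemannFan {p : ℕ} (F : State p → State p) (l : Fin p → State p → ℝ)
    (uL uR : State p) (W : ℝ → State p) (u : Fin (p + 1) → State p) (σm σp : Fin p → ℝ) :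
    Prop where
  left : u 0 = uL
  right : u (Fin.last p) = uR
  ordered : ∀ i j : Fin p, i < j → σp i < σm j
  wave : ∀ i : Fin p,
      IsRarefaction F (l i) W (u i.castSucc) (u i.succ) (σm i) (σp i) ∨
      (σm i = σp i ∧ (W (σm i) = u i.castSucc ∨ W (σm i) = u i.succ) ∧
        (IsShock F (l i) (u i.castSucc) (u i.succ) (σm i) ∨
          IsContact F (l i) (u i.castSucc) (u i.succ) (σm i)))
  const : ∀ (k : Fin (p + 1)) (ξ : ℝ), (∀ j : Fin p, j.castSucc < k → σp j < ξ) →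
      (∀ j : Fin p, k ≤ j.castSucc → ξ < σm j) → W ξ = u k

/-- The strength of a wave: the total variation of `W` across it, that is the integral of `|W'|`
for a rarefaction (`σm < σp`) and the size of the jump otherwise (`σm = σp`). -/
noncomputable def waveStrength {p : ℕ} (W : ℝ → State p) (um up : State p) (σm σp : ℝ) : ℝ :=
  if σm < σp then ∫ ξ in σm..σp, ‖derivWithin W (Icc σm σp) ξ‖ else ‖up - um‖

theorem waveStrength_nonneg {p : ℕ} (W : ℝ → State p) (um up : State p) (σm σp : ℝ) :
    0 ≤ waveStrength W um up σm σp := by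
  unfold waveStrength
  split_ifs with h
  · exact intervalIntegral.integral_nonneg h.le fun _ _ => norm_nonneg _
  · exact norm_nonneg _

namespace RiemannFan

variable {p : ℕ} {F : State p → State p} {l : Fin p → State p → ℝ} {uL uR : State p}
  {W : ℝ → State p} {u : Fin (p + 1) → State p} {σm σp : Fin p → ℝ}

theorem speed_le (h : RiemannFan F l uL uR W u σm σp) (i : Fin p) : σm i ≤ σp i := by
  rcases h.wave i with hi | hi
  · exact hi.1.le
  · exact hi.1.le

theorem exists_eq_state (h : RiemannFan F l uL uR W u σm σp) (k : Fin (p + 1)) :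
    ∃ ξ, W ξ = u k := by
  obtain ⟨ξ, h1, h2⟩ := Order.exists_between_finsets
    ((Finset.univ.filter fun j : Fin p => j.castSucc < k).image σp)
    ((Finset.univ.filter fun j : Fin p => k ≤ j.castSucc).image σm) (by
      intro x hx y hy
      simp only [Finset.mem_image, Finset.mem_filter, Finset.mem_univ, true_and] at hx hy
      obtain ⟨i, hi, rfl⟩ := hx
      obtain ⟨j, hj, rfl⟩ := hy
      exact h.ordered i j (Fin.castSucc_lt_castSucc_iff.1 (hi.trans_le hj)))
  refine ⟨ξ, h.const k ξ (fun j hj => h1 _ ?_) fun j hj => h2 _ ?_⟩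
  · exact Finset.mem_image_of_mem _ (by simpa using hj)
  · exact Finset.mem_image_of_mem _ (by simpa using hj)

theorem state_mem (h : RiemannFan F l uL uR W u σm σp) {U : Set (State p)} (hU : ∀ ξ, W ξ ∈ U)
    (k : Fin (p + 1)) : u k ∈ U := by
  obtain ⟨ξ, hξ⟩ := h.exists_eq_state k
  exact hξ ▸ hU ξ

/-- The wave speeds are bounded by the characteristic speeds on the values of `W`. -/
theorem speed_mem (h : RiemannFan F l uL uR W u σm σp) {U : Set (State p)} (hU : ∀ ξ, W ξ ∈ U)
    {a : ℝ} (ha : ∀ i, ∀ v ∈ U, |l i v| ≤ a) (i : Fin p) : -a ≤ σm i ∧ σp i ≤ a := by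
  rcases h.wave i with ⟨h1, h2, h3, h4, h5⟩ | ⟨h1, -, h2⟩
  · have h6 := (h5 (σm i) ⟨le_rfl, h1.le⟩).1
    have h7 := (h5 (σp i) ⟨h1.le, le_rfl⟩).1
    have h8 := abs_le.1 (ha i _ (hU (σm i)))
    have h9 := abs_le.1 (ha i _ (hU (σp i)))
    rw [h6] at h8; rw [h7] at h9
    exact ⟨h8.1, h9.2⟩
  · have h8 := abs_le.1 (ha i _ (h.state_mem hU i.castSucc))
    have h9 := abs_le.1 (ha i _ (h.state_mem hU i.succ))
    rw [← h1]
    rcases h2 with ⟨-, h3, h4⟩ | ⟨-, h3, h4⟩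
    · constructor <;> linarith
    · constructor <;> linarith

end RiemannFan

theorem sum_succ_sub_castSucc {E : Type*} [AddCommGroup E] {n : ℕ} (u : Fin (n + 1) → E) :
    ∑ i : Fin n, (u i.succ - u i.castSucc) = u (Fin.last n) - u 0 := by
  induction n with
  | zero => simp
  | succ n ih =>
    rw [Fin.sum_univ_castSucc]
    have := ih fun i => u i.castSucc
    simp only [Fin.succ_castSucc] at this ⊢
    rw [this]
    simp

theorem pos_or_neg_of_ne_zero {S : Set ℝ} (hS : IsPreconnected S) {φ : ℝ → ℝ}
    (hφ : ContinuousOn φ S) (h0 : ∀ ξ ∈ S, φ ξ ≠ 0) :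
    (∀ ξ ∈ S, 0 < φ ξ) ∨ ∀ ξ ∈ S, φ ξ < 0 := by
  by_contra! h
  obtain ⟨⟨a, ha, ha'⟩, b, hb, hb'⟩ := h
  obtain ⟨ξ, hξ, hξ'⟩ := hS.intermediate_value ha hb hφ ⟨ha', hb'⟩
  exact h0 ξ hξ hξ'

section NearConstant

variable {p : ℕ} {A₀ : State p →L[ℝ] State p} {μ : Fin p → ℝ} {c : Fin p → State p →L[ℝ] ℝ}
  {M N γ η : ℝ} {i : Fin p}

/-- An approximate eigenvector for the `i`-th eigenvalue has small components along the other
eigenvectors; here `c j` are the left eigenvectors. -/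
theorem coord_le_of_approx_eigenvector (hc : ∀ j v, c j (A₀ v) = μ j * c j v)
    (hN : ∀ j v, |c j v| ≤ N * ‖v‖) (hN0 : 0 ≤ N) (hγ : 0 < γ)
    (hgap : ∀ j, j ≠ i → γ ≤ |μ j - μ i|) {d : State p} (hd : ‖A₀ d - μ i • d‖ ≤ η * ‖d‖)
    {j : Fin p} (hj : j ≠ i) : |c j d| ≤ N * η / γ * ‖d‖ := by
  have h1 : c j (A₀ d - μ i • d) = (μ j - μ i) * c j d := by
    rw [map_sub, hc, map_smul, smul_eq_mul]; ring
  have h2 : γ * |c j d| ≤ N * (η * ‖d‖) := by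
    calc γ * |c j d| ≤ |μ j - μ i| * |c j d| := by gcongr; exact hgap j hj
      _ = |c j (A₀ d - μ i • d)| := by rw [h1, abs_mul]
      _ ≤ N * ‖A₀ d - μ i • d‖ := hN _ _
      _ ≤ N * (η * ‖d‖) := by gcongr
  rw [show N * η / γ * ‖d‖ = N * (η * ‖d‖) / γ by ring, le_div_iff₀ hγ]
  linarith

theorem norm_le_of_coord_le (hM : ∀ v, ‖v‖ ≤ M * ∑ j, |c j v|) (hM0 : 0 ≤ M) {κ : ℝ}
    (hκ0 : 0 ≤ κ) {d : State p} {ℓ : ℝ} (hℓ : 0 ≤ ℓ) (h : ∀ j, j ≠ i → |c j d| ≤ κ * ℓ) :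
    ‖d‖ ≤ M * |c i d| + M * p * κ * ℓ := by
  refine (hM d).trans ?_
  have : ∑ j, |c j d| ≤ |c i d| + p * (κ * ℓ) := by
    rw [← Finset.add_sum_erase _ _ (Finset.mem_univ i)]
    gcongr
    calc ∑ j ∈ Finset.univ.erase i, |c j d| ≤ ∑ j ∈ Finset.univ.erase i, κ * ℓ :=
          Finset.sum_le_sum fun j hj => h j (Finset.ne_of_mem_erase hj)
      _ ≤ ∑ j : Fin p, κ * ℓ := Finset.sum_le_sum_of_subset_of_nonneg (Finset.erase_subset _ _)
          fun _ _ _ => by positivity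
      _ = p * (κ * ℓ) := by simp
  calc M * ∑ j, |c j d| ≤ M * (|c i d| + p * (κ * ℓ)) := by gcongr
    _ = _ := by ring

/-- The jump or variation across a wave of the `i`-th family is nearly parallel to the `i`-th
eigenvector of `A₀`, provided that the Jacobian matrix of the flux is close to `A₀` and its `i`-th
eigenvalue close to that of `A₀`, on a convex set containing the wave. -/
theorem wave_coord_estimate (hc : ∀ j v, c j (A₀ v) = μ j * c j v)
    (hN : ∀ j v, |c j v| ≤ N * ‖v‖) (hN0 : 0 ≤ N) (hγ : 0 < γ)
    (hgap : ∀ j, j ≠ i → γ ≤ |μ j - μ i|) (hM : ∀ v, ‖v‖ ≤ M * ∑ j, |c j v|) (hM0 : 0 ≤ M)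
    {F : State p → State p} {l : State p → ℝ} {S : Set (State p)} (hS : Convex ℝ S)
    (hF : ∀ v ∈ S, DifferentiableAt ℝ F v) (hη : 0 ≤ η) (hA : ∀ v ∈ S, ‖fderiv ℝ F v - A₀‖ ≤ η)
    (hl : ∀ v ∈ S, |l v - μ i| ≤ η) (hsmall : M * p * (N * (2 * η) / γ) ≤ 1 / 4)
    {W : ℝ → State p} (hW : ∀ ξ, W ξ ∈ S) {um up : State p} (hum : um ∈ S) (hup : up ∈ S)
    {σm σp : ℝ} (hwave : IsRarefaction F l W um up σm σp ∨
      (σm = σp ∧ (IsShock F l um up σm ∨ IsContact F l um up σm))) :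
    (∀ j, j ≠ i → |c j (up - um)| ≤ N * (2 * η) / γ * waveStrength W um up σm σp) ∧
      waveStrength W um up σm σp ≤ 2 * M * |c i (up - um)| := by
  set κ := N * (2 * η) / γ with hκ
  have hκ0 : 0 ≤ κ := by positivity
  have hℓ0 := waveStrength_nonneg W um up σm σp
  rcases hwave with ⟨hlt, h1, h2, h3, h4⟩ | ⟨heq, hjump⟩
  · rw [waveStrength, if_pos hlt]
    set w' : ℝ → State p := fun ξ => derivWithin W (Icc σm σp) ξ with hw'
    have hcont : ContinuousOn w' (Icc σm σp) :=
      h3.continuousOn_derivWithin (uniqueDiffOn_Icc hlt) (by simp)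
    have hcoord : ∀ ξ ∈ Icc σm σp, ∀ j, j ≠ i → |c j (w' ξ)| ≤ κ * ‖w' ξ‖ := by
      intro ξ hξ j hj
      refine coord_le_of_approx_eigenvector hc hN hN0 hγ hgap ?_ hj
      obtain ⟨h5, h6⟩ := h4 ξ hξ
      have h7 : fderiv ℝ F (W ξ) (w' ξ) = ξ • w' ξ := h6.apply_eq_smul
      have h8 : A₀ (w' ξ) - μ i • w' ξ
          = (l (W ξ) - μ i) • w' ξ - (fderiv ℝ F (W ξ) - A₀) (w' ξ) := by
        rw [sub_apply, h7, h5, sub_smul]; abel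
      rw [h8]
      calc _ ≤ ‖(l (W ξ) - μ i) • w' ξ‖ + ‖(fderiv ℝ F (W ξ) - A₀) (w' ξ)‖ := norm_sub_le _ _
        _ ≤ η * ‖w' ξ‖ + η * ‖w' ξ‖ := by
            gcongr
            · rw [norm_smul]; gcongr; exact hl _ (hW ξ)
            · exact (ContinuousLinearMap.le_opNorm _ _).trans (by gcongr; exact hA _ (hW ξ))
        _ = _ := by ring
    have hpt : ∀ ξ ∈ Icc σm σp, ‖w' ξ‖ ≤ 2 * M * |c i (w' ξ)| := by
      intro ξ hξ
      have := norm_le_of_coord_le hM hM0 hκ0 (norm_nonneg _) (hcoord ξ hξ)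
      have h9 : M * p * κ * ‖w' ξ‖ ≤ 1 / 4 * ‖w' ξ‖ := by gcongr
      have := norm_nonneg (w' ξ)
      have : 0 ≤ M * |c i (w' ξ)| := by positivity
      linarith
    have hne : ∀ ξ ∈ Icc σm σp, c i (w' ξ) ≠ 0 := by
      intro ξ hξ h0
      have := hpt ξ hξ
      rw [h0, abs_zero, mul_zero] at this
      exact (h4 ξ hξ).2.2 (norm_le_zero_iff.1 this)
    have hint : IntervalIntegrable w' volume σm σp :=
      ContinuousOn.intervalIntegrable_of_Icc hlt.le hcont
    have hd : up - um = ∫ ξ in σm..σp, w' ξ := by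
      rw [intervalIntegral.integral_eq_sub_of_hasDerivAt_of_le hlt.le h3.continuousOn
        (fun ξ hξ => ?_) hint, h1, h2]
      exact ((h3.differentiableOn (by simp)) ξ (Ioo_subset_Icc_self hξ)).hasDerivWithinAt.hasDerivAt
        (Icc_mem_nhds hξ.1 hξ.2)
    have hcd : ∀ j, c j (up - um) = ∫ ξ in σm..σp, c j (w' ξ) := fun j => by
      rw [hd, (c j).intervalIntegral_comp_comm hint]
    have hcint : ∀ j, IntervalIntegrable (fun ξ => c j (w' ξ)) volume σm σp := fun j =>
      ContinuousOn.intervalIntegrable_of_Icc hlt.le ((c j).continuous.comp_continuousOn hcont)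
    refine ⟨fun j hj => ?_, ?_⟩
    · rw [hcd, ← intervalIntegral.integral_const_mul]
      refine (intervalIntegral.abs_integral_le_integral_abs hlt.le).trans ?_
      exact intervalIntegral.integral_mono_on hlt.le (hcint j).abs (hint.norm.const_mul _)
        fun ξ hξ => hcoord ξ hξ j hj
    · -- `c i (w' ξ)` keeps its sign along the rarefaction
      have habs : |c i (up - um)| = ∫ ξ in σm..σp, |c i (w' ξ)| := by
        rw [hcd]
        have hci : ContinuousOn (fun ξ => c i (w' ξ)) (Icc σm σp) :=
          (c i).continuous.comp_continuousOn hcont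
        rcases pos_or_neg_of_ne_zero isPreconnected_Icc hci hne with hpos | hneg
        · rw [abs_of_nonneg (intervalIntegral.integral_nonneg hlt.le fun ξ hξ => (hpos ξ hξ).le)]
          refine intervalIntegral.integral_congr fun ξ hξ => ?_
          rw [uIcc_of_le hlt.le] at hξ
          exact (abs_of_pos (hpos ξ hξ)).symm
        · rw [← abs_neg, ← intervalIntegral.integral_neg, abs_of_nonneg
            (intervalIntegral.integral_nonneg hlt.le fun ξ hξ => (neg_pos.2 (hneg ξ hξ)).le)]
          refine intervalIntegral.integral_congr fun ξ hξ => ?_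
          rw [uIcc_of_le hlt.le] at hξ
          exact (abs_of_neg (hneg ξ hξ)).symm
      rw [habs, ← intervalIntegral.integral_const_mul]
      exact intervalIntegral.integral_mono_on hlt.le hint.norm ((hcint i).abs.const_mul _) hpt
  · rw [waveStrength, if_neg (by rw [heq]; exact lt_irrefl _)]
    set d := up - um with hd
    have hRH : F up - F um = σm • d := by
      rcases hjump with h | h <;> exact h.1
    have hσ : |σm - μ i| ≤ η := by
      have h1 := abs_le.1 (hl um hum)
      have h2 := abs_le.1 (hl up hup)
      rw [abs_le]
      rcases hjump with ⟨-, h3, h4⟩ | ⟨-, h3, h4⟩ <;> constructor <;> linarith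
    have hmv : ‖F up - F um - A₀ d‖ ≤ η * ‖d‖ :=
      hS.norm_image_sub_le_of_norm_fderiv_le' hF hA hum hup
    have hcoord : ∀ j, j ≠ i → |c j d| ≤ κ * ‖d‖ := by
      intro j hj
      refine coord_le_of_approx_eigenvector hc hN hN0 hγ hgap ?_ hj
      have h8 : A₀ d - μ i • d = (σm - μ i) • d - (F up - F um - A₀ d) := by
        rw [hRH, sub_smul]; abel
      rw [h8]
      calc _ ≤ ‖(σm - μ i) • d‖ + ‖F up - F um - A₀ d‖ := norm_sub_le _ _
        _ ≤ η * ‖d‖ + η * ‖d‖ := by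
            gcongr
            rw [norm_smul]; gcongr; exact hσ
        _ = _ := by ring
    refine ⟨hcoord, ?_⟩
    have := norm_le_of_coord_le hM hM0 hκ0 (norm_nonneg _) hcoord
    have h9 : M * p * κ * ‖d‖ ≤ 1 / 4 * ‖d‖ := by gcongr
    have := norm_nonneg d
    have : 0 ≤ M * |c i d| := by positivity
    linarith

end NearConstant

/-- In the setting of `wave_coord_estimate`, the total strength of the waves of a Riemann fan is
controlled by the distance of the extreme states, because the waves are nearly parallel to the
linearly independent eigenvectors of `A₀`. -/
theorem RiemannFan.sum_strength_le {p : ℕ} {A₀ : State p →L[ℝ] State p} {μ : Fin p → ℝ}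
    {c : Fin p → State p →L[ℝ] ℝ} {M N γ η : ℝ} (hc : ∀ j v, c j (A₀ v) = μ j * c j v)
    (hN : ∀ j v, |c j v| ≤ N * ‖v‖) (hN0 : 0 ≤ N) (hγ : 0 < γ)
    (hgap : ∀ i j, j ≠ i → γ ≤ |μ j - μ i|) (hM : ∀ v, ‖v‖ ≤ M * ∑ j, |c j v|) (hM0 : 0 ≤ M)
    {F : State p → State p} {l : Fin p → State p → ℝ} {S : Set (State p)} (hS : Convex ℝ S)
    (hF : ∀ v ∈ S, DifferentiableAt ℝ F v) (hη : 0 ≤ η) (hA : ∀ v ∈ S, ‖fderiv ℝ F v - A₀‖ ≤ η)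
    (hl : ∀ i, ∀ v ∈ S, |l i v - μ i| ≤ η) (hsmall : M * p * (N * (2 * η) / γ) ≤ 1 / 4)
    {uL uR : State p} {W : ℝ → State p} {u : Fin (p + 1) → State p} {σm σp : Fin p → ℝ}
    (h : RiemannFan F l uL uR W u σm σp) (hW : ∀ ξ, W ξ ∈ S) :
    ∑ i, waveStrength W (u i.castSucc) (u i.succ) (σm i) (σp i)
      ≤ 4 * M * p * N * ‖uR - uL‖ := by
  set κ := N * (2 * η) / γ with hκ
  have hκ0 : 0 ≤ κ := by positivity
  set ℓ : Fin p → ℝ := fun i => waveStrength W (u i.castSucc) (u i.succ) (σm i) (σp i) with hℓ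
  have hℓ0 : ∀ i, 0 ≤ ℓ i := fun i => waveStrength_nonneg _ _ _ _ _
  have hest := fun i => wave_coord_estimate hc hN hN0 hγ (hgap i) hM hM0 hS hF hη hA (hl i) hsmall
    hW (h.state_mem hW i.castSucc) (h.state_mem hW i.succ)
    ((h.wave i).imp id fun hi => ⟨hi.1, hi.2.2⟩)
  have hdiag : ∀ i, |c i (u i.succ - u i.castSucc)| ≤ N * ‖uR - uL‖ + κ * ∑ j, ℓ j := by
    intro i
    have h1 : c i (u i.succ - u i.castSucc) = c i (uR - uL)
        - ∑ j ∈ Finset.univ.erase i, c i (u j.succ - u j.castSucc) := by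
      rw [← h.left, ← h.right, ← sum_succ_sub_castSucc, map_sum,
        ← Finset.add_sum_erase _ _ (Finset.mem_univ i)]
      ring
    rw [h1]
    refine (abs_sub _ _).trans (add_le_add (hN _ _) ?_)
    refine (Finset.abs_sum_le_sum_abs _ _).trans ?_
    rw [Finset.mul_sum]
    refine (Finset.sum_le_sum fun j hj => (hest j).1 i (Finset.ne_of_mem_erase hj).symm).trans ?_
    exact Finset.sum_le_sum_of_subset_of_nonneg (Finset.erase_subset _ _)
      fun j _ _ => mul_nonneg hκ0 (hℓ0 j)
  have h2 : ∑ i, ℓ i ≤ ∑ i : Fin p, 2 * M * (N * ‖uR - uL‖ + κ * ∑ j, ℓ j) :=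
    Finset.sum_le_sum fun i _ => (hest i).2.trans (by gcongr; exact hdiag i)
  rw [Finset.sum_const, Finset.card_univ, Fintype.card_fin, nsmul_eq_mul] at h2
  have h3 : M * p * κ * ∑ j, ℓ j ≤ 1 / 4 * ∑ j, ℓ j := by
    gcongr
    exact Finset.sum_nonneg fun j _ => hℓ0 j
  linarith

/-- On a small ball, and for base points near a given one, the total strength of a Riemann fan is
controlled by the distance of its extreme states. -/
theorem exists_sum_strength_le_near {p : ℕ} {f g : ℝ → ℝ → State p → State p}
    {lam : Fin p → ℝ → ℝ → State p → ℝ} {Ω : Set (State p)} (hΩ : IsOpen Ω)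
    (h0 : (0 : State p) ∈ Ω) (hsys : IsHyperbolicSystem f g lam Ω) {t : ℝ} (ht : 0 ≤ t) (x : ℝ) :
    ∃ ε > 0, ∃ C ≥ 0, ∀ t₀ x₀ : ℝ, 0 ≤ t₀ → |t₀ - t| < ε → |x₀ - x| < ε →
      ∀ (uL uR : State p) (W : ℝ → State p) (u : Fin (p + 1) → State p) (σm σp : Fin p → ℝ),
      RiemannFan (f t₀ x₀) (fun i => lam i t₀ x₀) uL uR W u σm σp →
      (∀ ξ, W ξ ∈ Metric.closedBall (0 : State p) ε) →
      ∑ i, waveStrength W (u i.castSucc) (u i.succ) (σm i) (σp i) ≤ C * ‖uR - uL‖ := by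
  set A : ℝ × ℝ × State p → State p →L[ℝ] State p :=
    fun z => fderiv ℝ (f z.1 z.2.1) z.2.2 with hAdef
  set z₀ : ℝ × ℝ × State p := (t, x, 0) with hz₀
  have hz₀D : z₀ ∈ phaseDomain Ω := ⟨ht, mem_univ _, h0⟩
  have hAc : ContinuousOn A (phaseDomain Ω) :=
    (contDiffOn_fderiv_state hΩ hsys.smooth_flux).continuousOn
  set μ : Fin p → ℝ := fun i => lam i t x 0 with hμdef
  have hμ : StrictMono μ := hsys.distinct t ht x 0 h0
  have hev : ∀ i, Module.End.HasEigenvalue (A z₀ : State p →ₗ[ℝ] State p) (μ i) :=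
    hsys.eigenvalue t ht x 0 h0
  have htend : ∀ i, Filter.Tendsto (fun z : ℝ × ℝ × State p => lam i z.1 z.2.1 z.2.2)
      (𝓝[phaseDomain Ω] z₀) (𝓝 (μ i)) := fun i =>
    tendsto_eigenvalue (μ := fun z i => lam i z.1 z.2.1 z.2.2) (hAc z₀ hz₀D) hμ hev (by
      filter_upwards [self_mem_nhdsWithin] with z hz
      exact ⟨hsys.distinct z.1 hz.1 z.2.1 z.2.2 hz.2.2,
        hsys.eigenvalue z.1 hz.1 z.2.1 z.2.2 hz.2.2⟩) i
  obtain ⟨b, hb⟩ := exists_eigenbasis (A z₀ : State p →ₗ[ℝ] State p) μ hμ.injective hev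
  set c : Fin p → State p →L[ℝ] ℝ := fun j => LinearMap.toContinuousLinearMap (b.coord j) with hcdef
  have hc : ∀ j v, c j (A z₀ v) = μ j * c j v := by
    intro j v
    have : (c j : State p →ₗ[ℝ] ℝ) ∘ₗ (A z₀ : State p →ₗ[ℝ] State p)
        = μ j • (c j : State p →ₗ[ℝ] ℝ) := by
      refine b.ext fun i => ?_
      have hbi : A z₀ (b i) = μ i • b i := hb i
      simp only [LinearMap.comp_apply, ContinuousLinearMap.coe_coe, hbi, map_smul,
        LinearMap.smul_apply, smul_eq_mul, hcdef, LinearMap.coe_toContinuousLinearMap',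
        Module.Basis.coord_apply, Module.Basis.repr_self]
      by_cases hij : i = j
      · rw [hij]
      · rw [Finsupp.single_eq_of_ne (Ne.symm hij)]; simp
    exact LinearMap.congr_fun this v
  obtain ⟨N, hN0, hN⟩ : ∃ N : ℝ, 0 ≤ N ∧ ∀ j v, |c j v| ≤ N * ‖v‖ := by
    refine ⟨∑ j, ‖c j‖, by positivity, fun j v => ((c j).le_opNorm v).trans ?_⟩
    gcongr
    exact Finset.single_le_sum (f := fun j => ‖c j‖) (fun _ _ => norm_nonneg _)
      (Finset.mem_univ j)
  obtain ⟨M, hM0, hM⟩ : ∃ M : ℝ, 0 ≤ M ∧ ∀ v, ‖v‖ ≤ M * ∑ j, |c j v| := by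
    refine ⟨∑ j, ‖b j‖, by positivity, fun v => ?_⟩
    conv_lhs => rw [← b.sum_repr v]
    refine (norm_sum_le _ _).trans ?_
    rw [Finset.mul_sum]
    refine Finset.sum_le_sum fun j _ => ?_
    rw [norm_smul, mul_comm]
    gcongr
    · exact Finset.single_le_sum (f := fun j => ‖b j‖) (fun _ _ => norm_nonneg _)
        (Finset.mem_univ j)
    · exact le_rfl
  obtain ⟨γ, hγ, hgap⟩ : ∃ γ : ℝ, 0 < γ ∧ ∀ i j, j ≠ i → γ ≤ |μ j - μ i| := by
    have : ∀ᶠ γ : ℝ in 𝓝[>] 0, ∀ i j, j ≠ i → γ ≤ |μ j - μ i| := by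
      refine Filter.eventually_all.2 fun i => Filter.eventually_all.2 fun j => ?_
      by_cases hij : j = i
      · simp [hij]
      · have hpos : 0 < |μ j - μ i| := abs_pos.2 (sub_ne_zero.2 fun h => hij (hμ.injective h))
        refine nhdsWithin_le_nhds ?_
        filter_upwards [eventually_lt_nhds hpos] with γ hγ _
        exact hγ.le
    obtain ⟨γ, hγ, hpos⟩ := (this.and self_mem_nhdsWithin).exists
    exact ⟨γ, hpos, hγ⟩
  obtain ⟨η, hη, hsmall⟩ : ∃ η : ℝ, 0 < η ∧ M * p * (N * (2 * η) / γ) ≤ 1 / 4 := by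
    have : Filter.Tendsto (fun η : ℝ => M * p * (N * (2 * η) / γ)) (𝓝[>] 0) (𝓝 0) := by
      have hcont : Continuous fun η : ℝ => M * p * (N * (2 * η) / γ) := by fun_prop
      simpa using (hcont.tendsto 0).mono_left nhdsWithin_le_nhds
    obtain ⟨η, h1, h2⟩ := ((this.eventually_lt_const (by norm_num : (0 : ℝ) < 1 / 4)).and
      self_mem_nhdsWithin).exists
    exact ⟨η, h2, h1.le⟩
  have hnear : ∀ᶠ z in 𝓝[phaseDomain Ω] z₀,
      ‖A z - A z₀‖ < η ∧ ∀ i, |lam i z.1 z.2.1 z.2.2 - μ i| < η := by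
    refine Filter.Eventually.and ?_ (Filter.eventually_all.2 fun i => ?_)
    · simpa only [dist_eq_norm] using Metric.tendsto_nhds.1 (hAc z₀ hz₀D) η hη
    · simpa only [Real.dist_eq] using Metric.tendsto_nhds.1 (htend i) η hη
  obtain ⟨ε₁, hε₁, hnear⟩ := Metric.mem_nhdsWithin_iff.1 hnear
  obtain ⟨ε₂, hε₂, hball⟩ := Metric.isOpen_iff.1 hΩ 0 h0
  set ε := min ε₁ ε₂ / 2 with hε
  have hεpos : 0 < ε := by positivity
  have hεε₁ : ε < ε₁ := by have := min_le_left ε₁ ε₂; linarith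
  have hεε₂ : ε < ε₂ := by have := min_le_right ε₁ ε₂; linarith
  refine ⟨ε, hεpos, 4 * M * p * N, by positivity, ?_⟩
  intro t₀ x₀ ht₀ ht₀' hx₀' uL uR W u σm σp hfan hW
  have hSΩ : Metric.closedBall (0 : State p) ε ⊆ Ω :=
    (Metric.closedBall_subset_ball hεε₂).trans hball
  have hz : ∀ v ∈ Metric.closedBall (0 : State p) ε,
      ‖A (t₀, x₀, v) - A z₀‖ < η ∧ ∀ i, |lam i t₀ x₀ v - μ i| < η := by
    intro v hv
    refine hnear ⟨?_, ht₀, mem_univ _, hSΩ hv⟩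
    rw [Metric.mem_ball, Prod.dist_eq, Prod.dist_eq]
    refine max_lt ?_ (max_lt ?_ ?_)
    · rw [Real.dist_eq]; exact ht₀'.trans hεε₁
    · rw [Real.dist_eq]; exact hx₀'.trans hεε₁
    · exact (Metric.mem_closedBall.1 hv).trans_lt hεε₁
  exact hfan.sum_strength_le hc hN hN0 hγ hgap hM hM0 (convex_closedBall _ _)
    (fun v hv => (HasFDerivAt.comp v (hasFDerivAt_of_contDiffOn hΩ hsys.smooth_flux ht₀ x₀
      (hSΩ hv)) (hasFDerivAt_prodMk_right x₀ v)).differentiableAt) hη.le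
    (fun v hv => (hz v hv).1.le) (fun i v hv => ((hz v hv).2 i).le) hsmall hW

theorem exists_sum_strength_le {p : ℕ} {f g : ℝ → ℝ → State p → State p}
    {lam : Fin p → ℝ → ℝ → State p → ℝ} {Ω : Set (State p)} (hΩ : IsOpen Ω)
    (h0 : (0 : State p) ∈ Ω) (hsys : IsHyperbolicSystem f g lam Ω) (T X : ℝ) :
    ∃ ε > 0, ∃ C ≥ 0, ∀ z ∈ Icc (0 : ℝ) T ×ˢ Icc (-X) X,
      ∀ (uL uR : State p) (W : ℝ → State p) (u : Fin (p + 1) → State p) (σm σp : Fin p → ℝ),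
      RiemannFan (f z.1 z.2) (fun i => lam i z.1 z.2) uL uR W u σm σp →
      (∀ ξ, W ξ ∈ Metric.closedBall (0 : State p) ε) →
      ∑ i, waveStrength W (u i.castSucc) (u i.succ) (σm i) (σp i) ≤ C * ‖uR - uL‖ := by
  refine (isCompact_Icc.prod isCompact_Icc : IsCompact (Icc (0 : ℝ) T ×ˢ Icc (-X) X)).induction_on
    (p := fun S => ∃ ε > 0, ∃ C ≥ 0, ∀ z ∈ S,
      ∀ (uL uR : State p) (W : ℝ → State p) (u : Fin (p + 1) → State p) (σm σp : Fin p → ℝ),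
      RiemannFan (f z.1 z.2) (fun i => lam i z.1 z.2) uL uR W u σm σp →
      (∀ ξ, W ξ ∈ Metric.closedBall (0 : State p) ε) →
      ∑ i, waveStrength W (u i.castSucc) (u i.succ) (σm i) (σp i) ≤ C * ‖uR - uL‖) ?_ ?_ ?_ ?_
  · exact ⟨1, one_pos, 0, le_rfl, fun z hz => hz.elim⟩
  · rintro S S' hSS' ⟨ε, hε, C, hC, h⟩
    exact ⟨ε, hε, C, hC, fun z hz => h z (hSS' hz)⟩
  · rintro S S' ⟨ε, hε, C, hC, h⟩ ⟨ε', hε', C', hC', h'⟩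
    refine ⟨min ε ε', lt_min hε hε', max C C', le_max_of_le_left hC, ?_⟩
    rintro z (hz | hz) uL uR W u σm σp hfan hW
    · refine (h z hz uL uR W u σm σp hfan fun ξ =>
        Metric.closedBall_subset_closedBall (min_le_left _ _) (hW ξ)).trans ?_
      gcongr
      exact le_max_left _ _
    · refine (h' z hz uL uR W u σm σp hfan fun ξ =>
        Metric.closedBall_subset_closedBall (min_le_right _ _) (hW ξ)).trans ?_
      gcongr
      exact le_max_right _ _
  · rintro ⟨t, x⟩ hz
    obtain ⟨ε, hε, C, hC, h⟩ := exists_sum_strength_le_near hΩ h0 hsys hz.1.1 x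
    refine ⟨Metric.ball (t, x) ε ∩ (Icc (0 : ℝ) T ×ˢ Icc (-X) X),
      Filter.inter_mem (mem_nhdsWithin_of_mem_nhds (Metric.ball_mem_nhds _ hε))
        self_mem_nhdsWithin, ε, hε, C, hC, ?_⟩
    rintro ⟨t₀, x₀⟩ ⟨hz', hz''⟩
    rw [Metric.mem_ball, Prod.dist_eq] at hz'
    exact h t₀ x₀ hz''.1.1 ((le_max_left _ _).trans_lt hz') ((le_max_right _ _).trans_lt hz')

/-! ### Test functions -/

section TestFunction

variable {θ : ℝ → ℝ → ℝ}

theorem IsTestFunction.hasFDerivWithinAt (hθ : IsTestFunction θ) {t : ℝ} (ht : 0 ≤ t) (x : ℝ) :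
    HasFDerivWithinAt (fun z : ℝ × ℝ => θ z.1 z.2)
      (fderivWithin ℝ (fun z : ℝ × ℝ => θ z.1 z.2) (Ici (0 : ℝ) ×ˢ univ) (t, x))
      (Ici (0 : ℝ) ×ˢ univ) (t, x) :=
  ((hθ.1.differentiableOn (by simp)) (t, x) ⟨ht, mem_univ _⟩).hasFDerivWithinAt

theorem IsTestFunction.hasDerivAt_space_aux (hθ : IsTestFunction θ) {t : ℝ} (ht : 0 ≤ t)
    (x : ℝ) : HasDerivAt (fun y => θ t y)
      (fderivWithin ℝ (fun z : ℝ × ℝ => θ z.1 z.2) (Ici (0 : ℝ) ×ˢ univ) (t, x) (0, 1)) x := by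
  have h2 : HasFDerivWithinAt (fun y : ℝ => (t, y)) (ContinuousLinearMap.inr ℝ ℝ ℝ) univ x :=
    (hasFDerivAt_prodMk_right t x).hasFDerivWithinAt
  have hmaps : MapsTo (fun y : ℝ => (t, y)) univ (Ici (0 : ℝ) ×ˢ (univ : Set ℝ)) :=
    fun y _ => ⟨ht, mem_univ _⟩
  have h3 := HasFDerivWithinAt.comp x (hθ.hasFDerivWithinAt ht x) h2 hmaps
  have h4 := (hasFDerivWithinAt_univ.1 h3).hasDerivAt
  simpa [Function.comp_def] using h4

theorem IsTestFunction.hasDerivWithinAt_time_aux (hθ : IsTestFunction θ) {t : ℝ} (ht : 0 ≤ t)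
    (x : ℝ) : HasDerivWithinAt (fun τ => θ τ x)
      (fderivWithin ℝ (fun z : ℝ × ℝ => θ z.1 z.2) (Ici (0 : ℝ) ×ˢ univ) (t, x) (1, 0))
      (Ici 0) t := by
  have h2 : HasFDerivWithinAt (fun τ : ℝ => (τ, x)) (ContinuousLinearMap.inl ℝ ℝ ℝ) (Ici 0) t :=
    (hasFDerivAt_prodMk_left t x).hasFDerivWithinAt
  have hmaps : MapsTo (fun τ : ℝ => (τ, x)) (Ici 0) (Ici (0 : ℝ) ×ˢ (univ : Set ℝ)) :=
    fun y hy => ⟨hy, mem_univ _⟩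
  have h3 := HasFDerivWithinAt.comp t (hθ.hasFDerivWithinAt ht x) h2 hmaps
  simpa [Function.comp_def] using h3.hasDerivWithinAt

theorem IsTestFunction.dx_eq (hθ : IsTestFunction θ) {t : ℝ} (ht : 0 ≤ t) (x : ℝ) :
    dx θ t x =
      fderivWithin ℝ (fun z : ℝ × ℝ => θ z.1 z.2) (Ici (0 : ℝ) ×ˢ univ) (t, x) (0, 1) :=
  (hθ.hasDerivAt_space_aux ht x).deriv

theorem IsTestFunction.dt_eq (hθ : IsTestFunction θ) {t : ℝ} (ht : 0 ≤ t) (x : ℝ) :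
    dt θ t x =
      fderivWithin ℝ (fun z : ℝ × ℝ => θ z.1 z.2) (Ici (0 : ℝ) ×ˢ univ) (t, x) (1, 0) :=
  (hθ.hasDerivWithinAt_time_aux ht x).derivWithin (uniqueDiffOn_Ici 0 t ht)

theorem IsTestFunction.hasDerivAt_space (hθ : IsTestFunction θ) {t : ℝ} (ht : 0 ≤ t) (x : ℝ) :
    HasDerivAt (fun y => θ t y) (dx θ t x) x := by
  rw [hθ.dx_eq ht]
  exact hθ.hasDerivAt_space_aux ht x

/-- The derivative of a test function along a ray `x = x₀ + τ ξ`, `t = t₀ + τ`. -/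
theorem IsTestFunction.hasDerivAt_ray (hθ : IsTestFunction θ) {t₀ τ : ℝ} (ht : 0 < t₀ + τ)
    (x₀ ξ : ℝ) : HasDerivAt (fun τ => θ (t₀ + τ) (x₀ + τ * ξ))
      (dt θ (t₀ + τ) (x₀ + τ * ξ) + ξ * dx θ (t₀ + τ) (x₀ + τ * ξ)) τ := by
  have h1 := (hθ.hasFDerivWithinAt ht.le (x₀ + τ * ξ)).hasFDerivAt
    (prod_mem_nhds (Ici_mem_nhds ht) Filter.univ_mem)
  have h2 : HasDerivAt (fun τ : ℝ => (t₀ + τ, x₀ + τ * ξ)) (1, ξ) τ := by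
    refine HasDerivAt.prodMk ((hasDerivAt_id τ).const_add t₀) ?_
    simpa using ((hasDerivAt_id τ).mul_const ξ).const_add x₀
  have h3 := HasFDerivAt.comp_hasDerivAt τ h1 h2
  rw [show ((1 : ℝ), ξ) = (1, 0) + ξ • (0, 1) by simp, map_add, map_smul, smul_eq_mul,
    ← hθ.dx_eq ht.le, ← hθ.dt_eq ht.le] at h3
  exact h3

theorem IsTestFunction.hasDerivAt_time (hθ : IsTestFunction θ) {t₀ τ : ℝ} (ht : 0 < t₀ + τ)
    (x : ℝ) : HasDerivAt (fun τ => θ (t₀ + τ) x) (dt θ (t₀ + τ) x) τ := by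
  simpa using hθ.hasDerivAt_ray ht x 0

theorem IsTestFunction.continuousOn (hθ : IsTestFunction θ) :
    ContinuousOn (fun z : ℝ × ℝ => θ z.1 z.2) (Ici (0 : ℝ) ×ˢ univ) := hθ.1.continuousOn

theorem IsTestFunction.continuousOn_fderivWithin (hθ : IsTestFunction θ) :
    ContinuousOn (fderivWithin ℝ (fun z : ℝ × ℝ => θ z.1 z.2) (Ici (0 : ℝ) ×ˢ univ))
      (Ici (0 : ℝ) ×ˢ univ) :=
  hθ.1.continuousOn_fderivWithin ((uniqueDiffOn_Ici 0).prod uniqueDiffOn_univ) (by simp)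

theorem IsTestFunction.continuousOn_dx (hθ : IsTestFunction θ) :
    ContinuousOn (fun z : ℝ × ℝ => dx θ z.1 z.2) (Ici (0 : ℝ) ×ˢ univ) :=
  (hθ.continuousOn_fderivWithin.clm_apply continuousOn_const).congr fun z hz => hθ.dx_eq hz.1 z.2

theorem IsTestFunction.continuousOn_dt (hθ : IsTestFunction θ) :
    ContinuousOn (fun z : ℝ × ℝ => dt θ z.1 z.2) (Ici (0 : ℝ) ×ˢ univ) :=
  (hθ.continuousOn_fderivWithin.clm_apply continuousOn_const).congr fun z hz => hθ.dt_eq hz.1 z.2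

/-- A supremum of reals bounds its terms only if it is finite. For `φ` this follows from the compact
support of `ψ`; the case `φ = ψ` and those where `φ` is a partial derivative of `ψ` are needed. -/
theorem le_normC0 {φ ψ : ℝ → ℝ → ℝ}
    (hφ : ContinuousOn (fun z : ℝ × ℝ => φ z.1 z.2) (Ici (0 : ℝ) ×ˢ univ))
    (hψ : HasCompactSupport fun z : Ici (0 : ℝ) × ℝ => ψ z.1 z.2)
    (h : ∀ z : Ici (0 : ℝ) × ℝ, (fun z : Ici (0 : ℝ) × ℝ => ψ z.1 z.2) =ᶠ[𝓝 z] 0 →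
      φ z.1 z.2 = 0) {t : ℝ} (ht : 0 ≤ t) (x : ℝ) :
    |φ t x| ≤ normC0 φ := by
  have hc : Continuous fun z : Ici (0 : ℝ) × ℝ => φ z.1 z.2 :=
    hφ.comp_continuous (f := fun z : Ici (0 : ℝ) × ℝ => ((z.1 : ℝ), z.2)) (by fun_prop)
      fun z => ⟨z.1.2, mem_univ _⟩
  have hs : HasCompactSupport fun z : Ici (0 : ℝ) × ℝ => φ z.1 z.2 :=
    hψ.mono' fun z hz => by
      by_contra hz'
      exact hz (h z (notMem_tsupport_iff_eventuallyEq.1 hz'))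
  have hb : BddAbove (range fun z : Ici (0 : ℝ) × ℝ => |φ z.1 z.2|) :=
    hc.abs.bddAbove_range_of_hasCompactSupport hs.norm
  exact le_ciSup hb (⟨t, ht⟩, x)

theorem normC0_nonneg (φ : ℝ → ℝ → ℝ) : 0 ≤ normC0 φ := Real.iSup_nonneg fun _ => abs_nonneg _

theorem IsTestFunction.le_normC1 (hθ : IsTestFunction θ) {t : ℝ} (ht : 0 ≤ t) (x : ℝ) :
    |θ t x| ≤ normC1 θ ∧ |dt θ t x| ≤ normC1 θ ∧ |dx θ t x| ≤ normC1 θ := by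
  have h1 := normC0_nonneg θ
  have h2 := normC0_nonneg (dt θ)
  have h3 := normC0_nonneg (dx θ)
  have h4 := le_normC0 hθ.continuousOn hθ.2 (fun z hz => hz.eq_of_nhds) ht x
  have h5 := le_normC0 hθ.continuousOn_dt hθ.2 (fun z hz => by
    have : (fun τ => θ τ z.2) =ᶠ[𝓝[Ici 0] (z.1 : ℝ)] fun _ => 0 := by
      rw [← map_nhds_subtype_val z.1]
      have hcont : Filter.Tendsto (fun τ : Ici (0 : ℝ) => (τ, z.2)) (𝓝 z.1) (𝓝 z) :=
        (by fun_prop : Continuous fun τ : Ici (0 : ℝ) => (τ, z.2)).tendsto z.1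
      exact Filter.eventually_map.2 (hcont.eventually hz)
    rw [dt, this.derivWithin_eq (this.self_of_nhdsWithin z.1.2)]
    simp) ht x
  have h6 := le_normC0 hθ.continuousOn_dx hθ.2 (fun z hz => by
    have : (fun y => θ z.1 y) =ᶠ[𝓝 z.2] fun _ => 0 := by
      have hcont : Filter.Tendsto (fun y : ℝ => (z.1, y)) (𝓝 z.2) (𝓝 z) :=
        (by fun_prop : Continuous fun y : ℝ => (z.1, y)).tendsto z.2
      exact hcont.eventually hz
    rw [dx, this.deriv_eq]
    simp) ht x
  unfold normC1
  exact ⟨by linarith, by linarith, by linarith⟩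

end TestFunction

/-! ### Integration along a Riemann fan -/

/-- The composition of a measurable map into a compact set with a function continuous on that set is
integrable. This covers discontinuous profiles and functions that are smooth only on `Ω`. -/
theorem integrableOn_comp_of_continuousOn {β Y E : Type*} [MeasurableSpace β]
    [TopologicalSpace Y] [MeasurableSpace Y] [BorelSpace Y] [T2Space Y]
    [NormedAddCommGroup E] [MeasurableSpace E] [BorelSpace E] [SecondCountableTopology E]
    {μ : Measure β} {G : Y → E} {S : Set Y} (hS : IsCompact S) (hG : ContinuousOn G S)
    {m : β → Y} (hm : Measurable m) {B : Set β} (hB : MeasurableSet B) (hμ : μ B < ⊤)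
    (hmaps : MapsTo m B S) : IntegrableOn (fun z => G (m z)) B μ := by
  classical
  obtain ⟨M, hM⟩ := hS.exists_bound_of_continuousOn hG
  have h1 : Measurable (S.piecewise G fun _ => 0) :=
    hG.measurable_piecewise continuousOn_const hS.measurableSet
  have h2 : AEStronglyMeasurable (fun z => G (m z)) (μ.restrict B) := by
    refine (h1.comp hm).aestronglyMeasurable.congr ?_
    filter_upwards [ae_restrict_mem hB] with z hz
    simp [Function.comp, Set.piecewise_eq_of_mem _ _ _ (hmaps hz)]
  have : IsFiniteMeasure (μ.restrict B) := ⟨by simpa using hμ⟩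
  refine Integrable.of_bound h2 M ?_
  filter_upwards [ae_restrict_mem hB] with z hz using hM _ (hmaps hz)

namespace RiemannFan

variable {p : ℕ} {F : State p → State p} {l : Fin p → State p → ℝ} {uL uR : State p}
  {W : ℝ → State p} {u : Fin (p + 1) → State p} {σm σp : Fin p → ℝ}

theorem mem_wave_or_gap (h : RiemannFan F l uL uR W u σm σp) (ξ : ℝ) :
    (∃ i, ξ ∈ Icc (σm i) (σp i)) ∨
      ∃ k : Fin (p + 1), (∀ j : Fin p, j.castSucc < k → σp j < ξ) ∧
        ∀ j : Fin p, k ≤ j.castSucc → ξ < σm j := by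
  by_cases hex : ∃ i, ξ ∈ Icc (σm i) (σp i)
  · exact Or.inl hex
  right
  push Not at hex
  have hor : ∀ i, ¬ σp i < ξ → ξ < σm i := fun i hi => by
    by_contra hc
    exact hex i ⟨not_lt.1 hc, not_lt.1 hi⟩
  by_cases hall : ∀ i, σp i < ξ
  · exact ⟨Fin.last p, fun j _ => hall j, fun j hj =>
      absurd hj (not_le.2 (Fin.castSucc_lt_last j))⟩
  · push Not at hall
    obtain ⟨i, hi, hmin⟩ := WellFounded.has_min (wellFounded_lt (α := Fin p))
      {i | ξ ≤ σp i} hall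
    refine ⟨i.castSucc, fun j hj => not_le.1 fun hc =>
      hmin j hc (Fin.castSucc_lt_castSucc_iff.1 hj), fun j hj => ?_⟩
    have hξi := hor i (not_lt.2 hi)
    rcases (Fin.castSucc_le_castSucc_iff.1 hj).eq_or_lt with rfl | hlt
    · exact hξi
    · exact (hξi.trans_le (h.speed_le i)).trans (h.ordered i j hlt)

theorem continuousOn_wave (h : RiemannFan F l uL uR W u σm σp) (i : Fin p) :
    ContinuousOn W (Icc (σm i) (σp i)) := by
  rcases h.wave i with hi | hi
  · exact hi.2.2.2.1.continuousOn
  · rw [← hi.1, Icc_self]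
    exact continuousOn_singleton _ _

theorem measurable (h : RiemannFan F l uL uR W u σm σp) : Measurable W := by
  classical
  set gap : Fin (p + 1) → Set ℝ := fun k =>
    {ξ | (∀ j : Fin p, j.castSucc < k → σp j < ξ) ∧ ∀ j : Fin p, k ≤ j.castSucc → ξ < σm j}
    with hgap
  have hgapm : ∀ k, MeasurableSet (gap k) := by
    intro k
    simp only [hgap, Set.ofPred_and, Set.ofPred_forall]
    refine MeasurableSet.inter ?_ ?_
    · exact MeasurableSet.iInter fun j => MeasurableSet.iInter fun _ => measurableSet_Ioi
    · exact MeasurableSet.iInter fun j => MeasurableSet.iInter fun _ => measurableSet_Iio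
  intro B hB
  have hpre : W ⁻¹' B = (⋃ i, Icc (σm i) (σp i) ∩ W ⁻¹' B) ∪ ⋃ k, gap k ∩ W ⁻¹' B := by
    ext ξ
    simp only [mem_union, mem_iUnion, mem_inter_iff]
    constructor
    · intro hξ
      rcases h.mem_wave_or_gap ξ with ⟨i, hi⟩ | ⟨k, hk⟩
      · exact Or.inl ⟨i, hi, hξ⟩
      · exact Or.inr ⟨k, hk, hξ⟩
    · rintro (⟨i, -, hξ⟩ | ⟨k, -, hξ⟩) <;> exact hξ
  rw [hpre]
  refine MeasurableSet.union (MeasurableSet.iUnion fun i => ?_) (MeasurableSet.iUnion fun k => ?_)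
  · have h1 : Measurable ((Icc (σm i) (σp i)).piecewise W fun _ => 0) :=
      (h.continuousOn_wave i).measurable_piecewise continuousOn_const measurableSet_Icc
    convert measurableSet_Icc.inter (h1 hB) using 1
    ext ξ
    simp only [mem_inter_iff, mem_preimage]
    refine and_congr_right fun hξ => ?_
    rw [Set.piecewise_eq_of_mem _ _ _ hξ]
  · have : gap k ∩ W ⁻¹' B = if u k ∈ B then gap k else ∅ := by
      ext ξ
      simp only [mem_inter_iff, mem_preimage]
      constructor
      · rintro ⟨h1, h2⟩
        rw [h.const k ξ h1.1 h1.2] at h2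
        rwa [if_pos h2]
      · split_ifs with hu
        · intro h1
          exact ⟨h1, by rwa [h.const k ξ h1.1 h1.2]⟩
        · exact fun h1 => h1.elim
    rw [this]
    split_ifs
    · exact hgapm k
    · exact MeasurableSet.empty

/-- Outside the fan of waves, `W` is equal to one of the extreme states. -/
theorem eq_left (h : RiemannFan F l uL uR W u σm σp) {a : ℝ} (ha : ∀ i, -a ≤ σm i) {ξ : ℝ}
    (hξ : ξ < -a) : W ξ = uL := by
  rw [← h.left]
  exact h.const 0 ξ (fun j hj => absurd hj (Fin.not_lt_zero _)) fun j _ => hξ.trans_le (ha j)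

theorem eq_right (h : RiemannFan F l uL uR W u σm σp) {a : ℝ} (ha : ∀ i, σp i ≤ a) {ξ : ℝ}
    (hξ : a < ξ) : W ξ = uR := by
  rw [← h.right]
  exact h.const _ ξ (fun j _ => (ha j).trans_lt hξ)
    fun j hj => absurd hj (not_le.2 (Fin.castSucc_lt_last j))

/-- Integration of an exact `ξ`-derivative across a Riemann fan: if `h' (ξ, v)` is the
`ξ`-derivative of `h (ξ, v)` at fixed `v`, the integral of `h' (ξ, W ξ)` differs from the increment
of `h (ξ, W ξ)` by at most the sum of the defects `e i` across the single waves. -/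
theorem norm_integral_sub_le (hfan : RiemannFan F l uL uR W u σm σp) {E : Type*}
    [NormedAddCommGroup E] [NormedSpace ℝ E] {a : ℝ} (ha : 0 ≤ a)
    (hσ : ∀ i, -a ≤ σm i ∧ σp i ≤ a) {h h' : ℝ → State p → E} {e : Fin p → ℝ}
    (hint : IntervalIntegrable (fun ξ => h' ξ (W ξ)) volume (-a) a)
    (hconst : ∀ k, ∀ α β, -a ≤ α → α ≤ β → β ≤ a →
      ∫ ξ in α..β, h' ξ (u k) = h β (u k) - h α (u k))
    (hwave : ∀ i, ‖(∫ ξ in σm i..σp i, h' ξ (W ξ))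
      - (h (σp i) (u i.succ) - h (σm i) (u i.castSucc))‖ ≤ e i) :
    ‖(∫ ξ in (-a)..a, h' ξ (W ξ)) - (h a uR - h (-a) uL)‖ ≤ ∑ i, e i := by
  have hsub : ∀ {α β}, -a ≤ α → α ≤ β → β ≤ a →
      IntervalIntegrable (fun ξ => h' ξ (W ξ)) volume α β := fun h1 h2 h3 =>
    hint.mono_set (by
      rw [uIcc_of_le h2, uIcc_of_le (by linarith)]; exact Icc_subset_Icc h1 h3)
  have hgap : ∀ k : Fin (p + 1), ∀ α β, -a ≤ α → α ≤ β → β ≤ a →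
      (∀ j : Fin p, j.castSucc < k → σp j ≤ α) → (∀ j : Fin p, k ≤ j.castSucc → β ≤ σm j) →
      ∫ ξ in α..β, h' ξ (W ξ) = h β (u k) - h α (u k) := by
    intro k α β h1 h2 h3 h4 h5
    rw [← hconst k α β h1 h2 h3]
    refine intervalIntegral.integral_congr_ae ?_
    rw [uIoc_of_le h2]
    filter_upwards [Measure.ae_ne volume β] with ξ hξ hξ'
    rw [hfan.const k ξ (fun j hj => (h4 j hj).trans_lt hξ'.1)
      fun j hj => (hξ'.2.lt_of_ne hξ).trans_le (h5 j hj)]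
  have key : ∀ n : ℕ, ∀ hn : n < p + 1, ∀ b, -a ≤ b → b ≤ a →
      (∀ j : Fin p, (j : ℕ) < n → σp j ≤ b) → (∀ j : Fin p, n ≤ j → b ≤ σm j) →
      ‖(∫ ξ in (-a)..b, h' ξ (W ξ)) - (h b (u ⟨n, hn⟩) - h (-a) uL)‖
        ≤ ∑ i ∈ Finset.univ.filter fun i : Fin p => (i : ℕ) < n, e i := by
    intro n
    induction n with
    | zero =>
      intro hn b hb hb' h1 h2
      rw [hgap ⟨0, hn⟩ (-a) b le_rfl hb hb' (fun j hj => absurd hj (Fin.not_lt_zero _))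
        fun j _ => h2 j (Nat.zero_le _), ← hfan.left]
      simp
    | succ n ih =>
      intro hn b hb hb' h1 h2
      have hnp : n < p := Nat.lt_of_succ_lt_succ hn
      set i : Fin p := ⟨n, hnp⟩ with hi
      have hσi := hfan.speed_le i
      have hσb : σp i ≤ b := h1 i (Nat.lt_succ_self n)
      have hih := ih (by omega) (σm i) (hσ i).1 (hσi.trans (hσ i).2)
        (fun j hj => (hfan.ordered j i hj).le) (fun j hj => by
          rcases hj.eq_or_lt with heq | hlt
          · rw [show j = i from Fin.ext heq.symm]
          · exact hσi.trans (hfan.ordered i j hlt).le)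
      have hg := hgap ⟨n + 1, hn⟩ (σp i) b ((hσ i).1.trans hσi) hσb hb'
        (fun j hj => by
          have hj' : (j : ℕ) ≤ n := Nat.lt_succ_iff.1 hj
          rcases hj'.eq_or_lt with heq | hlt
          · rw [show j = i from Fin.ext heq]
          · exact (hfan.ordered j i hlt).le.trans hσi)
        fun j hj => h2 j hj
      have hI1 := hsub le_rfl (hσ i).1 (hσi.trans (hσ i).2)
      have hI2 := hsub (hσ i).1 hσi (hσ i).2
      have hI3 := hsub ((hσ i).1.trans hσi) hσb hb'
      rw [← intervalIntegral.integral_add_adjacent_intervals (hI1.trans hI2) hI3,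
        ← intervalIntegral.integral_add_adjacent_intervals hI1 hI2, hg]
      have hfilter : (Finset.univ.filter fun j : Fin p => (j : ℕ) < n + 1)
          = insert i (Finset.univ.filter fun j : Fin p => (j : ℕ) < n) := by
        ext j
        simp only [Finset.mem_filter, Finset.mem_univ, true_and, Finset.mem_insert, hi,
          Fin.ext_iff]
        omega
      rw [hfilter, Finset.sum_insert (by simp [hi])]
      have hw := hwave i
      have hcs : i.castSucc = ⟨n, by omega⟩ := rfl
      have hsc : i.succ = ⟨n + 1, hn⟩ := rfl
      rw [hcs, hsc] at hw
      calc _ = ‖((∫ ξ in σm i..σp i, h' ξ (W ξ))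
              - (h (σp i) (u ⟨n + 1, hn⟩) - h (σm i) (u ⟨n, by omega⟩)))
            + ((∫ ξ in (-a)..σm i, h' ξ (W ξ))
              - (h (σm i) (u ⟨n, by omega⟩) - h (-a) uL))‖ := by congr 1; abel
        _ ≤ _ := (norm_add_le _ _).trans (add_le_add hw hih)
  have := key p (Nat.lt_succ_self p) a (by linarith) le_rfl (fun j _ => (hσ j).2)
    (fun j hj => absurd j.2 (not_lt.2 hj))
  rw [show (⟨p, Nat.lt_succ_self p⟩ : Fin (p + 1)) = Fin.last p from rfl, hfan.right] at this
  refine this.trans (le_of_eq ?_)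
  congr 1
  ext i
  simp

end RiemannFan

/-! ### The relative flux on a short cell -/

/-- The state `v + τ q(t₀, x₀, v)` that the approximate solution takes at time `t₀ + τ` where the
classical solution takes the value `v`. -/
noncomputable def correctedState {p : ℕ} (f g : ℝ → ℝ → State p → State p) (t₀ x₀ τ : ℝ)
    (v : State p) : State p :=
  v + τ • qMap f g t₀ x₀ v

/-- The flux of the corrected state relative to the ray `x = x₀ + τ ξ`, `t = t₀ + τ`. -/
noncomputable def relFlux {p : ℕ} (f g : ℝ → ℝ → State p → State p) (t₀ x₀ τ ξ : ℝ)
    (v : State p) : State p :=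
  f (t₀ + τ) (x₀ + τ * ξ) (correctedState f g t₀ x₀ τ v) - ξ • correctedState f g t₀ x₀ τ v

/-- The derivative of `relFlux` with respect to the state. -/
noncomputable def relFluxDu {p : ℕ} (f g : ℝ → ℝ → State p → State p) (t₀ x₀ τ ξ : ℝ)
    (v : State p) : State p →L[ℝ] State p :=
  (fderiv ℝ (f (t₀ + τ) (x₀ + τ * ξ)) (correctedState f g t₀ x₀ τ v)
    - ξ • ContinuousLinearMap.id ℝ (State p)).comp
      (ContinuousLinearMap.id ℝ (State p) + τ • fderiv ℝ (qMap f g t₀ x₀) v)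

/-- The `ξ`-derivative, at fixed state `v`, of the relative flux weighted by the test function. -/
noncomputable def weightedFluxDeriv {p : ℕ} (f g : ℝ → ℝ → State p → State p) (θ : ℝ → ℝ → ℝ)
    (t₀ x₀ τ ξ : ℝ) (v : State p) : State p :=
  θ (t₀ + τ) (x₀ + τ * ξ) •
      (τ • deriv (fun y => f (t₀ + τ) y (correctedState f g t₀ x₀ τ v)) (x₀ + τ * ξ)
        - correctedState f g t₀ x₀ τ v)
    + (τ * dx θ (t₀ + τ) (x₀ + τ * ξ)) • relFlux f g t₀ x₀ τ ξ v

/-- The residual `q(t₀, x₀, v) + ∂ₓf - g` that the corrected constant state `v` leaves in the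
balance law. -/
noncomputable def sourceDefect {p : ℕ} (f g : ℝ → ℝ → State p → State p) (t₀ x₀ τ y : ℝ)
    (v : State p) : State p :=
  qMap f g t₀ x₀ v
    + deriv (fun y => f (t₀ + τ) y (correctedState f g t₀ x₀ τ v)) (x₀ + y)
    - g (t₀ + τ) (x₀ + y) (correctedState f g t₀ x₀ τ v)

/-- A space-time cell `[t₀, t₀ + s] × [x₀ - r, x₀ + r]` so short that the corrections of states
`|v| ≤ ρ` stay in the ball `|u| ≤ R` where `LocalBounds` gives control. -/
structure Cell {p : ℕ} (f g : ℝ → ℝ → State p → State p) (T X R L ρ t₀ x₀ s r : ℝ) : Prop where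
  bounds : LocalBounds f g T X R L
  base_nonneg : 0 ≤ t₀
  duration_pos : 0 < s
  width_pos : 0 < r
  time_le : t₀ + s ≤ T
  space_le : |x₀| + r ≤ X
  radius_le : ρ + s * L ≤ R

namespace Cell

variable {p : ℕ} {f g : ℝ → ℝ → State p → State p} {T X R L ρ t₀ x₀ s r : ℝ}

theorem time_mem (h : Cell f g T X R L ρ t₀ x₀ s r) {τ : ℝ} (hτ : τ ∈ Icc 0 s) :
    t₀ + τ ∈ Icc 0 T := by
  have := h.base_nonneg
  have := h.time_le
  exact ⟨by linarith [hτ.1], by linarith [hτ.2]⟩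

theorem base_mem (h : Cell f g T X R L ρ t₀ x₀ s r) : t₀ ∈ Icc 0 T := by
  simpa using h.time_mem (left_mem_Icc.2 h.duration_pos.le)

theorem space_mem (h : Cell f g T X R L ρ t₀ x₀ s r) {y : ℝ} (hy : |y| ≤ r) :
    x₀ + y ∈ Icc (-X) X := by
  have h1 := abs_le.1 hy
  have h2 := h.space_le
  have h3 := abs_le.1 (le_refl |x₀|)
  constructor <;> linarith

theorem center_mem (h : Cell f g T X R L ρ t₀ x₀ s r) : x₀ ∈ Icc (-X) X := by
  simpa using h.space_mem (y := 0) (by simpa using h.width_pos.le)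

theorem abs_ray_le (h : Cell f g T X R L ρ t₀ x₀ s r) {τ ξ : ℝ} (hτ : τ ∈ Icc 0 s)
    (hξ : |ξ| ≤ r / s) : |τ * ξ| ≤ r := by
  rw [abs_mul, abs_of_nonneg hτ.1]
  calc τ * |ξ| ≤ s * (r / s) := mul_le_mul hτ.2 hξ (abs_nonneg _) h.duration_pos.le
    _ = r := mul_div_cancel₀ _ h.duration_pos.ne'

theorem ball_subset (h : Cell f g T X R L ρ t₀ x₀ s r) :
    Metric.closedBall (0 : State p) ρ ⊆ Metric.closedBall 0 R := by
  refine Metric.closedBall_subset_closedBall ?_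
  have := h.radius_le
  have := mul_nonneg h.duration_pos.le h.bounds.nonneg
  linarith

theorem q_le (h : Cell f g T X R L ρ t₀ x₀ s r) {v : State p}
    (hv : v ∈ Metric.closedBall (0 : State p) ρ) : ‖qMap f g t₀ x₀ v‖ ≤ L :=
  h.bounds.q_le t₀ h.base_mem x₀ h.center_mem v (h.ball_subset hv)

theorem correctedState_sub_le (h : Cell f g T X R L ρ t₀ x₀ s r) {τ : ℝ} (hτ : τ ∈ Icc 0 s)
    {v : State p} (hv : v ∈ Metric.closedBall (0 : State p) ρ) :
    ‖correctedState f g t₀ x₀ τ v - v‖ ≤ τ * L := by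
  rw [correctedState, add_sub_cancel_left, norm_smul, Real.norm_eq_abs, abs_of_nonneg hτ.1]
  exact mul_le_mul_of_nonneg_left (h.q_le hv) hτ.1

theorem correctedState_mem (h : Cell f g T X R L ρ t₀ x₀ s r) {τ : ℝ} (hτ : τ ∈ Icc 0 s)
    {v : State p} (hv : v ∈ Metric.closedBall (0 : State p) ρ) :
    correctedState f g t₀ x₀ τ v ∈ Metric.closedBall (0 : State p) R := by
  rw [mem_closedBall_zero_iff] at hv ⊢
  have h1 := h.correctedState_sub_le hτ (mem_closedBall_zero_iff.2 hv)
  have h2 := norm_le_norm_add_norm_sub' (correctedState f g t₀ x₀ τ v) v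
  have h3 : τ * L ≤ s * L := mul_le_mul_of_nonneg_right hτ.2 h.bounds.nonneg
  have := h.radius_le
  linarith

/-! ### Estimates at a fixed time -/

theorem sourceDefect_le (h : Cell f g T X R L ρ t₀ x₀ s r) {τ y : ℝ} (hτ : τ ∈ Icc 0 s)
    (hy : |y| ≤ r) {v : State p} (hv : v ∈ Metric.closedBall (0 : State p) ρ) :
    ‖sourceDefect f g t₀ x₀ τ y v‖ ≤ 2 * L * (1 + L) * (τ + |y|) := by
  have hL := h.bounds.nonneg
  have h1 := h.bounds.source_lip t₀ h.base_mem x₀ h.center_mem v (h.ball_subset hv)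
    (t₀ + τ) (h.time_mem hτ) (x₀ + y) (h.space_mem hy) _ (h.correctedState_mem hτ hv)
  have h2 := h.bounds.fluxDx_lip t₀ h.base_mem x₀ h.center_mem v (h.ball_subset hv)
    (t₀ + τ) (h.time_mem hτ) (x₀ + y) (h.space_mem hy) _ (h.correctedState_mem hτ hv)
  have h3 := h.correctedState_sub_le hτ hv
  simp only [add_sub_cancel_left, abs_of_nonneg hτ.1] at h1 h2
  have h4 : sourceDefect f g t₀ x₀ τ y v
      = (deriv (fun y => f (t₀ + τ) y (correctedState f g t₀ x₀ τ v)) (x₀ + y)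
          - deriv (fun y => f t₀ y v) x₀)
        - (g (t₀ + τ) (x₀ + y) (correctedState f g t₀ x₀ τ v) - g t₀ x₀ v) := by
    rw [sourceDefect, qMap]; abel
  rw [h4]
  refine (norm_sub_le _ _).trans ((add_le_add h2 h1).trans ?_)
  have h5 : τ + |y| + ‖correctedState f g t₀ x₀ τ v - v‖ ≤ (1 + L) * (τ + |y|) := by
    have := mul_nonneg hL (abs_nonneg y)
    linarith
  calc _ = 2 * L * (τ + |y| + ‖correctedState f g t₀ x₀ τ v - v‖) := by ring
    _ ≤ 2 * L * ((1 + L) * (τ + |y|)) := by gcongr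
    _ = _ := by ring

/-- The state derivative of the relative flux is close to its value at the base point. -/
theorem relFluxDu_sub_le (h : Cell f g T X R L ρ t₀ x₀ s r) {τ ξ : ℝ} (hτ : τ ∈ Icc 0 s)
    (hξ : |ξ| ≤ r / s) {v : State p} (hv : v ∈ Metric.closedBall (0 : State p) ρ) :
    ‖relFluxDu f g t₀ x₀ τ ξ v
        - (fderiv ℝ (f t₀ x₀) v - ξ • ContinuousLinearMap.id ℝ (State p))‖
      ≤ 2 * L * (1 + L) * (τ * (1 + |ξ|)) := by
  have hL := h.bounds.nonneg
  have hy := h.abs_ray_le hτ hξ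
  have h1 := h.bounds.jac_lip t₀ h.base_mem x₀ h.center_mem v (h.ball_subset hv)
    (t₀ + τ) (h.time_mem hτ) (x₀ + τ * ξ) (h.space_mem hy) _ (h.correctedState_mem hτ hv)
  have h2 := h.bounds.jac_le (t₀ + τ) (h.time_mem hτ) (x₀ + τ * ξ) (h.space_mem hy) _
    (h.correctedState_mem hτ hv)
  have h3 := h.correctedState_sub_le hτ hv
  have h4 := h.bounds.qDu_le t₀ h.base_mem x₀ h.center_mem v (h.ball_subset hv)
  simp only [add_sub_cancel_left, abs_mul, abs_of_nonneg hτ.1] at h1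
  unfold relFluxDu
  set A := fderiv ℝ (f (t₀ + τ) (x₀ + τ * ξ)) (correctedState f g t₀ x₀ τ v)
  set A₀ := fderiv ℝ (f t₀ x₀) v
  set Q := fderiv ℝ (qMap f g t₀ x₀) v
  have h5 : (A - ξ • ContinuousLinearMap.id ℝ (State p)).comp
        (ContinuousLinearMap.id ℝ (State p) + τ • Q)
        - (A₀ - ξ • ContinuousLinearMap.id ℝ (State p))
      = (A - A₀) + (τ • A.comp Q - (ξ * τ) • Q) := by
    ext1 z
    simp only [sub_apply, add_apply, smul_apply, ContinuousLinearMap.comp_apply,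
      ContinuousLinearMap.id_apply, map_add, map_smul]
    module
  rw [h5]
  have h6 : ‖τ • A.comp Q‖ ≤ τ * (L * L) := by
    rw [norm_smul, Real.norm_eq_abs, abs_of_nonneg hτ.1]
    refine mul_le_mul_of_nonneg_left ?_ hτ.1
    exact (ContinuousLinearMap.opNorm_comp_le _ _).trans
      (mul_le_mul h2 h4 (norm_nonneg _) hL)
  have h7 : ‖(ξ * τ) • Q‖ ≤ |ξ| * τ * L := by
    rw [norm_smul, Real.norm_eq_abs, abs_mul, abs_of_nonneg hτ.1]
    exact mul_le_mul_of_nonneg_left h4 (mul_nonneg (abs_nonneg _) hτ.1)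
  have h8 : ‖A - A₀‖ ≤ L * (τ + τ * |ξ| + τ * L) := h1.trans (by gcongr)
  have h9 := (norm_add_le (A - A₀) (τ • A.comp Q - (ξ * τ) • Q)).trans
    (add_le_add h8 ((norm_sub_le _ _).trans (add_le_add h6 h7)))
  refine h9.trans ?_
  have : 0 ≤ τ * L * L * |ξ| := by have := hτ.1; positivity
  have : 0 ≤ τ * L := mul_nonneg hτ.1 hL
  nlinarith

theorem hasFDerivAt_correctedState (h : Cell f g T X R L ρ t₀ x₀ s r) (τ : ℝ) {v : State p}
    (hv : v ∈ Metric.closedBall (0 : State p) ρ) :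
    HasFDerivAt (correctedState f g t₀ x₀ τ)
      (ContinuousLinearMap.id ℝ (State p) + τ • fderiv ℝ (qMap f g t₀ x₀) v) v :=
  (hasFDerivAt_id v).add ((h.bounds.q_diff t₀ x₀ v h.base_nonneg
    (mem_closedBall_zero_iff.1 (h.ball_subset hv))).hasFDerivAt.const_smul τ)

/-- The derivative of the relative flux along a curve of states. -/
theorem hasDerivAt_relFlux (h : Cell f g T X R L ρ t₀ x₀ s r) {τ ξ : ℝ} (hτ : τ ∈ Icc 0 s)
    {w : ℝ → State p} {w' : State p} (hw : HasDerivAt w w' ξ)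
    (hv : w ξ ∈ Metric.closedBall (0 : State p) ρ) :
    HasDerivAt (fun ξ => relFlux f g t₀ x₀ τ ξ (w ξ))
      (τ • deriv (fun y => f (t₀ + τ) y (correctedState f g t₀ x₀ τ (w ξ))) (x₀ + τ * ξ)
        - correctedState f g t₀ x₀ τ (w ξ) + relFluxDu f g t₀ x₀ τ ξ (w ξ) w') ξ := by
  set V := correctedState f g t₀ x₀ τ (w ξ) with hV
  set V' := (ContinuousLinearMap.id ℝ (State p) + τ • fderiv ℝ (qMap f g t₀ x₀) (w ξ)) w' with hV'
  have hVd : HasDerivAt (fun ξ => correctedState f g t₀ x₀ τ (w ξ)) V' ξ :=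
    (h.hasFDerivAt_correctedState τ hv).comp_hasDerivAt ξ hw
  have hF := (h.bounds.flux_diff (t₀ + τ) (x₀ + τ * ξ) V (h.time_mem hτ).1
    (mem_closedBall_zero_iff.1 (h.correctedState_mem hτ hv))).hasFDerivAt
  set F' := fderiv ℝ (fun y : ℝ × State p => f (t₀ + τ) y.1 y.2) (x₀ + τ * ξ, V) with hF'
  have hx : HasDerivAt (fun ξ : ℝ => x₀ + τ * ξ) τ ξ := by
    simpa using ((hasDerivAt_id ξ).const_mul τ).const_add x₀
  have h1 : HasDerivAt (fun ξ => f (t₀ + τ) (x₀ + τ * ξ) (correctedState f g t₀ x₀ τ (w ξ)))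
      (F' (τ, V')) ξ :=
    HasFDerivAt.comp_hasDerivAt (f := fun ξ => (x₀ + τ * ξ, correctedState f g t₀ x₀ τ (w ξ)))
      ξ hF (hx.prodMk hVd)
  have h2 : deriv (fun y => f (t₀ + τ) y V) (x₀ + τ * ξ) = F' (1, 0) := by
    have := (HasFDerivAt.comp (x₀ + τ * ξ) hF
      (hasFDerivAt_prodMk_left (x₀ + τ * ξ) V)).hasDerivAt.deriv
    simpa [Function.comp_def] using this
  have h3 : fderiv ℝ (f (t₀ + τ) (x₀ + τ * ξ)) V V' = F' (0, V') := by
    have := (HasFDerivAt.comp V hF (hasFDerivAt_prodMk_right (x₀ + τ * ξ) V)).fderiv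
    have h4 := congrArg (fun B : State p →L[ℝ] State p => B V') this
    simpa [Function.comp_def] using h4
  have h4 : HasDerivAt (fun ξ => ξ • correctedState f g t₀ x₀ τ (w ξ)) (ξ • V' + (1 : ℝ) • V) ξ :=
    (hasDerivAt_id ξ).smul hVd
  have h5 := h1.sub h4
  have h6 : F' (τ, V') = τ • F' (1, 0) + F' (0, V') := by
    rw [← map_smul, ← map_add]; simp
  have h7 : relFluxDu f g t₀ x₀ τ ξ (w ξ) w' = F' (0, V') - ξ • V' := by
    rw [← h3, relFluxDu, ContinuousLinearMap.comp_apply, sub_apply, ← hV, ← hV']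
    rfl
  rw [h2, h7]
  refine h5.congr_deriv ?_
  rw [h6, one_smul]
  abel

theorem hasDerivAt_weightedFlux (h : Cell f g T X R L ρ t₀ x₀ s r) {θ : ℝ → ℝ → ℝ}
    (hθ : IsTestFunction θ) {τ ξ : ℝ} (hτ : τ ∈ Icc 0 s)
    {w : ℝ → State p} {w' : State p} (hw : HasDerivAt w w' ξ)
    (hv : w ξ ∈ Metric.closedBall (0 : State p) ρ) :
    HasDerivAt (fun ξ => θ (t₀ + τ) (x₀ + τ * ξ) • relFlux f g t₀ x₀ τ ξ (w ξ))
      (weightedFluxDeriv f g θ t₀ x₀ τ ξ (w ξ)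
        + θ (t₀ + τ) (x₀ + τ * ξ) • relFluxDu f g t₀ x₀ τ ξ (w ξ) w') ξ := by
  have hx : HasDerivAt (fun ξ : ℝ => x₀ + τ * ξ) τ ξ := by
    simpa using ((hasDerivAt_id ξ).const_mul τ).const_add x₀
  have h1 : HasDerivAt (fun ξ => θ (t₀ + τ) (x₀ + τ * ξ))
      (dx θ (t₀ + τ) (x₀ + τ * ξ) * τ) ξ :=
    (hθ.hasDerivAt_space (h.time_mem hτ).1 (x₀ + τ * ξ)).comp ξ hx
  refine (h1.smul (h.hasDerivAt_relFlux hτ hw hv)).congr_deriv ?_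
  rw [weightedFluxDeriv, mul_comm (dx θ _ _) τ]
  simp only [smul_add]
  abel

theorem relFlux_jump_le (h : Cell f g T X R L ρ t₀ x₀ s r) {τ σ : ℝ} (hτ : τ ∈ Icc 0 s)
    (hσ : |σ| ≤ r / s) {um up : State p} (hum : um ∈ Metric.closedBall (0 : State p) ρ)
    (hup : up ∈ Metric.closedBall (0 : State p) ρ) (hRH : RankineHugoniot (f t₀ x₀) um up σ) :
    ‖relFlux f g t₀ x₀ τ σ up - relFlux f g t₀ x₀ τ σ um‖
      ≤ 2 * L * (1 + L) * (τ * (1 + |σ|)) * ‖up - um‖ := by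
  have hd : ∀ v ∈ Metric.closedBall (0 : State p) ρ,
      HasFDerivWithinAt (fun v => relFlux f g t₀ x₀ τ σ v - (f t₀ x₀ v - σ • v))
      (relFluxDu f g t₀ x₀ τ σ v
        - (fderiv ℝ (f t₀ x₀) v - σ • ContinuousLinearMap.id ℝ (State p)))
      (Metric.closedBall 0 ρ) v := by
    intro v hv
    have hV := h.hasFDerivAt_correctedState τ hv
    have hflux : ∀ t x : ℝ, 0 ≤ t → ∀ u ∈ Metric.closedBall (0 : State p) R,
        HasFDerivAt (f t x) (fderiv ℝ (f t x) u) u := fun t x ht u hu =>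
      (HasFDerivAt.comp u (h.bounds.flux_diff t x u ht
        (mem_closedBall_zero_iff.1 hu)).hasFDerivAt
        (hasFDerivAt_prodMk_right x u)).differentiableAt.hasFDerivAt
    have h1 := (hflux (t₀ + τ) (x₀ + τ * σ) (h.time_mem hτ).1 _
      (h.correctedState_mem hτ hv)).comp v hV
    have h2 : HasFDerivAt (fun v => relFlux f g t₀ x₀ τ σ v) (relFluxDu f g t₀ x₀ τ σ v) v := by
      rw [relFluxDu, ContinuousLinearMap.sub_comp, ContinuousLinearMap.smul_comp,
        ContinuousLinearMap.id_comp]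
      exact h1.sub (hV.const_smul σ)
    exact (h2.sub ((hflux t₀ x₀ h.base_nonneg v (h.ball_subset hv)).sub
      ((hasFDerivAt_id v).const_smul σ))).hasFDerivWithinAt
  have h3 := (convex_closedBall (0 : State p) ρ).norm_image_sub_le_of_norm_hasFDerivWithin_le hd
    (fun v hv => h.relFluxDu_sub_le hτ hσ hv) hum hup
  have h4 : f t₀ x₀ up = f t₀ x₀ um + σ • (up - um) := by
    rw [← hRH]; abel
  rw [h4] at h3
  refine le_trans (le_of_eq ?_) h3
  congr 1
  rw [smul_sub]
  abel

/-! ### Continuity on the cell -/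

theorem slope_pos (h : Cell f g T X R L ρ t₀ x₀ s r) : 0 < r / s :=
  div_pos h.width_pos h.duration_pos

theorem continuousOn_q (h : Cell f g T X R L ρ t₀ x₀ s r) :
    ContinuousOn (qMap f g t₀ x₀) (Metric.closedBall 0 ρ) := fun v hv =>
  (h.bounds.q_diff t₀ x₀ v h.base_nonneg (mem_closedBall_zero_iff.1
    (h.ball_subset hv))).continuousAt.continuousWithinAt

theorem continuousOn_correctedState (h : Cell f g T X R L ρ t₀ x₀ s r) :
    ContinuousOn (fun z : ℝ × ℝ × State p => correctedState f g t₀ x₀ z.1 z.2.2)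
      (Icc 0 s ×ˢ Icc (-(r / s)) (r / s) ×ˢ Metric.closedBall 0 ρ) := by
  have h1 : ContinuousOn (fun z : ℝ × ℝ × State p => qMap f g t₀ x₀ z.2.2)
      (Icc 0 s ×ˢ Icc (-(r / s)) (r / s) ×ˢ Metric.closedBall 0 ρ) :=
    h.continuousOn_q.comp (by fun_prop) fun z hz => hz.2.2
  unfold correctedState
  fun_prop

theorem continuousOn_comp_state (h : Cell f g T X R L ρ t₀ x₀ s r) {E : Type*}
    [TopologicalSpace E] {H : ℝ × ℝ × State p → E}
    (hH : ContinuousOn H (phaseDomain (Metric.closedBall 0 R))) :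
    ContinuousOn (fun z : ℝ × ℝ × State p =>
        H (t₀ + z.1, x₀ + z.1 * z.2.1, correctedState f g t₀ x₀ z.1 z.2.2))
      (Icc 0 s ×ˢ Icc (-(r / s)) (r / s) ×ˢ Metric.closedBall 0 ρ) := by
  have hV := h.continuousOn_correctedState
  refine hH.comp (by fun_prop) fun z hz => ?_
  exact ⟨(h.time_mem hz.1).1, mem_univ _, h.correctedState_mem hz.1 hz.2.2⟩

theorem continuousOn_comp_base (h : Cell f g T X R L ρ t₀ x₀ s r) {E : Type*}
    [TopologicalSpace E] {φ : ℝ × ℝ → E} (hφ : ContinuousOn φ (Ici (0 : ℝ) ×ˢ univ)) :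
    ContinuousOn (fun z : ℝ × ℝ × State p => φ (t₀ + z.1, x₀ + z.1 * z.2.1))
      (Icc 0 s ×ˢ Icc (-(r / s)) (r / s) ×ˢ Metric.closedBall 0 ρ) :=
  hφ.comp (by fun_prop) fun _ hz => ⟨(h.time_mem hz.1).1, mem_univ _⟩

theorem continuousOn_weightedFluxDeriv (h : Cell f g T X R L ρ t₀ x₀ s r) {θ : ℝ → ℝ → ℝ}
    (hθ : IsTestFunction θ) :
    ContinuousOn (fun z : ℝ × ℝ × State p => weightedFluxDeriv f g θ t₀ x₀ z.1 z.2.1 z.2.2)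
      (Icc 0 s ×ˢ Icc (-(r / s)) (r / s) ×ˢ Metric.closedBall 0 ρ) := by
  have h1 := h.continuousOn_correctedState
  have h2 := h.continuousOn_comp_state h.bounds.flux_cont
  have h3 := h.continuousOn_comp_state h.bounds.fluxDx_cont
  have h4 := h.continuousOn_comp_base hθ.continuousOn
  have h5 := h.continuousOn_comp_base hθ.continuousOn_dx
  exact (h4.smul ((continuousOn_fst.smul h3).sub h1)).add
    ((continuousOn_fst.mul h5).smul
      (h2.sub ((continuousOn_fst.comp continuousOn_snd fun _ hz => hz.2).smul h1)))

theorem integral_weightedFluxDeriv_const (h : Cell f g T X R L ρ t₀ x₀ s r) {θ : ℝ → ℝ → ℝ}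
    (hθ : IsTestFunction θ) {τ : ℝ} (hτ : τ ∈ Icc 0 s) {v : State p}
    (hv : v ∈ Metric.closedBall (0 : State p) ρ) {α β : ℝ} (hα : -(r / s) ≤ α) (hαβ : α ≤ β)
    (hβ : β ≤ r / s) :
    ∫ ξ in α..β, weightedFluxDeriv f g θ t₀ x₀ τ ξ v
      = θ (t₀ + τ) (x₀ + τ * β) • relFlux f g t₀ x₀ τ β v
        - θ (t₀ + τ) (x₀ + τ * α) • relFlux f g t₀ x₀ τ α v := by
  have hd : ∀ ξ, HasDerivAt (fun ξ => θ (t₀ + τ) (x₀ + τ * ξ) • relFlux f g t₀ x₀ τ ξ v)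
      (weightedFluxDeriv f g θ t₀ x₀ τ ξ v) ξ := fun ξ => by
    simpa using h.hasDerivAt_weightedFlux hθ hτ (hasDerivAt_const ξ v) hv
  refine intervalIntegral.integral_eq_sub_of_hasDerivAt (fun ξ _ => hd ξ) ?_
  refine ContinuousOn.intervalIntegrable_of_Icc hαβ ?_
  exact (h.continuousOn_weightedFluxDeriv hθ).comp (f := fun ξ : ℝ => (τ, ξ, v)) (by fun_prop)
    fun ξ hξ => ⟨hτ, ⟨hα.trans hξ.1, hξ.2.trans hβ⟩, hv⟩

theorem intervalIntegrable_weightedFluxDeriv (h : Cell f g T X R L ρ t₀ x₀ s r)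
    {θ : ℝ → ℝ → ℝ} (hθ : IsTestFunction θ) {τ : ℝ} (hτ : τ ∈ Icc 0 s) {W : ℝ → State p}
    (hWm : Measurable W) (hW : ∀ ξ, W ξ ∈ Metric.closedBall (0 : State p) ρ) :
    IntervalIntegrable (fun ξ => weightedFluxDeriv f g θ t₀ x₀ τ ξ (W ξ)) volume
      (-(r / s)) (r / s) := by
  have ha : -(r / s) ≤ r / s := by
    have := div_pos h.width_pos h.duration_pos
    linarith
  rw [intervalIntegrable_iff_integrableOn_Icc_of_le ha]
  exact integrableOn_comp_of_continuousOn
    (isCompact_Icc.prod (isCompact_Icc.prod (isCompact_closedBall _ _)))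
    (h.continuousOn_weightedFluxDeriv hθ) (m := fun ξ => (τ, ξ, W ξ)) (by fun_prop)
    measurableSet_Icc isCompact_Icc.measure_lt_top fun ξ hξ => ⟨hτ, hξ, hW ξ⟩

/-- At a fixed time, the increments of the weighted relative flux across the waves are controlled
by their strengths: this is where the Rankine-Hugoniot relation and the equation of rarefaction
waves at the base point enter. -/
theorem norm_integral_weightedFluxDeriv_sub_le (h : Cell f g T X R L ρ t₀ x₀ s r)
    {θ : ℝ → ℝ → ℝ} (hθ : IsTestFunction θ) {τ : ℝ} (hτ : τ ∈ Icc 0 s)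
    {l : Fin p → State p → ℝ} {uL uR : State p} {W : ℝ → State p} {u : Fin (p + 1) → State p}
    {σm σp : Fin p → ℝ} (hfan : RiemannFan (f t₀ x₀) l uL uR W u σm σp)
    (hW : ∀ ξ, W ξ ∈ Metric.closedBall (0 : State p) ρ)
    (hσ : ∀ i, -(r / s) ≤ σm i ∧ σp i ≤ r / s) :
    ‖(∫ ξ in (-(r / s))..(r / s), weightedFluxDeriv f g θ t₀ x₀ τ ξ (W ξ))
      - (θ (t₀ + τ) (x₀ + τ * (r / s)) • relFlux f g t₀ x₀ τ (r / s) uR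
        - θ (t₀ + τ) (x₀ + τ * -(r / s)) • relFlux f g t₀ x₀ τ (-(r / s)) uL)‖
      ≤ normC1 θ * (2 * L * (1 + L) * (τ * (1 + r / s)))
        * ∑ i, waveStrength W (u i.castSucc) (u i.succ) (σm i) (σp i) := by
  have ha : 0 < r / s := div_pos h.width_pos h.duration_pos
  have hL := h.bounds.nonneg
  have hτ0 := hτ.1
  have hΘ : ∀ x, |θ (t₀ + τ) x| ≤ normC1 θ := fun x => (hθ.le_normC1 (h.time_mem hτ).1 x).1
  have hΘ0 : 0 ≤ normC1 θ := (abs_nonneg _).trans (hΘ 0)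
  have hab : ∀ {ξ}, -(r / s) ≤ ξ → ξ ≤ r / s →
      2 * L * (1 + L) * (τ * (1 + |ξ|)) ≤ 2 * L * (1 + L) * (τ * (1 + r / s)) :=
    fun h1 h2 => by gcongr; exact abs_le.2 ⟨h1, h2⟩
  rw [Finset.mul_sum]
  refine hfan.norm_integral_sub_le
    (h := fun ξ v => θ (t₀ + τ) (x₀ + τ * ξ) • relFlux f g t₀ x₀ τ ξ v) ha.le hσ
    (h.intervalIntegrable_weightedFluxDeriv hθ hτ hfan.measurable hW)
    (fun k α β h1 h2 h3 => h.integral_weightedFluxDeriv_const hθ hτ (hfan.state_mem hW k) h1 h2 h3)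
    fun i => ?_
  rcases hfan.wave i with ⟨hlt, h1, h2, h3, h4⟩ | ⟨heq, -, hjump⟩
  · rw [waveStrength, if_pos hlt]
    set w' : ℝ → State p := fun ξ => derivWithin W (Icc (σm i) (σp i)) ξ with hw'
    have hsub : ∀ ξ ∈ Icc (σm i) (σp i), -(r / s) ≤ ξ ∧ ξ ≤ r / s := fun ξ hξ =>
      ⟨(hσ i).1.trans hξ.1, hξ.2.trans (hσ i).2⟩
    have hw'c : ContinuousOn w' (Icc (σm i) (σp i)) :=
      h3.continuousOn_derivWithin (uniqueDiffOn_Icc hlt) (by simp)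
    have hWc := h3.continuousOn
    have hcurve : ContinuousOn (fun ξ : ℝ => (τ, ξ, W ξ)) (Icc (σm i) (σp i)) := by fun_prop
    have hmaps : MapsTo (fun ξ : ℝ => (τ, ξ, W ξ)) (Icc (σm i) (σp i))
        (Icc 0 s ×ˢ Icc (-(r / s)) (r / s) ×ˢ Metric.closedBall 0 ρ) :=
      fun ξ hξ => ⟨hτ, hsub ξ hξ, hW ξ⟩
    have hk := (h.continuousOn_weightedFluxDeriv hθ).comp hcurve hmaps
    have hDc : ContinuousOn (fun ξ => θ (t₀ + τ) (x₀ + τ * ξ) •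
        relFluxDu f g t₀ x₀ τ ξ (W ξ) (w' ξ)) (Icc (σm i) (σp i)) := by
      have c1 := (h.continuousOn_comp_base hθ.continuousOn).comp hcurve hmaps
      have c2 := (h.continuousOn_comp_state h.bounds.jac_cont).comp hcurve hmaps
      have c3 : ContinuousOn (fun ξ => fderiv ℝ (qMap f g t₀ x₀) (W ξ)) (Icc (σm i) (σp i)) :=
        h.bounds.qDu_cont.comp (f := fun ξ : ℝ => (t₀, x₀, W ξ)) (by fun_prop)
          fun ξ _ => ⟨h.base_nonneg, mem_univ _, h.ball_subset (hW ξ)⟩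
      simp only [Function.comp_def] at c1 c2
      refine c1.smul (ContinuousOn.clm_apply ?_ hw'c)
      unfold relFluxDu
      exact (c2.sub (by fun_prop)).clm_comp (by fun_prop)
    have hkint := ContinuousOn.intervalIntegrable_of_Icc (μ := volume) hlt.le hk
    have hDint := ContinuousOn.intervalIntegrable_of_Icc (μ := volume) hlt.le hDc
    have hjc : ContinuousOn (fun ξ => θ (t₀ + τ) (x₀ + τ * ξ) • relFlux f g t₀ x₀ τ ξ (W ξ))
        (Icc (σm i) (σp i)) := by
      have c1 := (h.continuousOn_comp_base hθ.continuousOn).comp hcurve hmaps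
      have c2 := (h.continuousOn_comp_state h.bounds.flux_cont).comp hcurve hmaps
      have c3 := h.continuousOn_correctedState.comp hcurve hmaps
      exact c1.smul (c2.sub (continuousOn_id.smul c3))
    have hFTC := intervalIntegral.integral_eq_sub_of_hasDerivAt_of_le hlt.le hjc
      (fun ξ hξ => h.hasDerivAt_weightedFlux hθ hτ
        (((h3.differentiableOn (by simp)) ξ (Ioo_subset_Icc_self hξ)).hasDerivWithinAt.hasDerivAt
          (Icc_mem_nhds hξ.1 hξ.2)) (hW ξ)) (hkint.add hDint)
    rw [h1, h2] at hFTC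
    have hsplit := intervalIntegral.integral_add hkint hDint
    simp only [Function.comp_def] at hsplit
    rw [← hFTC, hsplit, sub_add_cancel_left, norm_neg, ← intervalIntegral.integral_const_mul]
    refine intervalIntegral.norm_integral_le_of_norm_le hlt.le (ae_of_all _ fun ξ hξ => ?_)
      (((ContinuousOn.intervalIntegrable_of_Icc hlt.le hw'c).norm).const_mul _)
    have hξ' := Ioc_subset_Icc_self hξ
    have h5 : fderiv ℝ (f t₀ x₀) (W ξ) (w' ξ) = ξ • w' ξ := (h4 ξ hξ').2.apply_eq_smul
    have h6 : relFluxDu f g t₀ x₀ τ ξ (W ξ) (w' ξ) = (relFluxDu f g t₀ x₀ τ ξ (W ξ)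
        - (fderiv ℝ (f t₀ x₀) (W ξ) - ξ • ContinuousLinearMap.id ℝ (State p))) (w' ξ) := by
      simp [h5]
    rw [h6, norm_smul, mul_assoc]
    refine mul_le_mul (hΘ _) ((ContinuousLinearMap.le_opNorm _ _).trans ?_) (norm_nonneg _) hΘ0
    refine mul_le_mul_of_nonneg_right ?_ (norm_nonneg _)
    exact (h.relFluxDu_sub_le hτ (abs_le.2 (hsub ξ hξ')) (hW ξ)).trans
      (hab (hsub ξ hξ').1 (hsub ξ hξ').2)
  · rw [waveStrength, if_neg (by rw [heq]; exact lt_irrefl _), ← heq,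
      intervalIntegral.integral_same, zero_sub, norm_neg, ← smul_sub, norm_smul, mul_assoc]
    have hσi : -(r / s) ≤ σm i ∧ σm i ≤ r / s := ⟨(hσ i).1, heq.le.trans (hσ i).2⟩
    refine mul_le_mul (hΘ _) ?_ (norm_nonneg _) hΘ0
    refine (h.relFlux_jump_le hτ (abs_le.2 hσi) (hfan.state_mem hW _) (hfan.state_mem hW _)
      (hjump.elim (fun h => h.1) fun h => h.1)).trans ?_
    exact mul_le_mul_of_nonneg_right (hab hσi.1 hσi.2) (norm_nonneg _)

end Cell

/-! ### Reduction to the profile with a single jump -/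

/-- The integrand of the weak form at the point `(t₀ + τ, x₀ + y)`, for the corrected state of
`v`. -/
noncomputable def stateIntegrand {p : ℕ} (f g : ℝ → ℝ → State p → State p) (θ : ℝ → ℝ → ℝ)
    (t₀ x₀ τ y : ℝ) (v : State p) : State p :=
  dt θ (t₀ + τ) (x₀ + y) • correctedState f g t₀ x₀ τ v
    + dx θ (t₀ + τ) (x₀ + y) • f (t₀ + τ) (x₀ + y) (correctedState f g t₀ x₀ τ v)
    + θ (t₀ + τ) (x₀ + y) • g (t₀ + τ) (x₀ + y) (correctedState f g t₀ x₀ τ v)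

/-- The `τ`-derivative of `τ θ(t₀ + τ, x₀ + τ ξ) (v + τ q)` at fixed `ξ` and `v`. -/
noncomputable def rayMassDeriv {p : ℕ} (f g : ℝ → ℝ → State p → State p) (θ : ℝ → ℝ → ℝ)
    (t₀ x₀ τ ξ : ℝ) (v : State p) : State p :=
  (θ (t₀ + τ) (x₀ + τ * ξ)
      + τ * (dt θ (t₀ + τ) (x₀ + τ * ξ) + ξ * dx θ (t₀ + τ) (x₀ + τ * ξ)))
      • correctedState f g t₀ x₀ τ v
    + (τ * θ (t₀ + τ) (x₀ + τ * ξ)) • qMap f g t₀ x₀ v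

/-- The balance law in the coordinates `(τ, ξ)`: the weak integrand times the Jacobian `τ` is a
`τ`-derivative plus a `ξ`-derivative (at fixed state) plus a small source. -/
theorem smul_stateIntegrand_eq {p : ℕ} (f g : ℝ → ℝ → State p → State p) (θ : ℝ → ℝ → ℝ)
    (t₀ x₀ τ ξ : ℝ) (v : State p) :
    τ • stateIntegrand f g θ t₀ x₀ τ (τ * ξ) v
      = rayMassDeriv f g θ t₀ x₀ τ ξ v + (weightedFluxDeriv f g θ t₀ x₀ τ ξ v
        - (τ * θ (t₀ + τ) (x₀ + τ * ξ)) • sourceDefect f g t₀ x₀ τ (τ * ξ) v) := by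
  unfold stateIntegrand rayMassDeriv weightedFluxDeriv sourceDefect relFlux
  module

theorem approxSolution_add {p : ℕ} (f g : ℝ → ℝ → State p → State p) (W : ℝ → State p)
    (uL uR : State p) (t₀ x₀ y : ℝ) {τ : ℝ} (hτ : 0 < τ) :
    approxSolution f g W uL uR t₀ x₀ (t₀ + τ) (x₀ + y)
      = correctedState f g t₀ x₀ τ (W (y / τ)) := by
  rw [approxSolution, if_neg (by linarith), correctedState, add_sub_cancel_left,
    add_sub_cancel_left]

theorem approxSolution_base {p : ℕ} (f g : ℝ → ℝ → State p → State p) (W : ℝ → State p)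
    (uL uR : State p) (t₀ x₀ x : ℝ) :
    approxSolution f g W uL uR t₀ x₀ t₀ x = riemannData uL uR x₀ x := by
  rw [approxSolution, if_pos le_rfl]

/-- A measurable profile with values in the ball of radius `ρ`, equal to the extreme states for
`|ξ| > a`. -/
structure IsProfile {p : ℕ} (W : ℝ → State p) (uL uR : State p) (ρ a : ℝ) : Prop where
  measurable : Measurable W
  mem : ∀ ξ, W ξ ∈ Metric.closedBall (0 : State p) ρ
  left : ∀ ξ, ξ < -a → W ξ = uL
  right : ∀ ξ, a < ξ → W ξ = uR

theorem IsProfile.left_mem {p : ℕ} {W : ℝ → State p} {uL uR : State p} {ρ a : ℝ}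
    (h : IsProfile W uL uR ρ a) : uL ∈ Metric.closedBall (0 : State p) ρ := by
  rw [← h.left (-a - 1) (by linarith)]; exact h.mem _

theorem IsProfile.right_mem {p : ℕ} {W : ℝ → State p} {uL uR : State p} {ρ a : ℝ}
    (h : IsProfile W uL uR ρ a) : uR ∈ Metric.closedBall (0 : State p) ρ := by
  rw [← h.right (a + 1) (by linarith)]; exact h.mem _

/-- The profile with a single jump at `ξ = 0`. -/
noncomputable def jumpProfile {p : ℕ} (uL uR : State p) (ξ : ℝ) : State p :=
  if ξ < 0 then uL else uR

theorem isProfile_jumpProfile {p : ℕ} {uL uR : State p} {ρ a : ℝ} (ha : 0 ≤ a)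
    (hL : uL ∈ Metric.closedBall (0 : State p) ρ) (hR : uR ∈ Metric.closedBall (0 : State p) ρ) :
    IsProfile (jumpProfile uL uR) uL uR ρ a where
  measurable := Measurable.ite measurableSet_Iio measurable_const measurable_const
  mem ξ := by unfold jumpProfile; split_ifs <;> assumption
  left ξ hξ := if_pos (by linarith)
  right ξ hξ := if_neg (by linarith)

namespace Cell

variable {p : ℕ} {f g : ℝ → ℝ → State p → State p} {T X R L ρ t₀ x₀ s r : ℝ} {θ : ℝ → ℝ → ℝ}
  {W : ℝ → State p} {uL uR : State p}

theorem continuousOn_correctedState_rect (h : Cell f g T X R L ρ t₀ x₀ s r) :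
    ContinuousOn (fun z : ℝ × ℝ × State p => correctedState f g t₀ x₀ z.1 z.2.2)
      (Icc 0 s ×ˢ Icc (-r) r ×ˢ Metric.closedBall 0 ρ) := by
  have h1 : ContinuousOn (fun z : ℝ × ℝ × State p => qMap f g t₀ x₀ z.2.2)
      (Icc 0 s ×ˢ Icc (-r) r ×ˢ Metric.closedBall 0 ρ) :=
    h.continuousOn_q.comp (by fun_prop) fun z hz => hz.2.2
  unfold correctedState
  fun_prop

theorem continuousOn_comp_state_rect (h : Cell f g T X R L ρ t₀ x₀ s r) {E : Type*}
    [TopologicalSpace E] {H : ℝ × ℝ × State p → E}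
    (hH : ContinuousOn H (phaseDomain (Metric.closedBall 0 R))) :
    ContinuousOn (fun z : ℝ × ℝ × State p =>
        H (t₀ + z.1, x₀ + z.2.1, correctedState f g t₀ x₀ z.1 z.2.2))
      (Icc 0 s ×ˢ Icc (-r) r ×ˢ Metric.closedBall 0 ρ) := by
  have hV := h.continuousOn_correctedState_rect
  exact hH.comp (by fun_prop) fun z hz =>
    ⟨(h.time_mem hz.1).1, mem_univ _, h.correctedState_mem hz.1 hz.2.2⟩

theorem continuousOn_comp_base_rect (h : Cell f g T X R L ρ t₀ x₀ s r) {E : Type*}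
    [TopologicalSpace E] {φ : ℝ × ℝ → E} (hφ : ContinuousOn φ (Ici (0 : ℝ) ×ˢ univ)) :
    ContinuousOn (fun z : ℝ × ℝ × State p => φ (t₀ + z.1, x₀ + z.2.1))
      (Icc 0 s ×ˢ Icc (-r) r ×ˢ Metric.closedBall 0 ρ) :=
  hφ.comp (by fun_prop) fun _ hz => ⟨(h.time_mem hz.1).1, mem_univ _⟩

theorem continuousOn_stateIntegrand (h : Cell f g T X R L ρ t₀ x₀ s r) (hθ : IsTestFunction θ) :
    ContinuousOn (fun z : ℝ × ℝ × State p => stateIntegrand f g θ t₀ x₀ z.1 z.2.1 z.2.2)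
      (Icc 0 s ×ˢ Icc (-r) r ×ˢ Metric.closedBall 0 ρ) := by
  have h1 := h.continuousOn_correctedState_rect
  have h2 := h.continuousOn_comp_state_rect h.bounds.flux_cont
  have h3 := h.continuousOn_comp_state_rect h.bounds.source_cont
  have h4 := h.continuousOn_comp_base_rect hθ.continuousOn
  have h5 := h.continuousOn_comp_base_rect hθ.continuousOn_dx
  have h6 := h.continuousOn_comp_base_rect hθ.continuousOn_dt
  exact ((h6.smul h1).add (h5.smul h2)).add (h4.smul h3)

theorem continuousOn_rayMassDeriv (h : Cell f g T X R L ρ t₀ x₀ s r) (hθ : IsTestFunction θ) :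
    ContinuousOn (fun z : ℝ × ℝ × State p => rayMassDeriv f g θ t₀ x₀ z.1 z.2.1 z.2.2)
      (Icc 0 s ×ˢ Icc (-(r / s)) (r / s) ×ˢ Metric.closedBall 0 ρ) := by
  have h1 := h.continuousOn_correctedState
  have h4 := h.continuousOn_comp_base hθ.continuousOn
  have h5 := h.continuousOn_comp_base hθ.continuousOn_dx
  have h6 := h.continuousOn_comp_base hθ.continuousOn_dt
  have h7 : ContinuousOn (fun z : ℝ × ℝ × State p => qMap f g t₀ x₀ z.2.2)
      (Icc 0 s ×ˢ Icc (-(r / s)) (r / s) ×ˢ Metric.closedBall 0 ρ) :=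
    h.continuousOn_q.comp (by fun_prop) fun z hz => hz.2.2
  have h8 : ContinuousOn (fun z : ℝ × ℝ × State p => z.2.1)
      (Icc 0 s ×ˢ Icc (-(r / s)) (r / s) ×ˢ Metric.closedBall 0 ρ) := by fun_prop
  exact ((h4.add (continuousOn_fst.mul (h6.add (h8.mul h5)))).smul h1).add
    ((continuousOn_fst.mul h4).smul h7)

theorem continuousOn_sourceDefect (h : Cell f g T X R L ρ t₀ x₀ s r) :
    ContinuousOn (fun z : ℝ × ℝ × State p => sourceDefect f g t₀ x₀ z.1 z.2.1 z.2.2)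
      (Icc 0 s ×ˢ Icc (-r) r ×ˢ Metric.closedBall 0 ρ) := by
  have h2 := h.continuousOn_comp_state_rect h.bounds.fluxDx_cont
  have h3 := h.continuousOn_comp_state_rect h.bounds.source_cont
  have h7 : ContinuousOn (fun z : ℝ × ℝ × State p => qMap f g t₀ x₀ z.2.2)
      (Icc 0 s ×ˢ Icc (-r) r ×ˢ Metric.closedBall 0 ρ) :=
    h.continuousOn_q.comp (by fun_prop) fun z hz => hz.2.2
  exact (h7.add h2).sub h3

theorem continuousOn_weightedFluxDeriv_sub (h : Cell f g T X R L ρ t₀ x₀ s r)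
    (hθ : IsTestFunction θ) :
    ContinuousOn (fun z : ℝ × ℝ × State p => weightedFluxDeriv f g θ t₀ x₀ z.1 z.2.1 z.2.2
        - (z.1 * θ (t₀ + z.1) (x₀ + z.1 * z.2.1))
          • sourceDefect f g t₀ x₀ z.1 (z.1 * z.2.1) z.2.2)
      (Icc 0 s ×ˢ Icc (-(r / s)) (r / s) ×ˢ Metric.closedBall 0 ρ) := by
  have hec : ContinuousOn (fun z : ℝ × ℝ × State p =>
      sourceDefect f g t₀ x₀ z.1 (z.1 * z.2.1) z.2.2)
      (Icc 0 s ×ˢ Icc (-(r / s)) (r / s) ×ˢ Metric.closedBall 0 ρ) :=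
    h.continuousOn_sourceDefect.comp
      (f := fun z : ℝ × ℝ × State p => (z.1, z.1 * z.2.1, z.2.2)) (by fun_prop)
      fun z hz => ⟨hz.1, abs_le.1 (h.abs_ray_le hz.1 (abs_le.2 hz.2.1)), hz.2.2⟩
  exact (h.continuousOn_weightedFluxDeriv hθ).sub
    ((continuousOn_fst.mul (h.continuousOn_comp_base hθ.continuousOn)).smul hec)

/-- In the coordinates `(τ, ξ)`, continuous functions of `τ`, `ξ` and the state are integrable
along a profile. -/
theorem integrable_ray (hW : IsProfile W uL uR ρ (r / s))
    {G : ℝ × ℝ × State p → State p} (hG : ContinuousOn G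
      (Icc 0 s ×ˢ Icc (-(r / s)) (r / s) ×ˢ Metric.closedBall 0 ρ)) :
    Integrable (fun z : ℝ × ℝ => G (z.1, z.2, W z.2))
      ((volume.restrict (Ioc 0 s)).prod (volume.restrict (Ioc (-(r / s)) (r / s)))) := by
  have hm := hW.measurable
  rw [Measure.prod_restrict, ← Measure.volume_eq_prod]
  refine IntegrableOn.mono_set ?_ (prod_mono Ioc_subset_Icc_self Ioc_subset_Icc_self)
  exact integrableOn_comp_of_continuousOn
    (isCompact_Icc.prod (isCompact_Icc.prod (isCompact_closedBall _ _))) hG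
    (m := fun z : ℝ × ℝ => (z.1, z.2, W z.2)) (by fun_prop)
    (measurableSet_Icc.prod measurableSet_Icc) (isCompact_Icc.prod isCompact_Icc).measure_lt_top
    fun z hz => ⟨hz.1, hz.2, hW.mem _⟩

theorem intervalIntegrable_ray (h : Cell f g T X R L ρ t₀ x₀ s r)
    (hW : IsProfile W uL uR ρ (r / s)) {G : ℝ × ℝ × State p → State p} (hG : ContinuousOn G
      (Icc 0 s ×ˢ Icc (-(r / s)) (r / s) ×ˢ Metric.closedBall 0 ρ)) {τ : ℝ} (hτ : τ ∈ Icc 0 s) :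
    IntervalIntegrable (fun ξ => G (τ, ξ, W ξ)) volume (-(r / s)) (r / s) := by
  have hm := hW.measurable
  rw [intervalIntegrable_iff_integrableOn_Icc_of_le (by linarith [h.slope_pos])]
  exact integrableOn_comp_of_continuousOn
    (isCompact_Icc.prod (isCompact_Icc.prod (isCompact_closedBall _ _))) hG
    (m := fun ξ : ℝ => (τ, ξ, W ξ)) (by fun_prop) measurableSet_Icc
    isCompact_Icc.measure_lt_top fun ξ hξ => ⟨hτ, hξ, hW.mem _⟩

theorem intervalIntegrable_integral_ray (h : Cell f g T X R L ρ t₀ x₀ s r)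
    (hW : IsProfile W uL uR ρ (r / s)) {G : ℝ × ℝ × State p → State p} (hG : ContinuousOn G
      (Icc 0 s ×ˢ Icc (-(r / s)) (r / s) ×ˢ Metric.closedBall 0 ρ)) :
    IntervalIntegrable (fun τ => ∫ ξ in (-(r / s))..(r / s), G (τ, ξ, W ξ)) volume 0 s := by
  rw [intervalIntegrable_iff_integrableOn_Ioc_of_le h.duration_pos.le]
  simp only [intervalIntegral.integral_of_le (show -(r / s) ≤ r / s by linarith [h.slope_pos])]
  exact (integrable_ray hW hG).integral_prod_left

/-- In the coordinates `(τ, y)`, the same for functions along `W (y / τ)`. -/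
theorem integrable_rect (hW : IsProfile W uL uR ρ (r / s))
    {G : ℝ × ℝ × State p → State p} (hG : ContinuousOn G
      (Icc 0 s ×ˢ Icc (-r) r ×ˢ Metric.closedBall 0 ρ)) :
    Integrable (fun z : ℝ × ℝ => G (z.1, z.2, W (z.2 / z.1)))
      ((volume.restrict (Ioc 0 s)).prod (volume.restrict (Ioc (-r) r))) := by
  have hm := hW.measurable
  rw [Measure.prod_restrict, ← Measure.volume_eq_prod]
  refine IntegrableOn.mono_set ?_ (prod_mono Ioc_subset_Icc_self Ioc_subset_Icc_self)
  exact integrableOn_comp_of_continuousOn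
    (isCompact_Icc.prod (isCompact_Icc.prod (isCompact_closedBall _ _))) hG
    (m := fun z : ℝ × ℝ => (z.1, z.2, W (z.2 / z.1))) (by fun_prop)
    (measurableSet_Icc.prod measurableSet_Icc) (isCompact_Icc.prod isCompact_Icc).measure_lt_top
    fun z hz => ⟨hz.1, hz.2, hW.mem _⟩

theorem intervalIntegrable_rect (h : Cell f g T X R L ρ t₀ x₀ s r)
    (hW : IsProfile W uL uR ρ (r / s)) {G : ℝ × ℝ × State p → State p} (hG : ContinuousOn G
      (Icc 0 s ×ˢ Icc (-r) r ×ˢ Metric.closedBall 0 ρ)) {τ : ℝ} (hτ : τ ∈ Icc 0 s) :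
    IntervalIntegrable (fun y => G (τ, y, W (y / τ))) volume (-r) r := by
  have hm := hW.measurable
  rw [intervalIntegrable_iff_integrableOn_Icc_of_le (by linarith [h.width_pos])]
  exact integrableOn_comp_of_continuousOn
    (isCompact_Icc.prod (isCompact_Icc.prod (isCompact_closedBall _ _))) hG
    (m := fun y : ℝ => (τ, y, W (y / τ))) (by fun_prop) measurableSet_Icc
    isCompact_Icc.measure_lt_top fun ξ hξ => ⟨hτ, hξ, hW.mem _⟩

theorem intervalIntegrable_integral_rect (h : Cell f g T X R L ρ t₀ x₀ s r)
    (hW : IsProfile W uL uR ρ (r / s)) {G : ℝ × ℝ × State p → State p} (hG : ContinuousOn G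
      (Icc 0 s ×ˢ Icc (-r) r ×ˢ Metric.closedBall 0 ρ)) :
    IntervalIntegrable (fun τ => ∫ y in (-r)..r, G (τ, y, W (y / τ))) volume 0 s := by
  rw [intervalIntegrable_iff_integrableOn_Ioc_of_le h.duration_pos.le]
  simp only [intervalIntegral.integral_of_le (show -r ≤ r by linarith [h.width_pos])]
  exact (integrable_rect hW hG).integral_prod_left

theorem weakResidual_eq (h : Cell f g T X R L ρ t₀ x₀ s r) :
    weakResidual f g (approxSolution f g W uL uR t₀ x₀) θ t₀ x₀ s r
      = ∫ τ in 0..s, ∫ y in (-r)..r, stateIntegrand f g θ t₀ x₀ τ y (W (y / τ)) := by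
  have h1 := intervalIntegral.integral_comp_add_left (a := 0) (b := s)
    (fun t => ∫ x in (x₀ - r)..(x₀ + r),
      weakIntegrand f g (approxSolution f g W uL uR t₀ x₀) θ t x) t₀
  rw [add_zero] at h1
  rw [weakResidual, ← h1]
  refine intervalIntegral.integral_congr_ae (ae_of_all _ fun τ hτ => ?_)
  rw [uIoc_of_le h.duration_pos.le] at hτ
  rw [sub_eq_add_neg, ← intervalIntegral.integral_comp_add_left]
  refine intervalIntegral.integral_congr fun y _ => ?_
  simp only [weakIntegrand, stateIntegrand, approxSolution_add f g W uL uR t₀ x₀ y hτ.1]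

/-- Outside the rays `|y| = τ r / s` a profile is constant, and the substitution `y = τ ξ` applies
between them. -/
theorem integral_stateIntegrand_eq (h : Cell f g T X R L ρ t₀ x₀ s r) (hθ : IsTestFunction θ)
    (hW : IsProfile W uL uR ρ (r / s)) {τ : ℝ} (hτ : τ ∈ Ioc 0 s) :
    ∫ y in (-r)..r, stateIntegrand f g θ t₀ x₀ τ y (W (y / τ))
      = (∫ y in (-r)..(τ * -(r / s)), stateIntegrand f g θ t₀ x₀ τ y uL)
        + (∫ ξ in (-(r / s))..(r / s), τ • stateIntegrand f g θ t₀ x₀ τ (τ * ξ) (W ξ))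
        + ∫ y in (τ * (r / s))..r, stateIntegrand f g θ t₀ x₀ τ y uR := by
  have hr := h.width_pos
  have ha := h.slope_pos
  have har : τ * (r / s) ≤ r := by
    have := h.abs_ray_le (Ioc_subset_Icc_self hτ) (abs_of_pos ha).le
    exact (le_abs_self _).trans this
  have ha0 : 0 < τ * (r / s) := mul_pos hτ.1 ha
  have hI := h.intervalIntegrable_rect hW (h.continuousOn_stateIntegrand hθ)
    (Ioc_subset_Icc_self hτ)
  have hsub : ∀ {α β}, -r ≤ α → α ≤ β → β ≤ r → IntervalIntegrable
      (fun y => stateIntegrand f g θ t₀ x₀ τ y (W (y / τ))) volume α β := fun h1 h2 h3 =>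
    hI.mono_set (by
      rw [uIcc_of_le h2, uIcc_of_le (by linarith)]; exact Icc_subset_Icc h1 h3)
  have e1 : ∫ y in (-r)..(τ * -(r / s)), stateIntegrand f g θ t₀ x₀ τ y (W (y / τ))
      = ∫ y in (-r)..(τ * -(r / s)), stateIntegrand f g θ t₀ x₀ τ y uL := by
    refine intervalIntegral.integral_congr_ae ?_
    rw [uIoc_of_le (by linarith)]
    filter_upwards [Measure.ae_ne volume (τ * -(r / s))] with y hy hy'
    rw [hW.left]
    rw [div_lt_iff₀ hτ.1, mul_comm]
    exact hy'.2.lt_of_ne hy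
  have e2 : ∫ y in (τ * (r / s))..r, stateIntegrand f g θ t₀ x₀ τ y (W (y / τ))
      = ∫ y in (τ * (r / s))..r, stateIntegrand f g θ t₀ x₀ τ y uR := by
    refine intervalIntegral.integral_congr_ae (ae_of_all _ fun y hy => ?_)
    rw [uIoc_of_le (by linarith)] at hy
    rw [hW.right]
    rw [lt_div_iff₀ hτ.1, mul_comm]
    exact hy.1
  have e3 : ∫ y in (τ * -(r / s))..(τ * (r / s)), stateIntegrand f g θ t₀ x₀ τ y (W (y / τ))
      = ∫ ξ in (-(r / s))..(r / s), τ • stateIntegrand f g θ t₀ x₀ τ (τ * ξ) (W ξ) := by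
    rw [← intervalIntegral.smul_integral_comp_mul_left, ← intervalIntegral.integral_smul]
    refine intervalIntegral.integral_congr fun ξ _ => ?_
    simp only [mul_div_cancel_left₀ ξ hτ.1.ne']
  rw [← e1, ← e2, ← e3, intervalIntegral.integral_add_adjacent_intervals,
    intervalIntegral.integral_add_adjacent_intervals]
  · exact hsub le_rfl (by linarith) har
  · exact hsub (by linarith) har le_rfl
  · exact hsub le_rfl (by linarith) (by linarith)
  · exact hsub (by linarith) (by linarith) har

theorem integral_rayMassDeriv (h : Cell f g T X R L ρ t₀ x₀ s r) (hθ : IsTestFunction θ) {ξ : ℝ}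
    (hξ : ξ ∈ Icc (-(r / s)) (r / s)) {v : State p} (hv : v ∈ Metric.closedBall (0 : State p) ρ) :
    ∫ τ in 0..s, rayMassDeriv f g θ t₀ x₀ τ ξ v
      = s • (θ (t₀ + s) (x₀ + s * ξ) • correctedState f g t₀ x₀ s v) := by
  have hs := h.duration_pos
  have hmaps : MapsTo (fun τ : ℝ => (τ, ξ, v)) (Icc 0 s)
      (Icc 0 s ×ˢ Icc (-(r / s)) (r / s) ×ˢ Metric.closedBall 0 ρ) := fun τ hτ => ⟨hτ, hξ, hv⟩
  have hcurve : ContinuousOn (fun τ : ℝ => (τ, ξ, v)) (Icc 0 s) := by fun_prop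
  have c1 : ContinuousOn (fun τ => θ (t₀ + τ) (x₀ + τ * ξ)) (Icc 0 s) :=
    (h.continuousOn_comp_base hθ.continuousOn).comp hcurve hmaps
  have c2 : ContinuousOn (fun τ => correctedState f g t₀ x₀ τ v) (Icc 0 s) :=
    h.continuousOn_correctedState.comp hcurve hmaps
  have c3 := (h.continuousOn_rayMassDeriv hθ).comp hcurve hmaps
  simp only [Function.comp_def] at c3
  have c4 : ContinuousOn (fun τ => (τ * θ (t₀ + τ) (x₀ + τ * ξ)) • correctedState f g t₀ x₀ τ v)
      (Icc 0 s) := (continuousOn_id.mul c1).smul c2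
  have hd : ∀ τ ∈ Ioo 0 s, HasDerivAt
      (fun τ => (τ * θ (t₀ + τ) (x₀ + τ * ξ)) • correctedState f g t₀ x₀ τ v)
      (rayMassDeriv f g θ t₀ x₀ τ ξ v) τ := by
    intro τ hτ
    have hpos : 0 < t₀ + τ := add_pos_of_nonneg_of_pos h.base_nonneg hτ.1
    have d1 : HasDerivAt (fun τ => τ * θ (t₀ + τ) (x₀ + τ * ξ)) (1 * θ (t₀ + τ) (x₀ + τ * ξ)
        + τ * (dt θ (t₀ + τ) (x₀ + τ * ξ) + ξ * dx θ (t₀ + τ) (x₀ + τ * ξ))) τ :=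
      (hasDerivAt_id τ).mul (hθ.hasDerivAt_ray hpos x₀ ξ)
    have d2 : HasDerivAt (fun τ => correctedState f g t₀ x₀ τ v) (qMap f g t₀ x₀ v) τ :=
      (((hasDerivAt_id τ).smul_const (qMap f g t₀ x₀ v)).const_add v).congr_deriv (one_smul _ _)
    refine (d1.smul d2).congr_deriv ?_
    rw [rayMassDeriv, one_mul, add_comm]
  rw [intervalIntegral.integral_eq_sub_of_hasDerivAt_of_le hs.le c4 hd
    (ContinuousOn.intervalIntegrable_of_Icc hs.le c3), zero_mul, zero_smul, sub_zero, mul_smul]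

/-- The mass terms integrate to the boundary term at the final time. -/
theorem integral_integral_rayMassDeriv (h : Cell f g T X R L ρ t₀ x₀ s r)
    (hθ : IsTestFunction θ) (hW : IsProfile W uL uR ρ (r / s)) :
    ∫ τ in 0..s, ∫ ξ in (-(r / s))..(r / s), rayMassDeriv f g θ t₀ x₀ τ ξ (W ξ)
      = ∫ x in (x₀ - r)..(x₀ + r),
        θ (t₀ + s) x • approxSolution f g W uL uR t₀ x₀ (t₀ + s) x := by
  have hs := h.duration_pos
  have ha := h.slope_pos
  have hI := integrable_ray hW (h.continuousOn_rayMassDeriv hθ)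
  have hswap : ∫ τ in 0..s, ∫ ξ in (-(r / s))..(r / s), rayMassDeriv f g θ t₀ x₀ τ ξ (W ξ)
      = ∫ ξ in (-(r / s))..(r / s), ∫ τ in 0..s, rayMassDeriv f g θ t₀ x₀ τ ξ (W ξ) := by
    simp only [intervalIntegral.integral_of_le hs.le,
      intervalIntegral.integral_of_le (show -(r / s) ≤ r / s by linarith)]
    exact integral_integral_swap hI
  have hcov := intervalIntegral.smul_integral_comp_add_mul (a := -(r / s)) (b := r / s)
    (fun x => θ (t₀ + s) x • approxSolution f g W uL uR t₀ x₀ (t₀ + s) x) s x₀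
  rw [mul_neg, mul_div_cancel₀ _ hs.ne', ← sub_eq_add_neg] at hcov
  rw [hswap, ← hcov, ← intervalIntegral.integral_smul]
  refine intervalIntegral.integral_congr fun ξ hξ => ?_
  rw [uIcc_of_le (by linarith)] at hξ
  rw [h.integral_rayMassDeriv hθ hξ (hW.mem ξ), approxSolution_add f g W uL uR t₀ x₀ _ hs,
    mul_div_cancel_left₀ _ hs.ne']

/-- Two profiles give the same initial data and, almost everywhere in time, the same lateral fluxes,
since `|ξ| > r / s` on the lateral sides before the final time. -/
theorem boundaryTerms_sub (h : Cell f g T X R L ρ t₀ x₀ s r) {W' : ℝ → State p}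
    (hW : IsProfile W uL uR ρ (r / s)) (hW' : IsProfile W' uL uR ρ (r / s)) :
    boundaryTerms f (approxSolution f g W uL uR t₀ x₀) θ t₀ x₀ s r
        - boundaryTerms f (approxSolution f g W' uL uR t₀ x₀) θ t₀ x₀ s r
      = (∫ x in (x₀ - r)..(x₀ + r),
          θ (t₀ + s) x • approxSolution f g W uL uR t₀ x₀ (t₀ + s) x)
        - ∫ x in (x₀ - r)..(x₀ + r),
          θ (t₀ + s) x • approxSolution f g W' uL uR t₀ x₀ (t₀ + s) x := by
  have hs := h.duration_pos
  have hr := h.width_pos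
  have hlat : ∀ V V' : ℝ → ℝ → State p, ∀ x, (∀ τ ∈ Ioo 0 s, V (t₀ + τ) x = V' (t₀ + τ) x) →
      (∫ t in t₀..(t₀ + s), θ t x • f t x (V t x))
        = ∫ t in t₀..(t₀ + s), θ t x • f t x (V' t x) := by
    intro V V' x hV
    refine intervalIntegral.integral_congr_ae ?_
    rw [uIoc_of_le (by linarith)]
    filter_upwards [Measure.ae_ne volume (t₀ + s)] with t ht ht'
    have := hV (t - t₀) ⟨by linarith [ht'.1], by have := ht'.2.lt_of_ne ht; linarith⟩
    rw [add_sub_cancel] at this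
    rw [this]
  have h1 := hlat (approxSolution f g W uL uR t₀ x₀) (approxSolution f g W' uL uR t₀ x₀) (x₀ + r)
    fun τ hτ => by
      have hlt : r / s < r / τ := div_lt_div_of_pos_left hr hτ.1 hτ.2
      rw [approxSolution_add _ _ _ _ _ _ _ _ hτ.1, approxSolution_add _ _ _ _ _ _ _ _ hτ.1,
        hW.right _ hlt, hW'.right _ hlt]
  have h2 := hlat (approxSolution f g W uL uR t₀ x₀) (approxSolution f g W' uL uR t₀ x₀) (x₀ - r)
    fun τ hτ => by
      have hlt : -r / τ < -(r / s) := by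
        rw [neg_div]; exact neg_lt_neg (div_lt_div_of_pos_left hr hτ.1 hτ.2)
      rw [sub_eq_add_neg, approxSolution_add _ _ _ _ _ _ _ _ hτ.1,
        approxSolution_add _ _ _ _ _ _ _ _ hτ.1, hW.left _ hlt, hW'.left _ hlt]
  unfold boundaryTerms
  rw [h1, h2]
  simp only [approxSolution_base]
  abel

/-- Two profiles with the same extreme states: the mass terms cancel against the boundary terms. -/
theorem defect_sub_defect (h : Cell f g T X R L ρ t₀ x₀ s r) (hθ : IsTestFunction θ)
    {W' : ℝ → State p} (hW : IsProfile W uL uR ρ (r / s)) (hW' : IsProfile W' uL uR ρ (r / s)) :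
    (weakResidual f g (approxSolution f g W uL uR t₀ x₀) θ t₀ x₀ s r
        - boundaryTerms f (approxSolution f g W uL uR t₀ x₀) θ t₀ x₀ s r)
      - (weakResidual f g (approxSolution f g W' uL uR t₀ x₀) θ t₀ x₀ s r
        - boundaryTerms f (approxSolution f g W' uL uR t₀ x₀) θ t₀ x₀ s r)
      = ∫ τ in 0..s, ((∫ ξ in (-(r / s))..(r / s), (weightedFluxDeriv f g θ t₀ x₀ τ ξ (W ξ)
          - (τ * θ (t₀ + τ) (x₀ + τ * ξ)) • sourceDefect f g t₀ x₀ τ (τ * ξ) (W ξ)))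
        - ∫ ξ in (-(r / s))..(r / s), (weightedFluxDeriv f g θ t₀ x₀ τ ξ (W' ξ)
          - (τ * θ (t₀ + τ) (x₀ + τ * ξ)) • sourceDefect f g t₀ x₀ τ (τ * ξ) (W' ξ))) := by
  have hs := h.duration_pos
  have ha := h.slope_pos
  have hSc := h.continuousOn_stateIntegrand hθ
  have hPc := h.continuousOn_rayMassDeriv hθ
  have hMc := h.continuousOn_weightedFluxDeriv_sub hθ
  have hsplit : ∀ {W : ℝ → State p}, IsProfile W uL uR ρ (r / s) → ∀ τ ∈ Ioc 0 s,
      ∫ ξ in (-(r / s))..(r / s), τ • stateIntegrand f g θ t₀ x₀ τ (τ * ξ) (W ξ)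
        = (∫ ξ in (-(r / s))..(r / s), rayMassDeriv f g θ t₀ x₀ τ ξ (W ξ))
          + ∫ ξ in (-(r / s))..(r / s), (weightedFluxDeriv f g θ t₀ x₀ τ ξ (W ξ)
          - (τ * θ (t₀ + τ) (x₀ + τ * ξ)) • sourceDefect f g t₀ x₀ τ (τ * ξ) (W ξ)) := by
    intro W hW τ hτ
    simp only [smul_stateIntegrand_eq]
    exact intervalIntegral.integral_add
      (h.intervalIntegrable_ray hW hPc (Ioc_subset_Icc_self hτ))
      (h.intervalIntegrable_ray hW hMc (Ioc_subset_Icc_self hτ))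
  have hres : weakResidual f g (approxSolution f g W uL uR t₀ x₀) θ t₀ x₀ s r
        - weakResidual f g (approxSolution f g W' uL uR t₀ x₀) θ t₀ x₀ s r
      = ∫ τ in 0..s, (((∫ ξ in (-(r / s))..(r / s), rayMassDeriv f g θ t₀ x₀ τ ξ (W ξ))
          - ∫ ξ in (-(r / s))..(r / s), rayMassDeriv f g θ t₀ x₀ τ ξ (W' ξ))
        + ((∫ ξ in (-(r / s))..(r / s), (weightedFluxDeriv f g θ t₀ x₀ τ ξ (W ξ)
          - (τ * θ (t₀ + τ) (x₀ + τ * ξ)) • sourceDefect f g t₀ x₀ τ (τ * ξ) (W ξ)))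
        - ∫ ξ in (-(r / s))..(r / s), (weightedFluxDeriv f g θ t₀ x₀ τ ξ (W' ξ)
          - (τ * θ (t₀ + τ) (x₀ + τ * ξ)) • sourceDefect f g t₀ x₀ τ (τ * ξ) (W' ξ)))) := by
    rw [h.weakResidual_eq, h.weakResidual_eq, ← intervalIntegral.integral_sub
      (h.intervalIntegrable_integral_rect hW hSc) (h.intervalIntegrable_integral_rect hW' hSc)]
    refine intervalIntegral.integral_congr_ae (ae_of_all _ fun τ hτ => ?_)
    rw [uIoc_of_le hs.le] at hτ
    rw [h.integral_stateIntegrand_eq hθ hW hτ, h.integral_stateIntegrand_eq hθ hW' hτ,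
      hsplit hW τ hτ, hsplit hW' τ hτ]
    abel
  rw [sub_sub_sub_comm, hres, h.boundaryTerms_sub hW hW',
    ← h.integral_integral_rayMassDeriv hθ hW, ← h.integral_integral_rayMassDeriv hθ hW',
    intervalIntegral.integral_add
      ((h.intervalIntegrable_integral_ray hW hPc).sub (h.intervalIntegrable_integral_ray hW' hPc))
      ((h.intervalIntegrable_integral_ray hW hMc).sub (h.intervalIntegrable_integral_ray hW' hMc)),
    intervalIntegral.integral_sub (h.intervalIntegrable_integral_ray hW hPc)
      (h.intervalIntegrable_integral_ray hW' hPc), add_sub_cancel_left]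

end Cell

/-! ### The estimate on a short cell -/

theorem integral_ite_neg {E : Type*} [NormedAddCommGroup E] [NormedSpace ℝ E] {r : ℝ} (hr : 0 ≤ r)
    {F G : ℝ → E} (hF : IntervalIntegrable F volume (-r) 0) (hG : IntervalIntegrable G volume 0 r) :
    ∫ y in (-r)..r, (if y < 0 then F y else G y)
      = (∫ y in (-r)..0, F y) + ∫ y in 0..r, G y := by
  have h1 : ∀ᵐ y, y ∈ uIoc (-r) 0 → F y = if y < 0 then F y else G y := by
    rw [uIoc_of_le (by linarith)]
    filter_upwards [Measure.ae_ne volume 0] with y hy hy'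
    rw [if_pos (hy'.2.lt_of_ne hy)]
  have h2 : ∀ᵐ y, y ∈ uIoc 0 r → G y = if y < 0 then F y else G y := by
    rw [uIoc_of_le hr]
    refine ae_of_all _ fun y hy => ?_
    rw [if_neg (not_lt.2 hy.1.le)]
  rw [intervalIntegral.integral_congr_ae h1, intervalIntegral.integral_congr_ae h2,
    intervalIntegral.integral_add_adjacent_intervals]
  · exact hF.congr_ae ((ae_restrict_iff' measurableSet_uIoc).2 h1)
  · exact hG.congr_ae ((ae_restrict_iff' measurableSet_uIoc).2 h2)

namespace Cell

variable {p : ℕ} {f g : ℝ → ℝ → State p → State p} {T X R L ρ t₀ x₀ s r : ℝ} {θ : ℝ → ℝ → ℝ}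
  {W : ℝ → State p} {uL uR : State p}

theorem normC1_nonneg (h : Cell f g T X R L ρ t₀ x₀ s r) (hθ : IsTestFunction θ) :
    0 ≤ normC1 θ :=
  (abs_nonneg _).trans (hθ.le_normC1 h.base_nonneg 0).1

theorem norm_integral_sourceDefect_le (h : Cell f g T X R L ρ t₀ x₀ s r) (hθ : IsTestFunction θ)
    (hW : IsProfile W uL uR ρ (r / s)) {τ : ℝ} (hτ : τ ∈ Icc 0 s) :
    ‖∫ ξ in (-(r / s))..(r / s),
        (τ * θ (t₀ + τ) (x₀ + τ * ξ)) • sourceDefect f g t₀ x₀ τ (τ * ξ) (W ξ)‖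
      ≤ τ * normC1 θ * (2 * L * (1 + L) * (τ * (1 + r / s))) * (2 * (r / s)) := by
  have ha := h.slope_pos
  have hL := h.bounds.nonneg
  have hτ0 := hτ.1
  have hΘ0 := h.normC1_nonneg hθ
  have := intervalIntegral.norm_integral_le_of_norm_le_const (a := -(r / s)) (b := r / s)
    (f := fun ξ => (τ * θ (t₀ + τ) (x₀ + τ * ξ)) • sourceDefect f g t₀ x₀ τ (τ * ξ) (W ξ))
    (C := τ * normC1 θ * (2 * L * (1 + L) * (τ * (1 + r / s)))) (fun ξ hξ => by
      rw [uIoc_of_le (by linarith)] at hξ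
      have hξ' : |ξ| ≤ r / s := abs_le.2 ⟨hξ.1.le, hξ.2⟩
      rw [norm_smul, Real.norm_eq_abs, abs_mul, abs_of_nonneg hτ0]
      refine mul_le_mul ?_ ?_ (norm_nonneg _) (by positivity)
      · exact mul_le_mul_of_nonneg_left (hθ.le_normC1 (h.time_mem hτ).1 _).1 hτ0
      · refine (h.sourceDefect_le hτ (h.abs_ray_le hτ hξ') (hW.mem ξ)).trans ?_
        rw [abs_mul, abs_of_nonneg hτ0]
        have : τ + τ * |ξ| ≤ τ * (1 + r / s) := by
          rw [mul_add, mul_one]; gcongr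
        gcongr)
  rwa [show r / s - -(r / s) = 2 * (r / s) by ring, abs_of_pos (by positivity)] at this

theorem integral_weightedFluxDeriv_jumpProfile (h : Cell f g T X R L ρ t₀ x₀ s r)
    (hθ : IsTestFunction θ) (hL : uL ∈ Metric.closedBall (0 : State p) ρ)
    (hR : uR ∈ Metric.closedBall (0 : State p) ρ) {τ : ℝ} (hτ : τ ∈ Icc 0 s) :
    ∫ ξ in (-(r / s))..(r / s), weightedFluxDeriv f g θ t₀ x₀ τ ξ (jumpProfile uL uR ξ)
      = (θ (t₀ + τ) (x₀ + τ * (r / s)) • relFlux f g t₀ x₀ τ (r / s) uR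
          - θ (t₀ + τ) (x₀ + τ * -(r / s)) • relFlux f g t₀ x₀ τ (-(r / s)) uL)
        - (θ (t₀ + τ) x₀ • f (t₀ + τ) x₀ (correctedState f g t₀ x₀ τ uR)
          - θ (t₀ + τ) x₀ • f (t₀ + τ) x₀ (correctedState f g t₀ x₀ τ uL)) := by
  have ha := h.slope_pos
  have hP := isProfile_jumpProfile ha.le hL hR
  have hI := h.intervalIntegrable_weightedFluxDeriv hθ hτ hP.measurable hP.mem
  have e1 : ∫ ξ in (-(r / s))..0, weightedFluxDeriv f g θ t₀ x₀ τ ξ (jumpProfile uL uR ξ)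
      = ∫ ξ in (-(r / s))..0, weightedFluxDeriv f g θ t₀ x₀ τ ξ uL := by
    refine intervalIntegral.integral_congr_ae ?_
    rw [uIoc_of_le (by linarith)]
    filter_upwards [Measure.ae_ne volume 0] with ξ hξ hξ'
    rw [jumpProfile, if_pos (hξ'.2.lt_of_ne hξ)]
  have e2 : ∫ ξ in 0..(r / s), weightedFluxDeriv f g θ t₀ x₀ τ ξ (jumpProfile uL uR ξ)
      = ∫ ξ in 0..(r / s), weightedFluxDeriv f g θ t₀ x₀ τ ξ uR := by
    refine intervalIntegral.integral_congr_ae (ae_of_all _ fun ξ hξ => ?_)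
    rw [uIoc_of_le ha.le] at hξ
    rw [jumpProfile, if_neg (not_lt.2 hξ.1.le)]
  rw [← intervalIntegral.integral_add_adjacent_intervals (b := 0)
    (hI.mono_set (by
      rw [uIcc_of_le (by linarith), uIcc_of_le (by linarith)]
      exact Icc_subset_Icc le_rfl ha.le))
    (hI.mono_set (by
      rw [uIcc_of_le ha.le, uIcc_of_le (by linarith)]
      exact Icc_subset_Icc (by linarith) le_rfl)), e1, e2,
    h.integral_weightedFluxDeriv_const hθ hτ hL le_rfl (by linarith) ha.le,
    h.integral_weightedFluxDeriv_const hθ hτ hR (by linarith) ha.le le_rfl]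
  simp only [relFlux, mul_zero, add_zero, zero_smul, sub_zero]
  abel

/-- The weak form for a corrected constant state on half of the cell. -/
theorem integral_integral_stateIntegrand (h : Cell f g T X R L ρ t₀ x₀ s r)
    (hθ : IsTestFunction θ) {v : State p} (hv : v ∈ Metric.closedBall (0 : State p) ρ) {α β : ℝ}
    (hα : -r ≤ α) (hαβ : α ≤ β) (hβ : β ≤ r) :
    ‖(∫ τ in 0..s, ∫ y in α..β, stateIntegrand f g θ t₀ x₀ τ y v)
      - ((∫ y in α..β, θ (t₀ + s) (x₀ + y) • correctedState f g t₀ x₀ s v)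
        - (∫ y in α..β, θ t₀ (x₀ + y) • v)
        + (∫ τ in 0..s, θ (t₀ + τ) (x₀ + β) •
            f (t₀ + τ) (x₀ + β) (correctedState f g t₀ x₀ τ v))
        - ∫ τ in 0..s, θ (t₀ + τ) (x₀ + α) •
            f (t₀ + τ) (x₀ + α) (correctedState f g t₀ x₀ τ v))‖
      ≤ normC1 θ * (2 * L * (1 + L) * (s + r)) * (β - α) * s := by
  have hs := h.duration_pos
  have hLn := h.bounds.nonneg
  have hΘ0 := h.normC1_nonneg hθ
  set V : ℝ → State p := fun τ => correctedState f g t₀ x₀ τ v with hV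
  set ρt : ℝ → ℝ → State p := fun τ y =>
    dt θ (t₀ + τ) (x₀ + y) • V τ + θ (t₀ + τ) (x₀ + y) • qMap f g t₀ x₀ v with hρt
  set φx : ℝ → ℝ → State p := fun τ y =>
    dx θ (t₀ + τ) (x₀ + y) • f (t₀ + τ) (x₀ + y) (V τ)
      + θ (t₀ + τ) (x₀ + y) • deriv (fun y => f (t₀ + τ) y (V τ)) (x₀ + y) with hφx
  set e : ℝ → ℝ → State p := fun τ y =>
    θ (t₀ + τ) (x₀ + y) • sourceDefect f g t₀ x₀ τ y v with he
  have hdecomp : ∀ τ y, stateIntegrand f g θ t₀ x₀ τ y v = ρt τ y + φx τ y - e τ y := by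
    intro τ y
    simp only [hρt, hφx, he, hV, stateIntegrand, sourceDefect]
    module
  have hmaps : MapsTo (fun z : ℝ × ℝ => (z.1, z.2, v)) (Icc 0 s ×ˢ Icc α β)
      (Icc 0 s ×ˢ Icc (-r) r ×ˢ Metric.closedBall 0 ρ) := fun z hz =>
    ⟨hz.1, ⟨hα.trans hz.2.1, hz.2.2.trans hβ⟩, hv⟩
  have hcurve : ContinuousOn (fun z : ℝ × ℝ => (z.1, z.2, v)) (Icc 0 s ×ˢ Icc α β) := by fun_prop
  have c1 := h.continuousOn_correctedState_rect.comp hcurve hmaps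
  have c2 := (h.continuousOn_comp_state_rect h.bounds.flux_cont).comp hcurve hmaps
  have c3 := (h.continuousOn_comp_state_rect h.bounds.fluxDx_cont).comp hcurve hmaps
  have c4 := (h.continuousOn_comp_base_rect hθ.continuousOn).comp hcurve hmaps
  have c5 := (h.continuousOn_comp_base_rect hθ.continuousOn_dt).comp hcurve hmaps
  have c6 := (h.continuousOn_comp_base_rect hθ.continuousOn_dx).comp hcurve hmaps
  have c7 := h.continuousOn_sourceDefect.comp hcurve hmaps
  simp only [Function.comp_def] at c1 c2 c3 c4 c5 c6 c7
  have hρc : ContinuousOn (fun z : ℝ × ℝ => ρt z.1 z.2) (Icc 0 s ×ˢ Icc α β) :=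
    (c5.smul c1).add (c4.smul continuousOn_const)
  have hφc : ContinuousOn (fun z : ℝ × ℝ => φx z.1 z.2) (Icc 0 s ×ˢ Icc α β) :=
    (c6.smul c2).add (c4.smul c3)
  have hec : ContinuousOn (fun z : ℝ × ℝ => e z.1 z.2) (Icc 0 s ×ˢ Icc α β) := c4.smul c7
  have hPc : ContinuousOn (fun z : ℝ × ℝ => θ (t₀ + z.1) (x₀ + z.2) • V z.1)
      (Icc 0 s ×ˢ Icc α β) := c4.smul c1
  have hQc : ContinuousOn (fun z : ℝ × ℝ => θ (t₀ + z.1) (x₀ + z.2) •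
      f (t₀ + z.1) (x₀ + z.2) (V z.1)) (Icc 0 s ×ˢ Icc α β) := c4.smul c2
  have hI2 : ∀ {G : ℝ → ℝ → State p}, ContinuousOn (fun z : ℝ × ℝ => G z.1 z.2)
      (Icc 0 s ×ˢ Icc α β) → Integrable (fun z : ℝ × ℝ => G z.1 z.2)
      ((volume.restrict (Ioc 0 s)).prod (volume.restrict (Ioc α β))) := by
    intro G hG
    rw [Measure.prod_restrict, ← Measure.volume_eq_prod]
    exact (hG.integrableOn_compact (isCompact_Icc.prod isCompact_Icc)).mono_set
      (prod_mono Ioc_subset_Icc_self Ioc_subset_Icc_self)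
  have hIy : ∀ {G : ℝ → ℝ → State p}, ContinuousOn (fun z : ℝ × ℝ => G z.1 z.2)
      (Icc 0 s ×ˢ Icc α β) → ∀ τ ∈ Icc 0 s, IntervalIntegrable (G τ) volume α β :=
    fun hG τ hτ => ContinuousOn.intervalIntegrable_of_Icc hαβ
      (hG.comp (f := fun y : ℝ => (τ, y)) (by fun_prop) fun y hy => ⟨hτ, hy⟩)
  have hIτ : ∀ {G : ℝ → ℝ → State p}, ContinuousOn (fun z : ℝ × ℝ => G z.1 z.2)
      (Icc 0 s ×ˢ Icc α β) → ∀ y ∈ Icc α β, ContinuousOn (fun τ => G τ y) (Icc 0 s) :=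
    fun hG y hy => hG.comp (f := fun τ : ℝ => (τ, y)) (by fun_prop) fun τ hτ => ⟨hτ, hy⟩
  have hIo : ∀ {G : ℝ → ℝ → State p}, ContinuousOn (fun z : ℝ × ℝ => G z.1 z.2)
      (Icc 0 s ×ˢ Icc α β) → IntervalIntegrable (fun τ => ∫ y in α..β, G τ y) volume 0 s := by
    intro G hG
    rw [intervalIntegrable_iff_integrableOn_Ioc_of_le hs.le]
    simp only [intervalIntegral.integral_of_le hαβ]
    exact (hI2 hG).integral_prod_left
  have hα' : α ∈ Icc α β := left_mem_Icc.2 hαβ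
  have hβ' : β ∈ Icc α β := right_mem_Icc.2 hαβ
  have hτ0 : (0 : ℝ) ∈ Icc 0 s := left_mem_Icc.2 hs.le
  have hτs : s ∈ Icc 0 s := right_mem_Icc.2 hs.le
  -- the mass terms
  have hmass : ∫ τ in 0..s, ∫ y in α..β, ρt τ y
      = (∫ y in α..β, θ (t₀ + s) (x₀ + y) • V s) - ∫ y in α..β, θ t₀ (x₀ + y) • v := by
    have hswap : ∫ τ in 0..s, ∫ y in α..β, ρt τ y = ∫ y in α..β, ∫ τ in 0..s, ρt τ y := by
      simp only [intervalIntegral.integral_of_le hs.le, intervalIntegral.integral_of_le hαβ]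
      exact integral_integral_swap (hI2 hρc)
    have hV0 : V 0 = v := by simp [hV, correctedState]
    have hP0 := hIy (G := fun τ y => θ (t₀ + τ) (x₀ + y) • V τ) hPc 0 hτ0
    simp only [add_zero, hV0] at hP0
    rw [hswap, ← intervalIntegral.integral_sub
      (hIy (G := fun τ y => θ (t₀ + τ) (x₀ + y) • V τ) hPc s hτs) hP0]
    refine intervalIntegral.integral_congr fun y hy => ?_
    rw [uIcc_of_le hαβ] at hy
    have hFTC := intervalIntegral.integral_eq_sub_of_hasDerivAt_of_le hs.le
      (hIτ (G := fun τ y => θ (t₀ + τ) (x₀ + y) • V τ) hPc y hy)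
      (f' := fun τ => ρt τ y) (fun τ hτ => by
        have hpos : 0 < t₀ + τ := add_pos_of_nonneg_of_pos h.base_nonneg hτ.1
        have d2 : HasDerivAt V (qMap f g t₀ x₀ v) τ :=
          (((hasDerivAt_id τ).smul_const (qMap f g t₀ x₀ v)).const_add v).congr_deriv
            (one_smul _ _)
        exact ((hθ.hasDerivAt_time hpos (x₀ + y)).smul d2).congr_deriv (add_comm _ _))
      (ContinuousOn.intervalIntegrable_of_Icc hs.le (hIτ hρc y hy))
    rw [add_zero, hV0] at hFTC
    exact hFTC
  -- the flux terms
  have hflux : ∫ τ in 0..s, ∫ y in α..β, φx τ y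
      = (∫ τ in 0..s, θ (t₀ + τ) (x₀ + β) • f (t₀ + τ) (x₀ + β) (V τ))
        - ∫ τ in 0..s, θ (t₀ + τ) (x₀ + α) • f (t₀ + τ) (x₀ + α) (V τ) := by
    rw [← intervalIntegral.integral_sub
      (ContinuousOn.intervalIntegrable_of_Icc hs.le
        (hIτ (G := fun τ y => θ (t₀ + τ) (x₀ + y) • f (t₀ + τ) (x₀ + y) (V τ)) hQc β hβ'))
      (ContinuousOn.intervalIntegrable_of_Icc hs.le
        (hIτ (G := fun τ y => θ (t₀ + τ) (x₀ + y) • f (t₀ + τ) (x₀ + y) (V τ)) hQc α hα'))]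
    refine intervalIntegral.integral_congr fun τ hτ => ?_
    rw [uIcc_of_le hs.le] at hτ
    refine intervalIntegral.integral_eq_sub_of_hasDerivAt
      (f := fun y => θ (t₀ + τ) (x₀ + y) • f (t₀ + τ) (x₀ + y) (V τ)) (fun y _ => ?_)
      (hIy hφc τ hτ)
    have hf : HasDerivAt (fun y => f (t₀ + τ) y (V τ))
        (deriv (fun y => f (t₀ + τ) y (V τ)) (x₀ + y)) (x₀ + y) := by
      have hF := (h.bounds.flux_diff (t₀ + τ) (x₀ + y) (V τ) (h.time_mem hτ).1
        (mem_closedBall_zero_iff.1 (h.correctedState_mem hτ hv))).hasFDerivAt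
      have hd := HasFDerivAt.comp (f := fun y : ℝ => (y, V τ)) (x₀ + y) hF
        (hasFDerivAt_prodMk_left (x₀ + y) (V τ))
      exact hd.differentiableAt.hasDerivAt
    have d1 : HasDerivAt (fun y => θ (t₀ + τ) (x₀ + y)) (dx θ (t₀ + τ) (x₀ + y)) y :=
      (hθ.hasDerivAt_space (h.time_mem hτ).1 (x₀ + y)).comp_const_add x₀ y
    exact (d1.smul (hf.comp_const_add x₀ y)).congr_deriv (add_comm _ _)
  have hsum : ∫ τ in 0..s, ∫ y in α..β, stateIntegrand f g θ t₀ x₀ τ y v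
      = (∫ τ in 0..s, ∫ y in α..β, ρt τ y) + (∫ τ in 0..s, ∫ y in α..β, φx τ y)
        - ∫ τ in 0..s, ∫ y in α..β, e τ y := by
    rw [← intervalIntegral.integral_add (hIo hρc) (hIo hφc),
      ← intervalIntegral.integral_sub ((hIo hρc).add (hIo hφc)) (hIo hec)]
    refine intervalIntegral.integral_congr fun τ hτ => ?_
    rw [uIcc_of_le hs.le] at hτ
    simp only [hdecomp]
    rw [intervalIntegral.integral_sub ((hIy hρc τ hτ).add (hIy hφc τ hτ)) (hIy hec τ hτ),
      intervalIntegral.integral_add (hIy hρc τ hτ) (hIy hφc τ hτ)]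
  have hebound : ∀ τ ∈ Icc 0 s, ‖∫ y in α..β, e τ y‖
      ≤ normC1 θ * (2 * L * (1 + L) * (s + r)) * (β - α) := by
    intro τ hτ
    have := intervalIntegral.norm_integral_le_of_norm_le_const (a := α) (b := β) (f := e τ)
      (C := normC1 θ * (2 * L * (1 + L) * (s + r))) (fun y hy => by
        rw [uIoc_of_le hαβ] at hy
        have hy' : |y| ≤ r := abs_le.2 ⟨hα.trans hy.1.le, hy.2.trans hβ⟩
        rw [he, norm_smul]
        refine mul_le_mul (hθ.le_normC1 (h.time_mem hτ).1 _).1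
          ((h.sourceDefect_le hτ hy' hv).trans ?_) (norm_nonneg _) hΘ0
        have := hτ.2
        gcongr)
    rwa [abs_of_nonneg (by linarith)] at this
  rw [hsum, hmass, hflux]
  have := intervalIntegral.norm_integral_le_of_norm_le_const (a := 0) (b := s)
    (f := fun τ => ∫ y in α..β, e τ y)
    (C := normC1 θ * (2 * L * (1 + L) * (s + r)) * (β - α)) (fun τ hτ => by
      rw [uIoc_of_le hs.le] at hτ
      exact hebound τ (Ioc_subset_Icc_self hτ))
  rw [sub_zero, abs_of_pos hs] at this
  refine le_trans (le_of_eq ?_) this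
  rw [← norm_neg]
  congr 1
  abel

theorem intervalIntegrable_const_state (h : Cell f g T X R L ρ t₀ x₀ s r)
    {G : ℝ × ℝ × State p → State p} (hG : ContinuousOn G
      (Icc 0 s ×ˢ Icc (-r) r ×ˢ Metric.closedBall 0 ρ)) {v : State p}
    (hv : v ∈ Metric.closedBall (0 : State p) ρ) :
    (∀ τ ∈ Icc 0 s, IntervalIntegrable (fun y => G (τ, y, v)) volume (-r) 0) ∧
    (∀ τ ∈ Icc 0 s, IntervalIntegrable (fun y => G (τ, y, v)) volume 0 r) ∧
    (∀ y ∈ Icc (-r) r, IntervalIntegrable (fun τ => G (τ, y, v)) volume 0 s) ∧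
    IntervalIntegrable (fun τ => ∫ y in (-r)..0, G (τ, y, v)) volume 0 s ∧
    IntervalIntegrable (fun τ => ∫ y in 0..r, G (τ, y, v)) volume 0 s := by
  have hs := h.duration_pos
  have hr := h.width_pos
  have hcont : ContinuousOn (fun z : ℝ × ℝ => G (z.1, z.2, v)) (Icc 0 s ×ˢ Icc (-r) r) :=
    hG.comp (by fun_prop) fun z hz => ⟨hz.1, hz.2, hv⟩
  have hI2 : ∀ {α β}, -r ≤ α → β ≤ r → Integrable (fun z : ℝ × ℝ => G (z.1, z.2, v))
      ((volume.restrict (Ioc 0 s)).prod (volume.restrict (Ioc α β))) := by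
    intro α β hα hβ
    rw [Measure.prod_restrict, ← Measure.volume_eq_prod]
    exact (hcont.integrableOn_compact (isCompact_Icc.prod isCompact_Icc)).mono_set
      (prod_mono Ioc_subset_Icc_self (Ioc_subset_Icc_self.trans (Icc_subset_Icc hα hβ)))
  refine ⟨fun τ hτ => ?_, fun τ hτ => ?_, fun y hy => ?_, ?_, ?_⟩
  · exact ContinuousOn.intervalIntegrable_of_Icc (by linarith)
      (hcont.comp (f := fun y : ℝ => (τ, y)) (by fun_prop)
        fun y hy => ⟨hτ, hy.1, hy.2.trans hr.le⟩)
  · exact ContinuousOn.intervalIntegrable_of_Icc hr.le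
      (hcont.comp (f := fun y : ℝ => (τ, y)) (by fun_prop)
        fun y hy => ⟨hτ, by linarith [hy.1], hy.2⟩)
  · exact ContinuousOn.intervalIntegrable_of_Icc hs.le
      (hcont.comp (f := fun τ : ℝ => (τ, y)) (by fun_prop) fun τ hτ => ⟨hτ, hy⟩)
  · rw [intervalIntegrable_iff_integrableOn_Ioc_of_le hs.le]
    simp only [intervalIntegral.integral_of_le (show -r ≤ 0 by linarith)]
    exact (hI2 le_rfl hr.le).integral_prod_left
  · rw [intervalIntegrable_iff_integrableOn_Ioc_of_le hs.le]
    simp only [intervalIntegral.integral_of_le hr.le]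
    exact (hI2 (by linarith) le_rfl).integral_prod_left

/-- For the profile with a single jump at `ξ = 0`, the defect of the weak form is the jump of the
flux across the line `x = x₀`, up to a small source. -/
theorem defect_jumpProfile_le (h : Cell f g T X R L ρ t₀ x₀ s r) (hθ : IsTestFunction θ)
    (hL : uL ∈ Metric.closedBall (0 : State p) ρ) (hR : uR ∈ Metric.closedBall (0 : State p) ρ) :
    ‖(weakResidual f g (approxSolution f g (jumpProfile uL uR) uL uR t₀ x₀) θ t₀ x₀ s r
        - boundaryTerms f (approxSolution f g (jumpProfile uL uR) uL uR t₀ x₀) θ t₀ x₀ s r)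
      + ∫ τ in 0..s, (θ (t₀ + τ) x₀ • f (t₀ + τ) x₀ (correctedState f g t₀ x₀ τ uR)
          - θ (t₀ + τ) x₀ • f (t₀ + τ) x₀ (correctedState f g t₀ x₀ τ uL))‖
      ≤ normC1 θ * (2 * L * (1 + L) * (s + r)) * (2 * r) * s := by
  have hs := h.duration_pos
  have hr := h.width_pos
  have hτs : s ∈ Icc 0 s := right_mem_Icc.2 hs.le
  have hτ0 : (0 : ℝ) ∈ Icc 0 s := left_mem_Icc.2 hs.le
  have hjump : ∀ {τ y : ℝ}, 0 < τ →
      jumpProfile uL uR (y / τ) = if y < 0 then uL else uR := by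
    intro τ y hτ
    rw [jumpProfile]
    simp only [div_neg_iff, hτ, not_lt_of_gt hτ, and_false, and_true, false_or]
  have hite : ∀ {α : Type _} (G : State p → α) (y : ℝ),
      G (if y < 0 then uL else uR) = if y < 0 then G uL else G uR := fun G y => by
    split_ifs <;> rfl
  have hSc := h.continuousOn_stateIntegrand hθ
  have hTc : ContinuousOn (fun z : ℝ × ℝ × State p =>
      θ (t₀ + z.1) (x₀ + z.2.1) • correctedState f g t₀ x₀ z.1 z.2.2)
      (Icc 0 s ×ˢ Icc (-r) r ×ˢ Metric.closedBall 0 ρ) :=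
    (h.continuousOn_comp_base_rect hθ.continuousOn).smul h.continuousOn_correctedState_rect
  have hQc : ContinuousOn (fun z : ℝ × ℝ × State p => θ (t₀ + z.1) (x₀ + z.2.1) •
      f (t₀ + z.1) (x₀ + z.2.1) (correctedState f g t₀ x₀ z.1 z.2.2))
      (Icc 0 s ×ˢ Icc (-r) r ×ˢ Metric.closedBall 0 ρ) :=
    (h.continuousOn_comp_base_rect hθ.continuousOn).smul
      (h.continuousOn_comp_state_rect h.bounds.flux_cont)
  have hres : weakResidual f g (approxSolution f g (jumpProfile uL uR) uL uR t₀ x₀) θ t₀ x₀ s r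
      = (∫ τ in 0..s, ∫ y in (-r)..0, stateIntegrand f g θ t₀ x₀ τ y uL)
        + ∫ τ in 0..s, ∫ y in 0..r, stateIntegrand f g θ t₀ x₀ τ y uR := by
    have hIL := h.intervalIntegrable_const_state hSc hL
    have hIR := h.intervalIntegrable_const_state hSc hR
    rw [h.weakResidual_eq, ← intervalIntegral.integral_add hIL.2.2.2.1 hIR.2.2.2.2]
    refine intervalIntegral.integral_congr_ae (ae_of_all _ fun τ hτ => ?_)
    rw [uIoc_of_le hs.le] at hτ
    refine (intervalIntegral.integral_congr fun y _ => ?_).trans (integral_ite_neg hr.le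
      (hIL.1 τ (Ioc_subset_Icc_self hτ)) (hIR.2.1 τ (Ioc_subset_Icc_self hτ)))
    simp only [hjump hτ.1]
    exact hite (fun v => stateIntegrand f g θ t₀ x₀ τ y v) y
  have hTL := h.intervalIntegrable_const_state hTc hL
  have hTR := h.intervalIntegrable_const_state hTc hR
  have htop : ∫ x in (x₀ - r)..(x₀ + r), θ (t₀ + s) x •
        approxSolution f g (jumpProfile uL uR) uL uR t₀ x₀ (t₀ + s) x
      = (∫ y in (-r)..0, θ (t₀ + s) (x₀ + y) • correctedState f g t₀ x₀ s uL)
        + ∫ y in 0..r, θ (t₀ + s) (x₀ + y) • correctedState f g t₀ x₀ s uR := by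
    rw [sub_eq_add_neg, ← intervalIntegral.integral_comp_add_left]
    refine (intervalIntegral.integral_congr fun y _ => ?_).trans
      (integral_ite_neg hr.le (hTL.1 s hτs) (hTR.2.1 s hτs))
    simp only [approxSolution_add _ _ _ _ _ _ _ _ hs, hjump hs]
    exact hite (fun v => θ (t₀ + s) (x₀ + y) • correctedState f g t₀ x₀ s v) y
  have hbot : ∫ x in (x₀ - r)..(x₀ + r), θ t₀ x •
        approxSolution f g (jumpProfile uL uR) uL uR t₀ x₀ t₀ x
      = (∫ y in (-r)..0, θ t₀ (x₀ + y) • uL) + ∫ y in 0..r, θ t₀ (x₀ + y) • uR := by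
    have h1 := hTL.1 0 hτ0
    have h2 := hTR.2.1 0 hτ0
    simp only [correctedState, add_zero, zero_smul] at h1 h2
    rw [sub_eq_add_neg, ← intervalIntegral.integral_comp_add_left]
    simp only [approxSolution_base, riemannData, add_lt_iff_neg_left, smul_ite]
    exact integral_ite_neg hr.le h1 h2
  have hright : ∫ t in t₀..(t₀ + s), θ t (x₀ + r) • f t (x₀ + r)
        (approxSolution f g (jumpProfile uL uR) uL uR t₀ x₀ t (x₀ + r))
      = ∫ τ in 0..s, θ (t₀ + τ) (x₀ + r) •
          f (t₀ + τ) (x₀ + r) (correctedState f g t₀ x₀ τ uR) := by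
    have h1 := intervalIntegral.integral_comp_add_left (a := 0) (b := s)
      (fun t => θ t (x₀ + r) • f t (x₀ + r)
        (approxSolution f g (jumpProfile uL uR) uL uR t₀ x₀ t (x₀ + r))) t₀
    rw [add_zero] at h1
    rw [← h1]
    refine intervalIntegral.integral_congr_ae (ae_of_all _ fun τ hτ => ?_)
    rw [uIoc_of_le hs.le] at hτ
    rw [approxSolution_add _ _ _ _ _ _ _ _ hτ.1, hjump hτ.1, if_neg (not_lt.2 hr.le)]
  have hleft : ∫ t in t₀..(t₀ + s), θ t (x₀ - r) • f t (x₀ - r)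
        (approxSolution f g (jumpProfile uL uR) uL uR t₀ x₀ t (x₀ - r))
      = ∫ τ in 0..s, θ (t₀ + τ) (x₀ + -r) •
          f (t₀ + τ) (x₀ + -r) (correctedState f g t₀ x₀ τ uL) := by
    have h1 := intervalIntegral.integral_comp_add_left (a := 0) (b := s)
      (fun t => θ t (x₀ - r) • f t (x₀ - r)
        (approxSolution f g (jumpProfile uL uR) uL uR t₀ x₀ t (x₀ - r))) t₀
    rw [add_zero] at h1
    rw [← h1]
    refine intervalIntegral.integral_congr_ae (ae_of_all _ fun τ hτ => ?_)
    rw [uIoc_of_le hs.le] at hτ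
    rw [sub_eq_add_neg, approxSolution_add _ _ _ _ _ _ _ _ hτ.1, hjump hτ.1,
      if_pos (neg_lt_zero.2 hr)]
  have hhalfL := h.integral_integral_stateIntegrand hθ hL le_rfl (by linarith) hr.le
  have hhalfR := h.integral_integral_stateIntegrand hθ hR (by linarith) hr.le le_rfl
  have hQL := (h.intervalIntegrable_const_state hQc hL).2.2.1 0 ⟨by linarith, hr.le⟩
  have hQR := (h.intervalIntegrable_const_state hQc hR).2.2.1 0 ⟨by linarith, hr.le⟩
  simp only [add_zero] at hQL hQR hhalfL hhalfR
  rw [intervalIntegral.integral_sub hQR hQL, boundaryTerms, hres, htop, hbot, hright, hleft]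
  refine le_trans (le_of_eq ?_) ((norm_add_le _ _).trans ((add_le_add hhalfL hhalfR).trans
    (le_of_eq ?_)))
  · congr 1
    abel
  · ring

/-- The local estimate on a short cell, in terms of the total strength of the waves. -/
theorem defect_le (h : Cell f g T X R L ρ t₀ x₀ s r) (hθ : IsTestFunction θ)
    {l : Fin p → State p → ℝ} {u : Fin (p + 1) → State p} {σm σp : Fin p → ℝ}
    (hfan : RiemannFan (f t₀ x₀) l uL uR W u σm σp)
    (hW : ∀ ξ, W ξ ∈ Metric.closedBall (0 : State p) ρ)
    (hσ : ∀ i, -(r / s) ≤ σm i ∧ σp i ≤ r / s) :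
    ‖weakResidual f g (approxSolution f g W uL uR t₀ x₀) θ t₀ x₀ s r
        - boundaryTerms f (approxSolution f g W uL uR t₀ x₀) θ t₀ x₀ s r‖
      ≤ 2 * L * (1 + L) * (s * (s + r)) *
        (∑ i, waveStrength W (u i.castSucc) (u i.succ) (σm i) (σp i) + 6 * r) * normC1 θ := by
  have hs := h.duration_pos
  have hr := h.width_pos
  have ha := h.slope_pos
  have hLn := h.bounds.nonneg
  have hΘ0 := h.normC1_nonneg hθ
  have hP : IsProfile W uL uR ρ (r / s) :=
    ⟨hfan.measurable, hW, fun ξ hξ => hfan.eq_left (fun i => (hσ i).1) hξ,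
      fun ξ hξ => hfan.eq_right (fun i => (hσ i).2) hξ⟩
  have hP₀ : IsProfile (jumpProfile uL uR) uL uR ρ (r / s) :=
    isProfile_jumpProfile ha.le hP.left_mem hP.right_mem
  set TV := ∑ i, waveStrength W (u i.castSucc) (u i.succ) (σm i) (σp i) with hTV
  have hTV0 : 0 ≤ TV := Finset.sum_nonneg fun i _ => waveStrength_nonneg _ _ _ _ _
  set Jmp : ℝ → State p := fun τ =>
    θ (t₀ + τ) x₀ • f (t₀ + τ) x₀ (correctedState f g t₀ x₀ τ uR)
      - θ (t₀ + τ) x₀ • f (t₀ + τ) x₀ (correctedState f g t₀ x₀ τ uL) with hJmp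
  have hsub := h.defect_sub_defect hθ hP hP₀
  have hjump := h.defect_jumpProfile_le hθ hP.left_mem hP.right_mem
  rw [← hJmp] at hjump
  set k : (ℝ → State p) → ℝ → State p := fun W τ =>
    ∫ ξ in (-(r / s))..(r / s), weightedFluxDeriv f g θ t₀ x₀ τ ξ (W ξ) with hk
  set e : (ℝ → State p) → ℝ → State p := fun W τ => ∫ ξ in (-(r / s))..(r / s),
    (τ * θ (t₀ + τ) (x₀ + τ * ξ)) • sourceDefect f g t₀ x₀ τ (τ * ξ) (W ξ) with he
  set M : (ℝ → State p) → ℝ → State p := fun W τ =>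
    ∫ ξ in (-(r / s))..(r / s), (weightedFluxDeriv f g θ t₀ x₀ τ ξ (W ξ)
      - (τ * θ (t₀ + τ) (x₀ + τ * ξ)) • sourceDefect f g t₀ x₀ τ (τ * ξ) (W ξ)) with hM
  have hMc := h.continuousOn_weightedFluxDeriv_sub hθ
  have hM_eq : ∀ {W}, IsProfile W uL uR ρ (r / s) → ∀ τ ∈ Icc 0 s, M W τ = k W τ - e W τ := by
    intro W hW τ hτ
    have h1 := h.intervalIntegrable_ray hW (h.continuousOn_weightedFluxDeriv hθ) hτ
    have h2 := h1.sub (h.intervalIntegrable_ray hW hMc hτ)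
    simp only [sub_sub_cancel] at h2
    exact intervalIntegral.integral_sub h1 h2
  have hpt : ∀ τ ∈ Icc 0 s, ‖M W τ - M (jumpProfile uL uR) τ - Jmp τ‖
      ≤ normC1 θ * (2 * L * (1 + L) * (s * (1 + r / s))) * (TV + 4 * r) := by
    intro τ hτ
    have h1 := h.norm_integral_weightedFluxDeriv_sub_le hθ hτ hfan hW hσ
    have h2 := h.integral_weightedFluxDeriv_jumpProfile hθ hP.left_mem hP.right_mem hτ
    have h3 := h.norm_integral_sourceDefect_le hθ hP hτ
    have h4 := h.norm_integral_sourceDefect_le hθ hP₀ hτ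
    set B := θ (t₀ + τ) (x₀ + τ * (r / s)) • relFlux f g t₀ x₀ τ (r / s) uR
        - θ (t₀ + τ) (x₀ + τ * -(r / s)) • relFlux f g t₀ x₀ τ (-(r / s)) uL with hB
    have h5 : M W τ - M (jumpProfile uL uR) τ - Jmp τ
        = (k W τ - B) - (e W τ - e (jumpProfile uL uR) τ) := by
      have h6 : k (jumpProfile uL uR) τ = B - Jmp τ := h2
      rw [hM_eq hP τ hτ, hM_eq hP₀ τ hτ, h6]
      abel
    have hτ0 := hτ.1
    have hmono : normC1 θ * (2 * L * (1 + L) * (τ * (1 + r / s)))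
        ≤ normC1 θ * (2 * L * (1 + L) * (s * (1 + r / s))) := by
      have := hτ.2
      gcongr
    have hτr : τ * (2 * (r / s)) ≤ 2 * r := by
      have := h.abs_ray_le hτ (abs_of_pos ha).le
      have := le_abs_self (τ * (r / s))
      linarith
    rw [h5]
    calc _ ≤ ‖k W τ - B‖ + (‖e W τ‖ + ‖e (jumpProfile uL uR) τ‖) :=
          (norm_sub_le _ _).trans (add_le_add le_rfl (norm_sub_le _ _))
      _ ≤ normC1 θ * (2 * L * (1 + L) * (τ * (1 + r / s))) * TV
          + (τ * normC1 θ * (2 * L * (1 + L) * (τ * (1 + r / s))) * (2 * (r / s))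
            + τ * normC1 θ * (2 * L * (1 + L) * (τ * (1 + r / s))) * (2 * (r / s))) :=
          add_le_add h1 (add_le_add h3 h4)
      _ = normC1 θ * (2 * L * (1 + L) * (τ * (1 + r / s))) * (TV + 2 * (τ * (2 * (r / s)))) := by
          ring
      _ ≤ normC1 θ * (2 * L * (1 + L) * (s * (1 + r / s))) * (TV + 2 * (2 * r)) := by gcongr
      _ = _ := by ring
  have hMI : ∀ {W}, IsProfile W uL uR ρ (r / s) → IntervalIntegrable (M W) volume 0 s :=
    fun hW => h.intervalIntegrable_integral_ray hW hMc
  have hJI : IntervalIntegrable Jmp volume 0 s := by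
    have hQc : ContinuousOn (fun z : ℝ × ℝ × State p => θ (t₀ + z.1) (x₀ + z.2.1) •
        f (t₀ + z.1) (x₀ + z.2.1) (correctedState f g t₀ x₀ z.1 z.2.2))
        (Icc 0 s ×ˢ Icc (-r) r ×ˢ Metric.closedBall 0 ρ) :=
      (h.continuousOn_comp_base_rect hθ.continuousOn).smul
        (h.continuousOn_comp_state_rect h.bounds.flux_cont)
    have hQL := (h.intervalIntegrable_const_state hQc hP.left_mem).2.2.1 0 ⟨by linarith, hr.le⟩
    have hQR := (h.intervalIntegrable_const_state hQc hP.right_mem).2.2.1 0 ⟨by linarith, hr.le⟩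
    simp only [add_zero] at hQL hQR
    exact hQR.sub hQL
  have hint := intervalIntegral.norm_integral_le_of_norm_le_const (a := 0) (b := s)
    (f := fun τ => M W τ - M (jumpProfile uL uR) τ - Jmp τ)
    (C := normC1 θ * (2 * L * (1 + L) * (s * (1 + r / s))) * (TV + 4 * r)) (fun τ hτ => by
      rw [uIoc_of_le hs.le] at hτ
      exact hpt τ (Ioc_subset_Icc_self hτ))
  rw [intervalIntegral.integral_sub ((hMI hP).sub (hMI hP₀)) hJI, ← hsub, sub_zero,
    abs_of_pos hs] at hint
  set D := weakResidual f g (approxSolution f g W uL uR t₀ x₀) θ t₀ x₀ s r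
    - boundaryTerms f (approxSolution f g W uL uR t₀ x₀) θ t₀ x₀ s r
  set D₀ := weakResidual f g (approxSolution f g (jumpProfile uL uR) uL uR t₀ x₀) θ t₀ x₀ s r
    - boundaryTerms f (approxSolution f g (jumpProfile uL uR) uL uR t₀ x₀) θ t₀ x₀ s r
  have hsr : s * (1 + r / s) = s + r := by field_simp
  rw [hsr] at hint
  have hD : D = (D - D₀ - ∫ τ in 0..s, Jmp τ) + (D₀ + ∫ τ in 0..s, Jmp τ) := by abel
  rw [hD]
  exact ((norm_add_le _ _).trans (add_le_add hint hjump)).trans (le_of_eq (by ring))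

end Cell

/-! ### Existence of the integrals and the estimate on long cells -/

section Existence

variable {p : ℕ} {f g : ℝ → ℝ → State p → State p} {θ : ℝ → ℝ → ℝ} {V : ℝ → ℝ → State p}
  {t₀ x₀ s r : ℝ}

theorem measurable_approxSolution {W : ℝ → State p} (hW : Measurable W) {S : Set (State p)}
    (hS : MeasurableSet S) (hWS : ∀ ξ, W ξ ∈ S) (hq : ContinuousOn (qMap f g t₀ x₀) S)
    (uL uR : State p) :
    Measurable fun z : ℝ × ℝ => approxSolution f g W uL uR t₀ x₀ z.1 z.2 := by
  classical
  have hqW : Measurable fun ξ => qMap f g t₀ x₀ (W ξ) := by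
    have h1 : Measurable (S.piecewise (qMap f g t₀ x₀) fun _ => 0) :=
      hq.measurable_piecewise continuousOn_const hS
    have heq : (fun ξ => qMap f g t₀ x₀ (W ξ)) = S.piecewise (qMap f g t₀ x₀) (fun _ => 0) ∘ W :=
      funext fun ξ => (Set.piecewise_eq_of_mem _ _ _ (hWS ξ)).symm
    rw [heq]
    exact h1.comp hW
  have hξ : Measurable fun z : ℝ × ℝ => (z.2 - x₀) / (z.1 - t₀) := by fun_prop
  refine Measurable.ite (measurableSet_le measurable_fst measurable_const) ?_ ?_
  · exact Measurable.ite (measurableSet_lt measurable_snd measurable_const) measurable_const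
      measurable_const
  · exact (hW.comp hξ).add ((by fun_prop : Measurable fun z : ℝ × ℝ => z.1 - t₀).smul
      (hqW.comp hξ))

theorem integralsExist_of_mem_compact
    (hV : Measurable fun z : ℝ × ℝ => V z.1 z.2) {K : Set (State p)} (hK : IsCompact K)
    (hf : ContinuousOn (fun z : ℝ × ℝ × State p => f z.1 z.2.1 z.2.2) (phaseDomain K))
    (hg : ContinuousOn (fun z : ℝ × ℝ × State p => g z.1 z.2.1 z.2.2) (phaseDomain K))
    (hθ : IsTestFunction θ) (ht₀ : 0 ≤ t₀) (hs : 0 < s) (hr : 0 < r)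
    (hVK : ∀ t ∈ Icc t₀ (t₀ + s), ∀ x ∈ Icc (x₀ - r) (x₀ + r), V t x ∈ K) :
    IntegralsExist f g V θ t₀ x₀ s r := by
  set S : Set (ℝ × ℝ × State p) := Icc t₀ (t₀ + s) ×ˢ Icc (x₀ - r) (x₀ + r) ×ˢ K with hSdef
  have hS : IsCompact S := isCompact_Icc.prod (isCompact_Icc.prod hK)
  have hSD : S ⊆ phaseDomain K := fun z hz => ⟨ht₀.trans hz.1.1, mem_univ _, hz.2.2⟩
  have hb : ∀ {φ : ℝ × ℝ → ℝ}, ContinuousOn φ (Ici (0 : ℝ) ×ˢ univ) →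
      ContinuousOn (fun z : ℝ × ℝ × State p => φ (z.1, z.2.1)) S := fun hφ =>
    hφ.comp (by fun_prop) fun z hz => ⟨ht₀.trans hz.1.1, mem_univ _⟩
  have hv : ContinuousOn (fun z : ℝ × ℝ × State p => z.2.2) S := by fun_prop
  have h1 := ((hb hθ.continuousOn_dt).smul hv).add
    (((hb hθ.continuousOn_dx).smul (hf.mono hSD)).add ((hb hθ.continuousOn).smul (hg.mono hSD)))
  have h2 := (hb hθ.continuousOn).smul hv
  have h3 := (hb hθ.continuousOn).smul (hf.mono hSD)
  have hx : ∀ t, Measurable fun x : ℝ => (t, x, V t x) := fun t =>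
    measurable_const.prodMk (measurable_id.prodMk (hV.comp (measurable_const.prodMk measurable_id)))
  have ht : ∀ x, Measurable fun t : ℝ => (t, x, V t x) := fun x =>
    measurable_id.prodMk (measurable_const.prodMk
      (hV.comp (measurable_id.prodMk measurable_const)))
  have htop : t₀ + s ∈ Icc t₀ (t₀ + s) := ⟨by linarith, le_rfl⟩
  have hbot : t₀ ∈ Icc t₀ (t₀ + s) := ⟨le_rfl, by linarith⟩
  have hright : x₀ + r ∈ Icc (x₀ - r) (x₀ + r) := ⟨by linarith, le_rfl⟩
  have hleft : x₀ - r ∈ Icc (x₀ - r) (x₀ + r) := ⟨le_rfl, by linarith⟩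
  refine ⟨?_, ?_, ?_, ?_, ?_⟩
  · refine (integrableOn_comp_of_continuousOn hS h1 (m := fun z : ℝ × ℝ => (z.1, z.2, V z.1 z.2))
      (measurable_fst.prodMk (measurable_snd.prodMk hV)) (measurableSet_Icc.prod measurableSet_Icc)
      (isCompact_Icc.prod isCompact_Icc).measure_lt_top
      fun z hz => ⟨hz.1, hz.2, hVK _ hz.1 _ hz.2⟩).congr_fun (fun z _ => ?_)
      (measurableSet_Icc.prod measurableSet_Icc)
    rw [weakIntegrand, add_assoc]
    rfl
  · rw [intervalIntegrable_iff_integrableOn_Icc_of_le (by linarith)]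
    exact integrableOn_comp_of_continuousOn hS h2 (hx (t₀ + s)) measurableSet_Icc
      isCompact_Icc.measure_lt_top fun x hx => ⟨htop, hx, hVK _ htop _ hx⟩
  · rw [intervalIntegrable_iff_integrableOn_Icc_of_le (by linarith)]
    exact integrableOn_comp_of_continuousOn hS h2 (hx t₀) measurableSet_Icc
      isCompact_Icc.measure_lt_top fun x hx => ⟨hbot, hx, hVK _ hbot _ hx⟩
  · rw [intervalIntegrable_iff_integrableOn_Icc_of_le (by linarith)]
    exact integrableOn_comp_of_continuousOn hS h3 (ht (x₀ + r)) measurableSet_Icc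
      isCompact_Icc.measure_lt_top fun t ht => ⟨ht, hright, hVK _ ht _ hright⟩
  · rw [intervalIntegrable_iff_integrableOn_Icc_of_le (by linarith)]
    exact integrableOn_comp_of_continuousOn hS h3 (ht (x₀ - r)) measurableSet_Icc
      isCompact_Icc.measure_lt_top fun t ht => ⟨ht, hleft, hVK _ ht _ hleft⟩

/-- The crude bound of the defect by the sizes of the integrands; it suffices for cells whose
duration is bounded below. -/
theorem defect_le_of_bounded {M : ℝ} (hθ : IsTestFunction θ) (ht₀ : 0 ≤ t₀)
    (hs : 0 < s) (hr : 0 < r)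
    (hb : ∀ t ∈ Icc t₀ (t₀ + s), ∀ x ∈ Icc (x₀ - r) (x₀ + r),
      ‖V t x‖ ≤ M ∧ ‖f t x (V t x)‖ ≤ M ∧ ‖g t x (V t x)‖ ≤ M) :
    ‖weakResidual f g V θ t₀ x₀ s r - boundaryTerms f V θ t₀ x₀ s r‖
      ≤ M * (6 * (r * s) + 4 * r + 2 * s) * normC1 θ := by
  have hθb : ∀ {t}, t ∈ Icc t₀ (t₀ + s) → ∀ x, |θ t x| ≤ normC1 θ ∧ |dt θ t x| ≤ normC1 θ ∧
      |dx θ t x| ≤ normC1 θ := fun ht x => hθ.le_normC1 (ht₀.trans ht.1) x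
  have htop : t₀ + s ∈ Icc t₀ (t₀ + s) := ⟨by linarith, le_rfl⟩
  have hbot : t₀ ∈ Icc t₀ (t₀ + s) := ⟨le_rfl, by linarith⟩
  have hright : x₀ + r ∈ Icc (x₀ - r) (x₀ + r) := ⟨by linarith, le_rfl⟩
  have hleft : x₀ - r ∈ Icc (x₀ - r) (x₀ + r) := ⟨le_rfl, by linarith⟩
  have hΘ0 : 0 ≤ normC1 θ := (abs_nonneg _).trans (hθb hbot 0).1
  have hprod : ∀ {c : ℝ} {v : State p}, |c| ≤ normC1 θ → ‖v‖ ≤ M → ‖c • v‖ ≤ normC1 θ * M :=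
    fun hc hv => by
      rw [norm_smul]
      exact mul_le_mul hc hv (norm_nonneg _) hΘ0
  have hspace : ∀ {φ : ℝ → State p} {B : ℝ}, (∀ x ∈ Icc (x₀ - r) (x₀ + r), ‖φ x‖ ≤ B) →
      ‖∫ x in (x₀ - r)..(x₀ + r), φ x‖ ≤ B * (2 * r) := by
    intro φ B hφ
    have := intervalIntegral.norm_integral_le_of_norm_le_const (a := x₀ - r) (b := x₀ + r)
      (f := φ) (C := B) fun x hx => by
        rw [uIoc_of_le (by linarith)] at hx
        exact hφ x (Ioc_subset_Icc_self hx)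
    rwa [show x₀ + r - (x₀ - r) = 2 * r by ring, abs_of_pos (by linarith)] at this
  have htime : ∀ {φ : ℝ → State p} {B : ℝ}, (∀ t ∈ Icc t₀ (t₀ + s), ‖φ t‖ ≤ B) →
      ‖∫ t in t₀..(t₀ + s), φ t‖ ≤ B * s := by
    intro φ B hφ
    have := intervalIntegral.norm_integral_le_of_norm_le_const (a := t₀) (b := t₀ + s)
      (f := φ) (C := B) fun t ht => by
        rw [uIoc_of_le (by linarith)] at ht
        exact hφ t (Ioc_subset_Icc_self ht)
    rwa [add_sub_cancel_left, abs_of_pos hs] at this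
  have h1 : ‖weakResidual f g V θ t₀ x₀ s r‖ ≤ 3 * (normC1 θ * M) * (2 * r) * s := by
    refine htime fun t ht => hspace fun x hx => ?_
    obtain ⟨b1, b2, b3⟩ := hb t ht x hx
    obtain ⟨c1, c2, c3⟩ := hθb ht x
    refine (norm_add₃_le).trans ?_
    have := hprod c2 b1
    have := hprod c3 b2
    have := hprod c1 b3
    linarith
  have h2 := hspace fun x hx => hprod (hθb htop x).1 (hb _ htop x hx).1
  have h3 := hspace fun x hx => hprod (hθb hbot x).1 (hb _ hbot x hx).1
  have h4 := htime fun t ht => hprod (hθb ht (x₀ + r)).1 (hb t ht _ hright).2.1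
  have h5 := htime fun t ht => hprod (hθb ht (x₀ - r)).1 (hb t ht _ hleft).2.1
  have h6 := norm_sub_le (weakResidual f g V θ t₀ x₀ s r) (boundaryTerms f V θ t₀ x₀ s r)
  have h7 : ‖boundaryTerms f V θ t₀ x₀ s r‖ ≤ normC1 θ * M * (2 * r) + normC1 θ * M * (2 * r)
      + normC1 θ * M * s + normC1 θ * M * s := by
    unfold boundaryTerms
    exact (norm_sub_le _ _).trans (add_le_add ((norm_add_le _ _).trans
      (add_le_add ((norm_sub_le _ _).trans (add_le_add h2 h3)) h4)) h5)
  linarith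

end Existence

theorem proposition2p1 {p : ℕ} (f g : ℝ → ℝ → State p → State p)
    (lam : Fin p → ℝ → ℝ → State p → ℝ) (Ω : Set (State p)) (hΩ : IsOpen Ω)
    (h0 : (0 : State p) ∈ Ω) (hsys : IsHyperbolicSystem f g lam Ω) (T X : ℝ) :
    ∃ δ : ℝ, 0 < δ ∧ Metric.closedBall (0 : State p) δ ⊆ Ω ∧
      ∀ K : Set (State p), IsCompact K → K ⊆ Ω → ∃ C : ℝ,
      ∀ U : Set (State p), U ∈ 𝓝 (0 : State p) → U ⊆ Metric.closedBall (0 : State p) δ →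
      ∀ θ : ℝ → ℝ → ℝ, IsTestFunction θ →
      ∀ t₀ x₀ : ℝ, 0 ≤ t₀ → ∀ uL ∈ U, ∀ uR ∈ U,
      ∀ W : ℝ → State p,
        IsClassicalRiemannSolution (f t₀ x₀) (fun i => lam i t₀ x₀) uL uR W →
        (∀ ξ : ℝ, W ξ ∈ U) →
      ∀ s r : ℝ, 0 < s → 0 < r → t₀ + s ≤ T → |x₀| + r ≤ X →
        (∀ i : Fin p, ∀ t : ℝ, 0 ≤ t → ∀ x : ℝ, ∀ u ∈ U, s / r * |lam i t x u| ≤ 1) →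
        (∀ t ∈ Icc t₀ (t₀ + s), ∀ x ∈ Icc (x₀ - r) (x₀ + r),
          approxSolution f g W uL uR t₀ x₀ t x ∈ K) →
        IntegralsExist f g (approxSolution f g W uL uR t₀ x₀) θ t₀ x₀ s r ∧
        ‖weakResidual f g (approxSolution f g W uL uR t₀ x₀) θ t₀ x₀ s r
            - boundaryTerms f (approxSolution f g W uL uR t₀ x₀) θ t₀ x₀ s r‖
          ≤ C * (s ^ 2 + r ^ 2) * (s + r + ‖uR - uL‖) * normC1 θ := by
  obtain ⟨ε, hε, C₁, hC₁, hTV⟩ := exists_sum_strength_le hΩ h0 hsys T X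
  obtain ⟨ε', hε', hball⟩ := Metric.isOpen_iff.1 hΩ 0 h0
  -- the factor `3` leaves room for the closed ball of radius `2 * δ` inside `Ω`
  set δ := min ε (ε' / 3) with hδ
  have hδ0 : 0 < δ := by positivity
  have hδε : δ ≤ ε := min_le_left _ _
  have hδε' : 2 * δ < ε' := by have := min_le_right ε (ε' / 3); linarith
  have hRΩ : Metric.closedBall (0 : State p) (2 * δ) ⊆ Ω :=
    (Metric.closedBall_subset_ball hδε').trans hball
  have hδR : Metric.closedBall (0 : State p) δ ⊆ Metric.closedBall 0 (2 * δ) :=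
    Metric.closedBall_subset_closedBall (by linarith)
  obtain ⟨L, hLb⟩ := exists_localBounds hΩ hsys.smooth_flux hsys.smooth_source T X hRΩ
  have hL0 := hLb.nonneg
  refine ⟨δ, hδ0, hδR.trans hRΩ, fun K hK hKΩ => ?_⟩
  have hKD : phaseDomain K ⊆ phaseDomain Ω := prod_mono le_rfl (prod_mono le_rfl hKΩ)
  have hfK := hsys.smooth_flux.continuousOn.mono hKD
  have hgK := hsys.smooth_source.continuousOn.mono hKD
  obtain ⟨M, hM0, hM⟩ : ∃ M : ℝ, 0 ≤ M ∧ ∀ t ∈ Icc 0 T, ∀ x ∈ Icc (-X) X, ∀ v ∈ K,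
      ‖v‖ ≤ M ∧ ‖f t x v‖ ≤ M ∧ ‖g t x v‖ ≤ M := by
    have hZ : IsCompact (Icc 0 T ×ˢ Icc (-X) X ×ˢ K) :=
      isCompact_Icc.prod (isCompact_Icc.prod hK)
    have hZD : Icc 0 T ×ˢ Icc (-X) X ×ˢ K ⊆ phaseDomain K :=
      fun z hz => ⟨hz.1.1, mem_univ _, hz.2.2⟩
    obtain ⟨M₁, hM₁⟩ := hZ.exists_bound_of_continuousOn (hfK.mono hZD)
    obtain ⟨M₂, hM₂⟩ := hZ.exists_bound_of_continuousOn (hgK.mono hZD)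
    obtain ⟨M₃, hM₃⟩ := hK.exists_bound_of_continuousOn continuousOn_id
    refine ⟨max 0 (max M₃ (max M₁ M₂)), le_max_left _ _, fun t ht x hx v hv => ⟨?_, ?_, ?_⟩⟩
    · exact (hM₃ v hv).trans (by simp)
    · exact (hM₁ (t, x, v) ⟨ht, hx, hv⟩).trans (by simp)
    · exact (hM₂ (t, x, v) ⟨ht, hx, hv⟩).trans (by simp)
  -- for durations up to `δ / (L + 1)` the corrected states stay in the ball of radius `2 * δ`
  set s₀ := δ / (L + 1) with hs₀
  have hs₀pos : 0 < s₀ := by positivity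
  set A := 4 * L * (1 + L) * (C₁ + 6) with hA
  set B := M * |6 * (X * T) + 4 * X + 2 * T| / s₀ ^ 3 with hB
  have hA0 : 0 ≤ A := by positivity
  have hB0 : 0 ≤ B := by positivity
  refine ⟨A + B, ?_⟩
  intro U _ hUδ θ hθ t₀ x₀ ht₀ uL _ uR _ W hRiem hWU s r hs hr htT hxX hCFL hVK
  obtain ⟨u, σm, σp, h1, h2, h3, h4, h5⟩ := hRiem
  have hfan : RiemannFan (f t₀ x₀) (fun i => lam i t₀ x₀) uL uR W u σm σp := ⟨h1, h2, h3, h4, h5⟩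
  have hWδ : ∀ ξ, W ξ ∈ Metric.closedBall (0 : State p) δ := fun ξ => hUδ (hWU ξ)
  have hq : ContinuousOn (qMap f g t₀ x₀) (Metric.closedBall 0 δ) := fun v hv =>
    (hLb.q_diff t₀ x₀ v ht₀
      (mem_closedBall_zero_iff.1 (hδR hv))).continuousAt.continuousWithinAt
  refine ⟨integralsExist_of_mem_compact
    (measurable_approxSolution hfan.measurable Metric.isClosed_closedBall.measurableSet hWδ hq uL uR)
    hK hfK hgK hθ ht₀ hs hr hVK, ?_⟩
  have hΘ0 : 0 ≤ normC1 θ := (abs_nonneg _).trans (hθ.le_normC1 ht₀ 0).1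
  have hd0 := norm_nonneg (uR - uL)
  have hx₀ := abs_nonneg x₀
  rcases le_or_gt s s₀ with hss₀ | hss₀
  · have hcell : Cell f g T X (2 * δ) L δ t₀ x₀ s r := by
      refine ⟨hLb, ht₀, hs, hr, htT, hxX, ?_⟩
      have h6 : s₀ * (L + 1) = δ := div_mul_cancel₀ _ (by positivity)
      have h7 : s * L ≤ s₀ * L := mul_le_mul_of_nonneg_right hss₀ hL0
      linarith
    have hspeed : ∀ i, ∀ v ∈ U, |lam i t₀ x₀ v| ≤ r / s := by
      intro i v hv
      have := hCFL i t₀ ht₀ x₀ v hv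
      rw [div_mul_eq_mul_div, div_le_one hr] at this
      rw [le_div_iff₀ hs]
      linarith
    refine (hcell.defect_le hθ hfan hWδ (hfan.speed_mem hWU hspeed)).trans ?_
    have hstr := hTV (t₀, x₀) ⟨hcell.base_mem, hcell.center_mem⟩ uL uR W u σm σp hfan
      fun ξ => Metric.closedBall_subset_closedBall hδε (hWδ ξ)
    have h6 : s * (s + r) ≤ 2 * (s ^ 2 + r ^ 2) := by nlinarith [sq_nonneg (s - r)]
    have h7 : ∑ i, waveStrength W (u i.castSucc) (u i.succ) (σm i) (σp i) + 6 * r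
        ≤ (C₁ + 6) * (s + r + ‖uR - uL‖) := by
      have := mul_nonneg hC₁ (add_pos hs hr).le
      linarith
    have h9 : 0 ≤ ∑ i, waveStrength W (u i.castSucc) (u i.succ) (σm i) (σp i) + 6 * r :=
      add_nonneg (Finset.sum_nonneg fun i _ => waveStrength_nonneg _ _ _ _ _) (by linarith)
    have h8 : 0 ≤ (C₁ + 6) * (s + r + ‖uR - uL‖) := by positivity
    calc _ ≤ 2 * L * (1 + L) * (2 * (s ^ 2 + r ^ 2)) * ((C₁ + 6) * (s + r + ‖uR - uL‖))
          * normC1 θ := by gcongr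
      _ = A * (s ^ 2 + r ^ 2) * (s + r + ‖uR - uL‖) * normC1 θ := by rw [hA]; ring
      _ ≤ _ := by gcongr; linarith
  · have hbd : ∀ t ∈ Icc t₀ (t₀ + s), ∀ x ∈ Icc (x₀ - r) (x₀ + r),
        ‖approxSolution f g W uL uR t₀ x₀ t x‖ ≤ M ∧
        ‖f t x (approxSolution f g W uL uR t₀ x₀ t x)‖ ≤ M ∧
        ‖g t x (approxSolution f g W uL uR t₀ x₀ t x)‖ ≤ M := by
      intro t ht x hx
      have h6 := abs_le.1 (le_refl |x₀|)
      exact hM t ⟨ht₀.trans ht.1, ht.2.trans htT⟩ x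
        ⟨by linarith [hx.1], by linarith [hx.2]⟩ _ (hVK t ht x hx)
    refine (defect_le_of_bounded hθ ht₀ hs hr hbd).trans ?_
    have hrX : r ≤ X := by linarith
    have hsT : s ≤ T := by linarith
    have h6 : 6 * (r * s) + 4 * r + 2 * s ≤ |6 * (X * T) + 4 * X + 2 * T| := by
      refine le_trans ?_ (le_abs_self _)
      have : r * s ≤ X * T := mul_le_mul hrX hsT hs.le (hr.le.trans hrX)
      linarith
    have h7 : s₀ ^ 3 ≤ (s ^ 2 + r ^ 2) * (s + r + ‖uR - uL‖) :=
      calc s₀ ^ 3 ≤ s ^ 3 := by gcongr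
        _ = s ^ 2 * s := by ring
        _ ≤ _ := by gcongr <;> nlinarith
    calc _ ≤ M * |6 * (X * T) + 4 * X + 2 * T| * normC1 θ := by gcongr
      _ = B * s₀ ^ 3 * normC1 θ := by rw [hB, div_mul_cancel₀ _ (by positivity)]
      _ ≤ B * ((s ^ 2 + r ^ 2) * (s + r + ‖uR - uL‖)) * normC1 θ := by gcongr
      _ = B * (s ^ 2 + r ^ 2) * (s + r + ‖uR - uL‖) * normC1 θ := by ring
      _ ≤ _ := by gcongr; linarith
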